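/- **Kinetic De Giorgi intermediate value lemma.** Let $d\ge 1$. Write $z=(t,x,v)\in\mathbb R\times\mathbb R^d\times\mathbb R^d$, let $|\cdot|$ be Lebesgue measure, and for $r>0$ set $$Q_r=(-r^2,0]\times B_{r^3}\times B_r,\qquad Q_r^-=\{(t,x,v):\ -3r^2<t<-2r^2,\ |x|<r^3,\ |v|<r\},$$ where $B_\rho$ is the open ball of radius $\rho$ centred at $0$ in $\mathbb R^d$. For a measurable field $A$ of symmetric matrices on $Q_2$, a *weak subsolution* over $Q_2$ of $$\partial_t f+v\cdot\nabla_x f\le\nabla_v\cdot(A\nabla_v f)$$ is a function $f\in L^2(Q_2)$ with distributional gradient $\nabla_v f\in L^2(Q_2)$ such that $$-\int_{Q_2} f\,(\partial_t\varphi+v\cdot\nabla_x\varphi)\,dz\le-\int_{Q_2}A\nabla_v f\cdot\nabla_v\varphi\,dz$$ for every non-negative $\varphi\in C_c^\infty$ supported in the interior of $Q_2$. Given $\Lambda>0$, there is $c\in(0,1)$, depending only on $\Lambda$ and $d$, such that for all $\delta_1,\delta_2\in(0,1)$ the numbers $\theta=c\,\delta_1\delta_2$ and $\nu=c\,(\delta_1\delta_2)^2$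 lie in $(0,1)$ and the following holds. Let $r=1/20$, let $A$ be a measurable field of symmetric matrices with $\Lambda^{-1}\le A\le\Lambda$ almost everywhere in $Q_2$, and let $f$ be a weak subsolution over $Q_2$ with $f\le 1$ almost everywhere in $Q_2$, $$|\{f\le 0\}\cap Q_r^-|\ge\delta_1|Q_r^-|\qquad\text{and}\qquad|\{f\ge 1-\theta\}\cap Q_r|\ge\delta_2|Q_r|.$$ Then $$|\{0<f<1-\theta\}\cap Q_1|\ge\nu\,|Q_1|.$$ -/

import Mathlib

open MeasureTheory
open scoped ContDiff Matrix

namespace KineticDeGiorgi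

/-- The space `ℝ^d` of positions, or of velocities, with its Euclidean norm. -/
abbrev E (d : ℕ) : Type := EuclideanSpace ℝ (Fin d)

/-- The space `ℝ^{1+2d}` of the variables `z = (t, x, v)`; its `volume` is Lebesgue measure. -/
abbrev Z (d : ℕ) : Type := ℝ × E d × E d

/-- The kinetic cylinder `Q_r = (-r², 0] × B_{r³} × B_r`. -/
def cyl (d : ℕ) (r : ℝ) : Set (Z d) :=
  Set.Ioc (-r ^ 2) 0 ×ˢ Metric.ball (0 : E d) (r ^ 3) ×ˢ Metric.ball (0 : E d) r

/-- The past cylinder `Q_r⁻ = {-3r² < t < -2r², |x| < r³, |v| < r}`. -/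
def pastCyl (d : ℕ) (r : ℝ) : Set (Z d) :=
  Set.Ioo (-3 * r ^ 2) (-2 * r ^ 2) ×ˢ Metric.ball (0 : E d) (r ^ 3) ×ˢ Metric.ball (0 : E d) r

/-- `φ` is a test function in `U`: smooth, with compact support in the interior of `U`. -/
structure IsTestFun {d : ℕ} (U : Set (Z d)) (φ : Z d → ℝ) : Prop where
  smooth : ContDiff ℝ ∞ φ
  compact_supp : HasCompactSupport φ
  supp_subset : tsupport φ ⊆ interior U

/-- The transport derivative `𝒯φ = ∂_t φ + v · ∇_x φ` at `z = (t, x, v)`, that is, the derivative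
of `φ` in the direction `(1, v, 0)`. -/
noncomputable def transport {d : ℕ} (φ : Z d → ℝ) (z : Z d) : ℝ :=
  fderiv ℝ φ z (1, z.2.2, 0)

/-- The velocity derivative `w · ∇_v φ` at `z`, that is, the derivative of `φ` in the
direction `(0, 0, w)`. -/
noncomputable def velDeriv {d : ℕ} (φ : Z d → ℝ) (z : Z d) (w : E d) : ℝ :=
  fderiv ℝ φ z (0, 0, w)

/-- `G` is the velocity gradient `∇_v f` of `f` in the sense of distributions in `U`. -/
def IsWeakVelGrad {d : ℕ} (U : Set (Z d)) (f : Z d → ℝ) (G : Z d → E d) : Prop :=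
  ∀ φ : Z d → ℝ, IsTestFun U φ → ∀ w : E d,
    ∫ z in U, f z * velDeriv φ z w = - ∫ z in U, inner ℝ (G z) w * φ z

/-- `A` is a symmetric measurable matrix field with `Λ⁻¹ ≤ A ≤ Λ` almost everywhere in `U`. -/
structure IsElliptic {d : ℕ} (Λ : ℝ) (U : Set (Z d))
    (A : Z d → Matrix (Fin d) (Fin d) ℝ) : Prop where
  measurable : ∀ i j, AEMeasurable (fun z => A z i j) (volume.restrict U)
  symm : ∀ᵐ z ∂(volume.restrict U), (A z).IsSymm
  bounds : ∀ᵐ z ∂(volume.restrict U), ∀ ξ : E d,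
    Λ⁻¹ * ‖ξ‖ ^ 2 ≤ inner ℝ (Matrix.toEuclideanLin (A z) ξ) ξ ∧
      inner ℝ (Matrix.toEuclideanLin (A z) ξ) ξ ≤ Λ * ‖ξ‖ ^ 2

/-- `f` is a weak subsolution in `U` of `∂_t f + v · ∇_x f ≤ ∇_v · (A ∇_v f)`: both `f` and its
distributional velocity gradient `G = ∇_v f` are square integrable in `U`, and the inequality
holds against all non-negative test functions,
`-∫ f 𝒯φ ≤ -∫ (A ∇_v f) · ∇_v φ`. -/
def IsWeakSubsolution {d : ℕ} (U : Set (Z d)) (A : Z d → Matrix (Fin d) (Fin d) ℝ)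
    (f : Z d → ℝ) : Prop :=
  MemLp f 2 (volume.restrict U) ∧
  ∃ G : Z d → E d, MemLp G 2 (volume.restrict U) ∧ IsWeakVelGrad U f G ∧
    ∀ φ : Z d → ℝ, IsTestFun U φ → (∀ z, 0 ≤ φ z) →
      - ∫ z in U, f z * transport φ z ≤
        - ∫ z in U, velDeriv φ z (Matrix.toEuclideanLin (A z) (G z))

end KineticDeGiorgi

namespace KineticDeGiorgi

open Set Filter Topology Function
open scoped ENNReal

/-! ### The Galilean group: law, inverse, invariance of Lebesgue measure -/

section

variable {d : ℕ}

/-! The argument is constructive: no compactness is used, and the dependence on δ₁δ₂ is explicit. It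
works with u = `profile` ∘ f, where `profile` is smooth, nondecreasing, zero on (-∞, 0] and convex
on the range of f. By `IsDivSubsolution.renormalize`, u is again a subsolution, up to a dissipation
term of favourable sign. Two estimates on u are played against each other.

The first says that ∇_v u is small in L¹ (`exists_gradient_bound`). It vanishes where f ≤ 0. On W =
{0 < f < 1 - θ} the energy estimate `exists_energy_bound` controls it in L², so Cauchy–Schwarz gives
a bound by √|W|. On {f ≥ 1 - θ} the same energy estimate is applied to a profile rescaled to start
at the level 1 - 2θ; as f ≤ 1, the energy there is O(θ²). In total, ‖∇_v u‖ in L¹ is at most a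
constant times √|W| + θ.

The second says that u(z) exceeds a weighted mean of u in the past of z by at most an integral of
|∇_v u| against a kernel (`exists_kernel_inequality`). In place of a fundamental solution, the test
function is built from an explicit compactly supported density `kolm`. At time -τ it lives on |x| ≲
τ^(3/2), |v| ≲ τ^(1/2), it concentrates at the origin as τ → 0 with constant mass, and it satisfies
𝒯 kolm = ∇_v · (kolm drift) with 𝒯 = ∂_t + v · ∇_x. Translated to z by the Galilean group and cut
off in time, it exchanges the mean of u near z for the mean in the past, at the price of velocity
derivatives only; these are integrated by parts onto u. The kernel is of size τ^(-2d-1/2) on slices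
of volume comparable to τ^(2d), hence integrable (`lintegral_kernel_lt_top`), and integrating the
inequality in z costs a constant (`lintegral_lintegral_kernel_le`).

Every point of Q_r sees all of Q_r⁻ with a density bounded below (`one_le_kolm`), so the past mean
falls short of its maximum by a multiple of |{f ≤ 0} ∩ Q_r⁻| (`exists_final_mean_le`), whereas u is
within 3θ of its maximum on {f ≥ 1 - θ} ∩ Q_r. Integrating over the latter set gives
`exists_intermediate_value_bound`: (κ |{f ≤ 0} ∩ Q_r⁻| - Cθ) |{f ≥ 1 - θ} ∩ Q_r| ≤ C (√|W ∩ Q_1| +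
θ). With θ = c δ₁δ₂ and c small, both terms in θ are absorbed, and |W ∩ Q_1| is bounded below by a
multiple of (δ₁δ₂)². -/

instance : (volume : Measure (E d × E d)).IsAddHaarMeasure :=
  Measure.prod.instIsAddHaarMeasure (volume : Measure (E d)) volume

instance : (volume : Measure (Z d)).IsAddHaarMeasure :=
  Measure.prod.instIsAddHaarMeasure (volume : Measure ℝ) (volume : Measure (E d × E d))

/-- The Galilean group law `(s, y, ν) ∘ (t, x, v) = (s + t, y + x + tν, ν + v)`. -/
def gal (w z : Z d) : Z d := (w.1 + z.1, w.2.1 + z.2.1 + z.1 • w.2.2, w.2.2 + z.2.2)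

/-- The inverse for the Galilean group law. -/
def galInv (w : Z d) : Z d := (-w.1, -w.2.1 + w.1 • w.2.2, -w.2.2)

lemma gal_assoc (a b c : Z d) : gal (gal a b) c = gal a (gal b c) := by
  simp only [gal, Prod.mk.injEq]
  refine ⟨by ring, ?_, by abel⟩
  module

lemma gal_zero_left (z : Z d) : gal 0 z = z := by simp [gal]

lemma gal_zero_right (z : Z d) : gal z 0 = z := by simp [gal]

lemma galInv_gal_self (z : Z d) : gal (galInv z) z = 0 := by
  simp only [gal, galInv, Prod.mk_eq_zero]
  refine ⟨by ring, by module, by module⟩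

lemma gal_galInv_self (z : Z d) : gal z (galInv z) = 0 := by
  simp only [gal, galInv, Prod.mk_eq_zero]
  refine ⟨by ring, by module, by module⟩

lemma galInv_gal_cancel (w z : Z d) : gal (galInv w) (gal w z) = z := by
  rw [← gal_assoc, galInv_gal_self, gal_zero_left]

lemma gal_galInv_cancel (w z : Z d) : gal w (gal (galInv w) z) = z := by
  rw [← gal_assoc, gal_galInv_self, gal_zero_left]

lemma galInv_gal (w z : Z d) : galInv (gal w z) = gal (galInv z) (galInv w) := by
  simp only [gal, galInv, Prod.mk.injEq]
  refine ⟨by ring, by module, by module⟩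

lemma galInv_galInv (z : Z d) : galInv (galInv z) = z := by
  simp [galInv]

lemma contDiff_gal : ContDiff ℝ ∞ (fun p : Z d × Z d => gal p.1 p.2) := by
  unfold gal; fun_prop

lemma contDiff_galInv : ContDiff ℝ ∞ (galInv : Z d → Z d) := by
  unfold galInv; fun_prop

lemma continuous_gal : Continuous (fun p : Z d × Z d => gal p.1 p.2) := contDiff_gal.continuous

lemma continuous_galInv : Continuous (galInv : Z d → Z d) := contDiff_galInv.continuous

lemma contDiff_gal_left (w : Z d) : ContDiff ℝ ∞ (gal w) :=
  contDiff_gal.comp (contDiff_const.prodMk contDiff_id)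

lemma measurePreserving_gal_left (w : Z d) : MeasurePreserving (gal w) := by
  have h := (measurePreserving_add_left (volume : Measure ℝ) w.1).skew_product
    (μc := (volume : Measure (E d × E d))) (μd := (volume : Measure (E d × E d)))
    (g := fun t p => (w.2.1 + t • w.2.2, w.2.2) + p) (by fun_prop)
    (ae_of_all _ fun t => (measurePreserving_add_left (volume : Measure (E d × E d)) _).map_eq)
  convert! h using 1
  ext z : 1
  simp [gal, Prod.ext_iff, add_right_comm]

lemma measurePreserving_galInv : MeasurePreserving (galInv : Z d → Z d) := by
  have hs : ∀ t : ℝ, MeasurePreserving (fun p : E d × E d => (-p.1 + t • p.2, -p.2)) := by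
    intro t
    have h := (Measure.measurePreserving_neg (volume : Measure (E d))).skew_product
      (μc := (volume : Measure (E d))) (μd := (volume : Measure (E d)))
      (g := fun v x => -x + t • v) (by fun_prop)
      (ae_of_all _ fun v => ((measurePreserving_add_right (volume : Measure (E d)) (t • v)).comp
        (Measure.measurePreserving_neg (volume : Measure (E d)))).map_eq)
    exact (Measure.measurePreserving_swap.comp h).comp Measure.measurePreserving_swap
  exact (Measure.measurePreserving_neg (volume : Measure ℝ)).skew_product
    (μc := (volume : Measure (E d × E d))) (μd := (volume : Measure (E d × E d)))
    (g := fun t p => (-p.1 + t • p.2, -p.2)) (by fun_prop)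
    (ae_of_all _ fun t => (hs t).map_eq)

/-- Inversion preserves the measure and exchanges left and right translations, so the group is
unimodular. Both sides are needed: left translations commute with the equation and serve for
mollification, while right translations move the argument of u when it is averaged against a density
centred at z. -/
lemma measurePreserving_gal_right (w : Z d) : MeasurePreserving (fun z => gal z w) := by
  have h := measurePreserving_galInv.comp ((measurePreserving_gal_left (galInv w)).comp
    (measurePreserving_galInv (d := d)))
  convert h using 1
  ext z : 1
  simp [galInv_gal, galInv_galInv]

lemma measurePreserving_galInv_gal (z : Z d) : MeasurePreserving (fun w => gal (galInv w) z) :=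
  (measurePreserving_gal_right z).comp measurePreserving_galInv

/-! ### Left invariance of the derivatives and integration by parts -/

/-- The linear part of the left translation by `w`. -/
noncomputable def galLin (w : Z d) : Z d →L[ℝ] Z d :=
  (ContinuousLinearMap.fst ℝ ℝ (E d × E d)).prod
    (((ContinuousLinearMap.fst ℝ (E d) (E d)).comp (ContinuousLinearMap.snd ℝ ℝ (E d × E d)) +
      (ContinuousLinearMap.fst ℝ ℝ (E d × E d)).smulRight w.2.2).prod
      ((ContinuousLinearMap.snd ℝ (E d) (E d)).comp (ContinuousLinearMap.snd ℝ ℝ (E d × E d))))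

lemma galLin_apply (w z : Z d) : galLin w z = (z.1, z.2.1 + z.1 • w.2.2, z.2.2) := rfl

lemma hasFDerivAt_gal_left (w z : Z d) : HasFDerivAt (gal w) (galLin w) z := by
  have : gal w = fun z => w + galLin w z := by
    ext z : 1
    simp only [gal, galLin_apply]
    ext <;> simp [add_assoc]
  rw [this]
  exact (galLin w).hasFDerivAt.const_add w

lemma fderiv_comp_gal_left {φ : Z d → ℝ} (hφ : Differentiable ℝ φ) (w z : Z d) :
    fderiv ℝ (fun z => φ (gal w z)) z = (fderiv ℝ φ (gal w z)).comp (galLin w) :=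
  ((hφ _).hasFDerivAt.comp z (hasFDerivAt_gal_left w z)).fderiv

/-- The field (1, v, 0) is left invariant: the linear part of the translation adds to the direction
x exactly the drift by which the velocity is shifted. This is why mollification must follow the
group and not the ordinary translations. -/
lemma transport_comp_gal_left {φ : Z d → ℝ} (hφ : Differentiable ℝ φ) (w z : Z d) :
    transport (fun z => φ (gal w z)) z = transport φ (gal w z) := by
  rw [transport, transport, fderiv_comp_gal_left hφ]
  simp [galLin_apply, gal, add_comm]

lemma velDeriv_comp_gal_left {φ : Z d → ℝ} (hφ : Differentiable ℝ φ) (w z : Z d) (e : E d) :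
    velDeriv (fun z => φ (gal w z)) z e = velDeriv φ (gal w z) e := by
  rw [velDeriv, velDeriv, fderiv_comp_gal_left hφ]
  simp [galLin_apply]

lemma transport_mul {f g : Z d → ℝ} (hf : Differentiable ℝ f) (hg : Differentiable ℝ g) (z : Z d) :
    transport (fun z => f z * g z) z = f z * transport g z + transport f z * g z := by
  rw [transport, fderiv_fun_mul (hf z) (hg z)]
  simp [transport, mul_comm]

lemma velDeriv_mul {f g : Z d → ℝ} (hf : Differentiable ℝ f) (hg : Differentiable ℝ g) (z : Z d)
    (e : E d) :
    velDeriv (fun z => f z * g z) z e = f z * velDeriv g z e + velDeriv f z e * g z := by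
  rw [velDeriv, fderiv_fun_mul (hf z) (hg z)]
  simp [velDeriv, mul_comm]

lemma fderiv_comp_real {f : Z d → ℝ} {β : ℝ → ℝ} (hβ : Differentiable ℝ β)
    (hf : Differentiable ℝ f) (z : Z d) :
    fderiv ℝ (fun z => β (f z)) z = deriv β (f z) • fderiv ℝ f z :=
  ((hβ _).hasDerivAt.comp_hasFDerivAt z (hf z).hasFDerivAt).fderiv

lemma transport_comp_real {f : Z d → ℝ} {β : ℝ → ℝ} (hβ : Differentiable ℝ β)
    (hf : Differentiable ℝ f) (z : Z d) :
    transport (fun z => β (f z)) z = deriv β (f z) * transport f z := by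
  rw [transport, fderiv_comp_real hβ hf]; rfl

lemma velDeriv_comp_real {f : Z d → ℝ} {β : ℝ → ℝ} (hβ : Differentiable ℝ β)
    (hf : Differentiable ℝ f) (z : Z d) (e : E d) :
    velDeriv (fun z => β (f z)) z e = deriv β (f z) * velDeriv f z e := by
  rw [velDeriv, fderiv_comp_real hβ hf]; rfl

lemma continuous_transport {f : Z d → ℝ} (hf : ContDiff ℝ 1 f) : Continuous (transport f) := by
  unfold transport
  exact (hf.continuous_fderiv one_ne_zero).clm_apply (by fun_prop)

lemma continuous_velDeriv {f : Z d → ℝ} (hf : ContDiff ℝ 1 f) (e : E d) :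
    Continuous (fun z => velDeriv f z e) := by
  unfold velDeriv
  exact (hf.continuous_fderiv one_ne_zero).clm_apply (by fun_prop)

lemma transport_eq_zero_of_notMem {f : Z d → ℝ} {z : Z d} (hz : z ∉ tsupport f) :
    transport f z = 0 := by
  have := notMem_support.1 (fun h => hz (support_fderiv_subset ℝ h))
  simp [transport, this]

lemma velDeriv_eq_zero_of_notMem {f : Z d → ℝ} {z : Z d} (hz : z ∉ tsupport f) (e : E d) :
    velDeriv f z e = 0 := by
  have := notMem_support.1 (fun h => hz (support_fderiv_subset ℝ h))
  simp [velDeriv, this]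

lemma hasCompactSupport_transport {f : Z d → ℝ} (hf : HasCompactSupport f) :
    HasCompactSupport (transport f) :=
  HasCompactSupport.intro hf fun _ hz => transport_eq_zero_of_notMem hz

lemma hasCompactSupport_velDeriv {f : Z d → ℝ} (hf : HasCompactSupport f) (e : E d) :
    HasCompactSupport (fun z => velDeriv f z e) :=
  HasCompactSupport.intro hf fun _ hz => velDeriv_eq_zero_of_notMem hz e

lemma integral_mul_fderiv_of_compactSupport {f g : Z d → ℝ} (hf : ContDiff ℝ 1 f)
    (hg : ContDiff ℝ 1 g) (hc : HasCompactSupport g) (e : Z d) :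
    ∫ z, f z * fderiv ℝ g z e = -∫ z, fderiv ℝ f z e * g z := by
  have hcf : Continuous fun z => fderiv ℝ f z e :=
    (hf.continuous_fderiv one_ne_zero).clm_apply continuous_const
  have hcg : Continuous fun z => fderiv ℝ g z e :=
    (hg.continuous_fderiv one_ne_zero).clm_apply continuous_const
  refine integral_mul_fderiv_eq_neg_fderiv_mul_of_integrable ?_ ?_ ?_
    (fun z _ => hf.differentiable one_ne_zero z) (fun z _ => hg.differentiable one_ne_zero z)
  · exact (hcf.mul hg.continuous).integrable_of_hasCompactSupport hc.mul_left
  · exact (hf.continuous.mul hcg).integrable_of_hasCompactSupport (hc.fderiv_apply ℝ e).mul_left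
  · exact (hf.continuous.mul hg.continuous).integrable_of_hasCompactSupport hc.mul_left

lemma integral_fderiv_eq_zero {g : Z d → ℝ} (hg : ContDiff ℝ 1 g) (hc : HasCompactSupport g)
    (e : Z d) : ∫ z, fderiv ℝ g z e = 0 := by
  simpa using integral_mul_fderiv_of_compactSupport (f := fun _ => 1) contDiff_const hg hc e

lemma integral_velDeriv_eq_zero {g : Z d → ℝ} (hg : ContDiff ℝ 1 g) (hc : HasCompactSupport g)
    (e : E d) : ∫ z, velDeriv g z e = 0 := integral_fderiv_eq_zero hg hc _

/-- The field (1, v, 0) is divergence free, since the coefficient v does not depend on x. As the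
coefficient is unbounded, it is handled one coordinate at a time, as a linear function integrated by
parts against the compactly supported g. -/
lemma integral_transport_eq_zero {g : Z d → ℝ} (hg : ContDiff ℝ 1 g) (hc : HasCompactSupport g) :
    ∫ z, transport g z = 0 := by
  have hdec : ∀ z : Z d, transport g z = fderiv ℝ g z (1, 0, 0) +
      ∑ i, z.2.2 i * fderiv ℝ g z (0, EuclideanSpace.single i 1, 0) := by
    intro z
    have : ((1 : ℝ), z.2.2, (0 : E d)) = (1, 0, 0) +
        ∑ i, z.2.2 i • ((0 : ℝ), (EuclideanSpace.single i (1 : ℝ) : E d), (0 : E d)) := by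
      have hv : z.2.2 = ∑ i, z.2.2 i • (EuclideanSpace.single i (1 : ℝ) : E d) := by
        ext j; simp [Finset.sum_apply, Pi.single_apply]
      ext1
      · simp [Prod.fst_sum]
      ext1
      · simp only [Prod.fst_add, Prod.snd_add, Prod.snd_sum, Prod.fst_sum, Prod.smul_snd,
          Prod.smul_fst, zero_add]
        exact hv
      · simp [Prod.snd_sum]
    rw [transport, this, map_add, map_sum]
    simp only [map_smul, smul_eq_mul]
  have hcont : ∀ e : Z d, Continuous fun z => fderiv ℝ g z e := fun e =>
    (hg.continuous_fderiv one_ne_zero).clm_apply continuous_const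
  simp_rw [hdec]
  rw [integral_add, integral_fderiv_eq_zero hg hc, integral_finsetSum, zero_add]
  · refine Finset.sum_eq_zero fun i _ => ?_
    let ℓ : Z d →L[ℝ] ℝ := (EuclideanSpace.proj i : E d →L[ℝ] ℝ).comp
      ((ContinuousLinearMap.snd ℝ (E d) (E d)).comp (ContinuousLinearMap.snd ℝ ℝ (E d × E d)))
    have := integral_mul_fderiv_of_compactSupport (f := ℓ) ℓ.contDiff hg hc
      (0, EuclideanSpace.single i 1, 0)
    simp only [ContinuousLinearMap.fderiv] at this
    simpa [ℓ] using this
  · intro i _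
    refine Continuous.integrable_of_hasCompactSupport (by fun_prop) (hc.fderiv_apply ℝ _).mul_left
  · exact (hcont _).integrable_of_hasCompactSupport (hc.fderiv_apply ℝ _)
  · refine Continuous.integrable_of_hasCompactSupport (by fun_prop) ?_
    refine HasCompactSupport.intro hc fun z hz => ?_
    have := notMem_support.1 (fun h => hz (support_fderiv_subset ℝ h))
    simp [this]

lemma integral_mul_transport {f g : Z d → ℝ} (hf : ContDiff ℝ 1 f) (hg : ContDiff ℝ 1 g)
    (hc : HasCompactSupport g) : ∫ z, f z * transport g z = -∫ z, transport f z * g z := by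
  have h := integral_transport_eq_zero (g := fun z => f z * g z) (hf.mul hg) hc.mul_left
  have h1 := hf.differentiable one_ne_zero
  have h2 := hg.differentiable one_ne_zero
  simp_rw [transport_mul h1 h2] at h
  rw [integral_add] at h
  · linarith
  · exact (hf.continuous.mul (continuous_transport hg)).integrable_of_hasCompactSupport
      (hasCompactSupport_transport hc).mul_left
  · exact ((continuous_transport hf).mul hg.continuous).integrable_of_hasCompactSupport hc.mul_left

lemma integral_mul_velDeriv {f g : Z d → ℝ} (hf : ContDiff ℝ 1 f) (hg : ContDiff ℝ 1 g)
    (hc : HasCompactSupport g) (e : E d) :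
    ∫ z, f z * velDeriv g z e = -∫ z, velDeriv f z e * g z :=
  integral_mul_fderiv_of_compactSupport hf hg hc _

end

/-! ### Mollification along the Galilean group -/

section

variable {d : ℕ} {F : Type*} [NormedAddCommGroup F]

/-- Composition with a continuously varying family of measure preserving maps is continuous in Lᵖ
for finite p. The action τ is left general because both left and right translations are used. -/
lemma tendsto_eLpNorm_comp_sub {τ : Z d → Z d → Z d} (hτ : Continuous (uncurry τ))
    (hm : ∀ w, MeasurePreserving (τ w)) (h0 : ∀ z, τ 0 z = z) {p : ℝ≥0∞} [Fact (1 ≤ p)]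
    (hp : p ≠ ⊤) {f : Z d → F} (hf : MemLp f p) :
    Tendsto (fun w => eLpNorm (fun z => f (τ w z) - f z) p) (𝓝 0) (𝓝 0) := by
  let g : C(Z d, C(Z d, Z d)) := ContinuousMap.curry ⟨uncurry τ, hτ⟩
  have hg : ∀ w z, g w z = τ w z := fun w z => rfl
  have hgm : ∀ w, MeasurePreserving (g w) := hm
  have hc : Continuous fun w => Lp.compMeasurePreserving (g w) (hgm w) (hf.toLp f) :=
    Continuous.compMeasurePreservingLp continuous_const g.continuous hgm hp
  have h1 := tendsto_iff_edist_tendsto_0.1 (hc.tendsto 0)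
  refine h1.congr fun w => ?_
  rw [Lp.toLp_compMeasurePreserving hf (hgm w), Lp.toLp_compMeasurePreserving hf (hgm 0),
    Lp.edist_toLp_toLp]
  congr 1
  ext z
  simp [hg, h0]

lemma sq_eLpNorm_two {α : Type*} [MeasurableSpace α] {μ : Measure α} (f : α → F) :
    eLpNorm f 2 μ ^ 2 = ∫⁻ z, ‖f z‖ₑ ^ 2 ∂μ := by
  rw [eLpNorm_eq_lintegral_rpow_enorm_toReal (by norm_num) (by norm_num)]
  simp only [ENNReal.toReal_ofNat, ENNReal.rpow_ofNat]
  rw [← ENNReal.rpow_natCast, ← ENNReal.rpow_mul]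
  norm_num

/-- Left translation by `w` as a homeomorphism. -/
def galHomeo (w : Z d) : Z d ≃ₜ Z d where
  toFun := gal w
  invFun := gal (galInv w)
  left_inv := galInv_gal_cancel w
  right_inv := gal_galInv_cancel w
  continuous_toFun := (contDiff_gal_left w).continuous
  continuous_invFun := (contDiff_gal_left _).continuous

/-- Right translation by `w` as a homeomorphism. -/
def galHomeoRight (w : Z d) : Z d ≃ₜ Z d where
  toFun z := gal z w
  invFun z := gal z (galInv w)
  left_inv z := by simp only [gal_assoc, gal_galInv_self, gal_zero_right]
  right_inv z := by simp only [gal_assoc, galInv_gal_self, gal_zero_right]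
  continuous_toFun := continuous_gal.comp (continuous_id.prodMk continuous_const)
  continuous_invFun := continuous_gal.comp (continuous_id.prodMk continuous_const)

lemma measurePreserving_prod_gal :
    MeasurePreserving (fun p : Z d × Z d => (p.1, gal p.1 p.2)) (volume.prod volume)
      (volume.prod volume) :=
  (MeasurePreserving.id volume).skew_product (g := fun w z => gal w z)
    continuous_gal.measurable (ae_of_all _ fun w => (measurePreserving_gal_left w).map_eq)

variable [NormedSpace ℝ F]

/-- Mollification along the left translations of the Galilean group. -/
noncomputable def moll (b : ContDiffBump (0 : Z d)) (f : Z d → F) (z : Z d) : F :=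
  ∫ w, b.normed volume w • f (gal w z)

variable (b : ContDiffBump (0 : Z d))

lemma integrable_normed_smul_comp_gal {f : Z d → F} (hf : MemLp f 2) (z : Z d) :
    Integrable fun w => b.normed volume w • f (gal w z) := by
  have h1 : MemLp (fun w => f (gal w z)) 2 :=
    hf.comp_measurePreserving (measurePreserving_gal_right z)
  have h2 : MemLp (b.normed (volume : Measure (Z d))) 2 :=
    b.continuous_normed.memLp_of_hasCompactSupport b.hasCompactSupport_normed
  exact memLp_one_iff_integrable.1 (h1.smul h2)

/-- The substitution y = w ∘ z turns the average into the integral of b(y ∘ z⁻¹) f(y), in which z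
enters only through a smooth kernel. This is a convolution whose kernel depends on a parameter,
evaluated at the parameter itself. -/
lemma contDiff_moll [CompleteSpace F] {f : Z d → F} (hf : MemLp f 2) : ContDiff ℝ ∞ (moll b f) := by
  let g : Z d → Z d → ℝ := fun p y => b.normed volume (gal (p - y) (galInv p))
  have heq : ∀ z, moll b f z =
      convolution f (g z) (ContinuousLinearMap.lsmul ℝ ℝ).flip volume z := by
    intro z
    rw [moll, convolution_def,
      ← (measurePreserving_gal_right z).integral_comp (galHomeoRight z).measurableEmbedding
        (fun y => (ContinuousLinearMap.lsmul ℝ ℝ).flip (f y) (g z (z - y)))]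
    refine integral_congr_ae (ae_of_all _ fun w => ?_)
    have : gal (gal w z) (galInv z) = w := (galHomeoRight z).left_inv w
    simp [g, this]
  rw [show moll b f = fun z => convolution f (g z) (ContinuousLinearMap.lsmul ℝ ℝ).flip volume z
    from funext heq, contDiff_iff_contDiffAt]
  intro z₀
  have hK : IsCompact ((fun p : Z d × Z d => p.2 - gal p.1 p.2) ''
      (Metric.closedBall 0 b.rOut ×ˢ Metric.closedBall z₀ 1)) :=
    ((isCompact_closedBall _ _).prod (isCompact_closedBall _ _)).image
      (continuous_snd.sub continuous_gal)
  refine (contDiffOn_convolution_right_with_param_comp (n := ⊤)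
    (ContinuousLinearMap.lsmul ℝ ℝ).flip (v := id) contDiffOn_id (s := Metric.ball z₀ 1)
    Metric.isOpen_ball hK ?_ (hf.locallyIntegrable (by norm_num)) ?_).contDiffAt
    (Metric.ball_mem_nhds _ one_pos)
  · intro p y hp hy
    by_contra hne
    apply hy
    refine ⟨(gal (p - y) (galInv p), p), ⟨?_, Metric.ball_subset_closedBall hp⟩, ?_⟩
    · have : gal (p - y) (galInv p) ∈ support (b.normed volume) := hne
      rw [b.support_normed_eq] at this
      exact Metric.ball_subset_closedBall this
    · simp only [gal_assoc, galInv_gal_self, gal_zero_right]; abel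
  · refine ContDiff.contDiffOn ?_
    have h : ContDiff ℝ ∞ fun p : Z d × Z d => (p.1 - p.2, galInv p.1) :=
      (contDiff_fst.sub contDiff_snd).prodMk (contDiff_galInv.comp contDiff_fst)
    exact (b.contDiff_normed (n := ⊤)).comp (contDiff_gal.comp h)

/-- Jensen's inequality for the probability measure whose density is the normalized bump. -/
lemma enorm_moll_sub_le [CompleteSpace F] {f : Z d → F} (hf : MemLp f 2)
    (hm : StronglyMeasurable f) (z : Z d) :
    ‖moll b f z - f z‖ₑ ^ 2 ≤
      ∫⁻ w, ENNReal.ofReal (b.normed volume w) * ‖f (gal w z) - f z‖ₑ ^ 2 := by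
  have hmf : Measurable fun w => ENNReal.ofReal (b.normed (volume : Measure (Z d)) w) :=
    b.continuous_normed.measurable.ennreal_ofReal
  let ν : Measure (Z d) := volume.withDensity fun w => ENNReal.ofReal (b.normed volume w)
  have hν : IsProbabilityMeasure ν := by
    constructor
    rw [withDensity_apply _ MeasurableSet.univ, Measure.restrict_univ,
      ← ofReal_integral_eq_lintegral_ofReal b.integrable_normed (ae_of_all _ b.nonneg_normed),
      b.integral_normed, ENNReal.ofReal_one]
  have hg : StronglyMeasurable fun w => f (gal w z) - f z :=
    (hm.comp_measurable (galHomeoRight z).continuous.measurable).sub stronglyMeasurable_const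
  have e1 : moll b f z - f z = ∫ w, b.normed volume w • (f (gal w z) - f z) := by
    simp_rw [smul_sub]
    rw [integral_sub (integrable_normed_smul_comp_gal b hf z) (b.integrable_normed.smul_const _),
      integral_smul_const, b.integral_normed, one_smul]; rfl
  have e2 : ‖moll b f z - f z‖ₑ ≤ eLpNorm (fun w => f (gal w z) - f z) 1 ν := by
    rw [e1, eLpNorm_one_eq_lintegral_enorm, lintegral_withDensity_eq_lintegral_mul _ hmf
      hg.enorm]
    refine (enorm_integral_le_lintegral_enorm _).trans (lintegral_mono fun w => ?_)
    simp only [enorm_smul, Pi.mul_apply]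
    rw [Real.enorm_of_nonneg (b.nonneg_normed w)]
  calc ‖moll b f z - f z‖ₑ ^ 2 ≤ eLpNorm (fun w => f (gal w z) - f z) 2 ν ^ 2 := by
        gcongr
        exact e2.trans (eLpNorm_le_eLpNorm_of_exponent_le (by norm_num) hg.aestronglyMeasurable)
    _ = _ := by
        rw [sq_eLpNorm_two, lintegral_withDensity_eq_lintegral_mul _ hmf
          (hg.enorm.pow_const 2)]
        rfl

lemma eLpNorm_moll_sub_le [CompleteSpace F] {f : Z d → F} (hf : MemLp f 2)
    (hm : StronglyMeasurable f) {δ : ℝ≥0∞}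
    (hδ : ∀ w ∈ Metric.ball (0 : Z d) b.rOut, eLpNorm (fun z => f (gal w z) - f z) 2 ≤ δ) :
    eLpNorm (fun z => moll b f z - f z) 2 ≤ δ := by
  have hmf : Measurable fun w => ENNReal.ofReal (b.normed (volume : Measure (Z d)) w) :=
    b.continuous_normed.measurable.ennreal_ofReal
  rw [← ENNReal.pow_le_pow_left_iff (n := 2) two_ne_zero, sq_eLpNorm_two]
  calc ∫⁻ z, ‖moll b f z - f z‖ₑ ^ 2
      ≤ ∫⁻ z, ∫⁻ w, ENNReal.ofReal (b.normed volume w) * ‖f (gal w z) - f z‖ₑ ^ 2 :=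
        lintegral_mono fun z => enorm_moll_sub_le b hf hm z
    _ = ∫⁻ w, ∫⁻ z, ENNReal.ofReal (b.normed volume w) * ‖f (gal w z) - f z‖ₑ ^ 2 := by
        refine lintegral_lintegral_swap (Measurable.aemeasurable ?_)
        refine (hmf.comp measurable_snd).mul (Measurable.pow_const ?_ 2)
        refine StronglyMeasurable.enorm ?_
        refine (hm.comp_measurable (g := fun p : Z d × Z d => gal p.2 p.1) ?_).sub
          (hm.comp_measurable measurable_fst)
        exact (continuous_gal.comp continuous_swap).measurable
    _ ≤ ∫⁻ w, ENNReal.ofReal (b.normed volume w) * δ ^ 2 := by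
        refine lintegral_mono fun w => ?_
        rw [lintegral_const_mul']
        · by_cases hw : w ∈ Metric.ball (0 : Z d) b.rOut
          · rw [← sq_eLpNorm_two]
            gcongr
            exact hδ w hw
          · rw [← b.support_normed_eq (μ := volume), notMem_support] at hw
            simp [hw]
        · exact ENNReal.ofReal_ne_top
    _ = δ ^ 2 := by
        rw [lintegral_mul_const _ hmf,
          ← ofReal_integral_eq_lintegral_ofReal b.integrable_normed (ae_of_all _ b.nonneg_normed),
          b.integral_normed, ENNReal.ofReal_one, one_mul]

lemma tendsto_eLpNorm_moll_sub [CompleteSpace F] {f : Z d → F} (hf : MemLp f 2)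
    (hm : StronglyMeasurable f) {b : ℕ → ContDiffBump (0 : Z d)}
    (hb : Tendsto (fun n => (b n).rOut) atTop (𝓝 0)) :
    Tendsto (fun n => eLpNorm (fun z => moll (b n) f z - f z) 2) atTop (𝓝 0) := by
  have : Fact ((1 : ℝ≥0∞) ≤ 2) := ⟨by norm_num⟩
  have h := tendsto_eLpNorm_comp_sub (τ := gal) continuous_gal measurePreserving_gal_left
    gal_zero_left (p := 2) (by norm_num) hf
  rw [ENNReal.tendsto_nhds_zero] at h ⊢
  intro ε hε
  obtain ⟨r, hr, hrε⟩ := Metric.eventually_nhds_iff_ball.1 (h ε hε)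
  filter_upwards [hb.eventually (gt_mem_nhds hr)] with n hn
  exact eLpNorm_moll_sub_le _ hf hm fun w hw => hrε w (Metric.ball_subset_ball hn.le hw)

end

/-! ### The weak formulation after mollification, and renormalization of smooth functions -/

section

variable {d : ℕ}

/-- Fubini, with |A(z) f(w ∘ z)| dominated by |A(z)|² + |f(w ∘ z)|². Pairing through continuous
linear forms treats the scalar f and the vector fields G and H at once. -/
lemma integral_clm_moll {F : Type*} [NormedAddCommGroup F] [NormedSpace ℝ F] [CompleteSpace F]
    (b : ContDiffBump (0 : Z d)) {A : Z d → F →L[ℝ] ℝ} (hA : Continuous A)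
    (hc : HasCompactSupport A) {f : Z d → F} (hf : MemLp f 2) (hm : StronglyMeasurable f) :
    Integrable (fun w => b.normed volume w * ∫ z, A z (f (gal w z))) ∧
    ∫ z, A z (moll b f z) = ∫ w, b.normed volume w * ∫ z, A z (f (gal w z)) := by
  have hAm : StronglyMeasurable A := hA.stronglyMeasurable
  have hA2 : MemLp A 2 := hA.memLp_of_hasCompactSupport hc
  have hint : Integrable (uncurry fun w z : Z d => b.normed volume w * A z (f (gal w z)))
      (volume.prod volume) := by
    have h1 : Integrable (fun p : Z d × Z d => b.normed volume p.1 * ‖A p.2‖ ^ 2)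
        (volume.prod volume) := b.integrable_normed.mul_prod (hA2.integrable_norm_pow two_ne_zero)
    have h2 : Integrable (fun p : Z d × Z d => b.normed volume p.1 * ‖f p.2‖ ^ 2)
        (volume.prod volume) := b.integrable_normed.mul_prod (hf.integrable_norm_pow two_ne_zero)
    have h3 := measurePreserving_prod_gal.integrable_comp_of_integrable h2
    refine (h1.add h3).mono' ?_ (ae_of_all _ fun p => ?_)
    · refine StronglyMeasurable.aestronglyMeasurable ?_
      refine (b.continuous_normed.comp continuous_fst).stronglyMeasurable.mul ?_
      have := (hAm.comp_measurable (measurable_snd (α := Z d))).prodMk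
        (hm.comp_measurable continuous_gal.measurable)
      exact isBoundedBilinearMap_apply.continuous.comp_stronglyMeasurable this
    · simp only [uncurry, Pi.add_apply, comp_apply, norm_mul]
      rw [Real.norm_of_nonneg (b.nonneg_normed _), ← mul_add]
      refine mul_le_mul_of_nonneg_left ?_ (b.nonneg_normed _)
      refine ((A p.2).le_opNorm _).trans ?_
      nlinarith [sq_nonneg (‖A p.2‖ - ‖f (gal p.1 p.2)‖), sq_nonneg (‖A p.2‖),
        sq_nonneg ‖f (gal p.1 p.2)‖]
  constructor
  · have := hint.integral_prod_left
    simpa only [uncurry, integral_const_mul] using this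
  · have h := integral_integral_swap hint
    simp only [integral_const_mul] at h
    rw [h]
    refine integral_congr_ae (ae_of_all _ fun z => ?_)
    simp only [moll]
    rw [← ContinuousLinearMap.integral_comp_comm _ (integrable_normed_smul_comp_gal b hf z)]
    simp

lemma integral_clm_comp_gal {F : Type*} [NormedAddCommGroup F] [NormedSpace ℝ F]
    (A : Z d → F →L[ℝ] ℝ) (f : Z d → F) (w : Z d) :
    ∫ z, A z (f (gal w z)) = ∫ z, A (gal (galInv w) z) (f z) := by
  rw [← (measurePreserving_gal_left w).integral_comp (galHomeo w).measurableEmbedding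
    (fun z => A (gal (galInv w) z) (f z))]
  simp only [galInv_gal_cancel]

/-- `f` is a square integrable function with weak velocity gradient `G` in `U` and satisfies
`∂_t f + v · ∇_x f ≤ ∇_v · H` weakly in `U`; all three are defined on the whole space. -/
structure IsDivSubsolution (U : Set (Z d)) (f : Z d → ℝ) (G H : Z d → E d) : Prop where
  sm_f : StronglyMeasurable f
  sm_G : StronglyMeasurable G
  sm_H : StronglyMeasurable H
  memLp_f : MemLp f 2
  memLp_G : MemLp G 2
  memLp_H : MemLp H 2
  grad : ∀ φ : Z d → ℝ, IsTestFun U φ → ∀ e : E d,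
    ∫ z, f z * velDeriv φ z e = - ∫ z, inner ℝ (G z) e * φ z
  le : ∀ φ : Z d → ℝ, IsTestFun U φ → (∀ z, 0 ≤ φ z) →
    - ∫ z, f z * transport φ z ≤ - ∫ z, velDeriv φ z (H z)

lemma IsTestFun.comp_galInv {U : Set (Z d)} {φ : Z d → ℝ} {w : Z d} (hφ : ContDiff ℝ ∞ φ)
    (hc : HasCompactSupport φ) (hs : ∀ z ∈ tsupport φ, gal w z ∈ interior U) :
    IsTestFun U (fun z => φ (gal (galInv w) z)) where
  smooth := hφ.comp (contDiff_gal_left _)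
  compact_supp := hc.comp_homeomorph (galHomeo (galInv w))
  supp_subset := by
    have : tsupport (fun z => φ (gal (galInv w) z)) = (galHomeo (galInv w)) ⁻¹' tsupport φ :=
      tsupport_comp_eq_preimage φ (galHomeo (galInv w))
    rw [this]
    intro z hz
    simpa [galHomeo, gal_galInv_cancel] using hs _ hz

lemma exists_gal_mem_of_isCompact {K O : Set (Z d)} (hK : IsCompact K) (hO : IsOpen O)
    (hKO : K ⊆ O) : ∃ δ > 0, ∀ w ∈ Metric.ball (0 : Z d) δ, ∀ z ∈ K, gal w z ∈ O := by
  have h : ∀ᶠ w in 𝓝 (0 : Z d), ∀ z ∈ K, gal w z ∈ O := by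
    refine hK.eventually_forall_of_forall_eventually fun z hz => ?_
    refine continuous_gal.continuousAt.eventually_mem (hO.mem_nhds ?_)
    simpa [gal_zero_left] using hKO hz
  exact Metric.eventually_nhds_iff_ball.1 h

/-- The velocity gradient of a function as a continuous linear form. -/
noncomputable def velForm (φ : Z d → ℝ) (z : Z d) : E d →L[ℝ] ℝ :=
  (fderiv ℝ φ z).comp
    ((ContinuousLinearMap.inr ℝ ℝ (E d × E d)).comp (ContinuousLinearMap.inr ℝ (E d) (E d)))

lemma velForm_apply (φ : Z d → ℝ) (z : Z d) (e : E d) : velForm φ z e = velDeriv φ z e := rfl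

lemma continuous_velForm {φ : Z d → ℝ} (hφ : ContDiff ℝ 1 φ) : Continuous (velForm φ) :=
  (hφ.continuous_fderiv one_ne_zero).clm_comp continuous_const

lemma hasCompactSupport_velForm {φ : Z d → ℝ} (hφ : HasCompactSupport φ) :
    HasCompactSupport (velForm φ) :=
  HasCompactSupport.intro hφ fun z hz => by
    ext e; exact velDeriv_eq_zero_of_notMem hz e

/-- Testing the mollified functions with φ averages the original weak formulation over the
translates of φ by small w. The translates remain admissible because the support of φ stays at a
positive distance, in the sense of the group, from the complement of the interior of U. Here G and H
are mollified separately: no relation between them is used, so the roughness of the coefficients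
never enters. -/
lemma IsDivSubsolution.exists_moll {U : Set (Z d)} {f : Z d → ℝ} {G H : Z d → E d}
    (h : IsDivSubsolution U f G H) {K : Set (Z d)} (hK : IsCompact K) (hKU : K ⊆ interior U) :
    ∃ δ > 0, ∀ b : ContDiffBump (0 : Z d), b.rOut < δ → ∀ φ : Z d → ℝ, ContDiff ℝ ∞ φ →
      tsupport φ ⊆ K →
      (∀ e, ∫ z, moll b f z * velDeriv φ z e = - ∫ z, inner ℝ (moll b G z) e * φ z) ∧
      ((∀ z, 0 ≤ φ z) →
        - ∫ z, moll b f z * transport φ z ≤ - ∫ z, velDeriv φ z (moll b H z)) := by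
  obtain ⟨δ, hδ, hmem⟩ := exists_gal_mem_of_isCompact hK isOpen_interior hKU
  refine ⟨δ, hδ, fun b hb φ hφ hφK => ?_⟩
  have hc : HasCompactSupport φ := hK.of_isClosed_subset (isClosed_tsupport _) hφK
  have hd : Differentiable ℝ φ := hφ.differentiable (by simp)
  have hφ1 : ContDiff ℝ 1 φ := hφ.of_le (by simp)
  have htest : ∀ w ∈ Metric.ball (0 : Z d) b.rOut,
      IsTestFun U (fun z => φ (gal (galInv w) z)) := fun w hw =>
    IsTestFun.comp_galInv hφ hc fun z hz =>
      hmem w (Metric.ball_subset_ball hb.le hw) z (hφK hz)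
  have hzero : ∀ w ∉ Metric.ball (0 : Z d) b.rOut, b.normed volume w = 0 := fun w hw => by
    rwa [← b.support_normed_eq (μ := volume), notMem_support] at hw
  have hA : ∀ {c : Z d → ℝ}, Continuous c → HasCompactSupport c →
      Continuous (fun z => c z • ContinuousLinearMap.id ℝ ℝ) ∧
      HasCompactSupport (fun z => c z • ContinuousLinearMap.id ℝ ℝ) := fun hcc hcs =>
    ⟨hcc.smul continuous_const, hcs.smul_right⟩
  constructor
  · intro e
    obtain ⟨a1, a2⟩ := hA (continuous_velDeriv hφ1 e) (hasCompactSupport_velDeriv hc e)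
    obtain ⟨i1, e1⟩ := integral_clm_moll b a1 a2 h.memLp_f h.sm_f
    have a3 : Continuous (fun z => φ z • innerSL ℝ e) := hφ.continuous.smul continuous_const
    have a4 : HasCompactSupport (fun z => φ z • innerSL ℝ e) := hc.smul_right
    obtain ⟨i2, e2⟩ := integral_clm_moll b a3 a4 h.memLp_G h.sm_G
    have l1 : ∫ z, moll b f z * velDeriv φ z e =
        ∫ z, (velDeriv φ z e • ContinuousLinearMap.id ℝ ℝ) (moll b f z) := by simp [mul_comm]
    have l2 : ∫ z, inner ℝ (moll b G z) e * φ z =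
        ∫ z, (φ z • innerSL ℝ e) (moll b G z) := by simp [mul_comm, real_inner_comm]
    rw [l1, l2, e1, e2, ← integral_neg]
    refine integral_congr_ae (ae_of_all _ fun w => ?_)
    by_cases hw : w ∈ Metric.ball (0 : Z d) b.rOut
    · simp only
      rw [← mul_neg, integral_clm_comp_gal, integral_clm_comp_gal (fun z => φ z • innerSL ℝ e)]
      congr 1
      have := h.grad _ (htest w hw) e
      simp only [velDeriv_comp_gal_left hd] at this
      simpa [mul_comm, real_inner_comm] using this
    · simp [hzero w hw]
  · intro hpos
    obtain ⟨a1, a2⟩ := hA (continuous_transport hφ1) (hasCompactSupport_transport hc)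
    obtain ⟨i1, e1⟩ := integral_clm_moll b a1 a2 h.memLp_f h.sm_f
    obtain ⟨i2, e2⟩ := integral_clm_moll b (continuous_velForm hφ1) (hasCompactSupport_velForm hc)
      h.memLp_H h.sm_H
    have l1 : ∫ z, moll b f z * transport φ z =
        ∫ z, (transport φ z • ContinuousLinearMap.id ℝ ℝ) (moll b f z) := by simp [mul_comm]
    have l2 : ∫ z, velDeriv φ z (moll b H z) = ∫ z, velForm φ z (moll b H z) := rfl
    rw [l1, l2, e1, e2, neg_le_neg_iff]
    refine integral_mono i2 i1 fun w => ?_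
    by_cases hw : w ∈ Metric.ball (0 : Z d) b.rOut
    · refine mul_le_mul_of_nonneg_left ?_ (b.nonneg_normed w)
      rw [integral_clm_comp_gal, integral_clm_comp_gal]
      have := h.le _ (htest w hw) fun z => hpos _
      simp only [velDeriv_comp_gal_left hd, transport_comp_gal_left hd] at this
      rw [neg_le_neg_iff] at this
      simpa [mul_comm, velForm_apply] using this
    · simp [hzero w hw]

lemma velDeriv_eq_sum (f : Z d → ℝ) (z : Z d) (e : E d) :
    velDeriv f z e = ∑ i, e i * velDeriv f z (EuclideanSpace.single i 1) := by
  have hv : e = ∑ i, e i • (EuclideanSpace.single i (1 : ℝ) : E d) := by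
    ext j; simp [Pi.single_apply]
  conv_lhs => rw [← velForm_apply, hv, map_sum]
  simp [velForm_apply]

lemma inner_eq_sum (g e : E d) :
    inner ℝ g e = ∑ i, e i * inner ℝ g (EuclideanSpace.single i 1) := by
  simp [PiLp.inner_apply]

/-- The renormalized formulation for a smooth function `f` that satisfies the weak formulation
against the test functions supported in `K`. -/
lemma renormalize_of_smooth {K : Set (Z d)} (hK : IsCompact K) {f : Z d → ℝ} {G H : Z d → E d}
    (hf : ContDiff ℝ ∞ f) (hG : ContDiff ℝ ∞ G) (hH : ContDiff ℝ ∞ H)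
    (hgrad : ∀ φ : Z d → ℝ, ContDiff ℝ ∞ φ → tsupport φ ⊆ K →
      ∀ e, ∫ z, f z * velDeriv φ z e = - ∫ z, inner ℝ (G z) e * φ z)
    (hle : ∀ φ : Z d → ℝ, ContDiff ℝ ∞ φ → tsupport φ ⊆ K → (∀ z, 0 ≤ φ z) →
      - ∫ z, f z * transport φ z ≤ - ∫ z, velDeriv φ z (H z))
    {β : ℝ → ℝ} (hβ : ContDiff ℝ ∞ β) (hβ0 : ∀ s, 0 ≤ deriv β s)
    {φ : Z d → ℝ} (hφ : ContDiff ℝ ∞ φ) (hφK : tsupport φ ⊆ K) :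
    (∀ e, ∫ z, β (f z) * velDeriv φ z e = - ∫ z, deriv β (f z) * (inner ℝ (G z) e * φ z)) ∧
    ((∀ z, 0 ≤ φ z) → - ∫ z, β (f z) * transport φ z ≤
      - (∫ z, deriv β (f z) * velDeriv φ z (H z)) -
        ∫ z, (deriv (deriv β) (f z) * φ z) * inner ℝ (G z) (H z)) := by
  have hβ' : ContDiff ℝ ∞ (deriv β) := (contDiff_infty_iff_deriv.1 hβ).2
  have hβ'' : ContDiff ℝ ∞ (deriv (deriv β)) := (contDiff_infty_iff_deriv.1 hβ').2
  have h1 : ∀ {F : Type} [NormedAddCommGroup F] [NormedSpace ℝ F] {g : Z d → F},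
    ContDiff ℝ ∞ g → ContDiff ℝ 1 g := fun hg => hg.of_le (by simp)
  have hdf : Differentiable ℝ f := hf.differentiable (by simp)
  have hdφ : Differentiable ℝ φ := hφ.differentiable (by simp)
  have hdβ : Differentiable ℝ β := hβ.differentiable (by simp)
  have hdβ' : Differentiable ℝ (deriv β) := hβ'.differentiable (by simp)
  have hc : HasCompactSupport φ := hK.of_isClosed_subset (isClosed_tsupport _) hφK
  have hβf : ContDiff ℝ 1 (fun z => β (f z)) := h1 (hβ.comp hf)
  have hβ'f : ContDiff ℝ ∞ (fun z => deriv β (f z)) := hβ'.comp hf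
  have hΨ : ContDiff ℝ ∞ (fun z => deriv β (f z) * φ z) := hβ'f.mul hφ
  have hΨK : tsupport (fun z => deriv β (f z) * φ z) ⊆ K :=
    (tsupport_mul_subset_right).trans hφK
  have hΨc : HasCompactSupport (fun z => deriv β (f z) * φ z) := hc.mul_left
  constructor
  · intro e
    rw [integral_mul_velDeriv hβf (h1 hφ) hc]
    have := hgrad _ hΨ hΨK e
    rw [integral_mul_velDeriv (h1 hf) (h1 hΨ) hΨc] at this
    simp_rw [velDeriv_comp_real hdβ hdf]
    convert this using 4 <;> ring
  · intro hpos
    -- The test function is β'(f) φ. Transport gives β'(f) 𝒯f = 𝒯(β(f)), and the velocity derivative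
    -- that falls on β'(f) produces the dissipation term.
    have key := hle _ hΨ hΨK fun z => mul_nonneg (hβ0 _) (hpos z)
    rw [integral_mul_transport (h1 hf) (h1 hΨ) hΨc] at key
    rw [integral_mul_transport hβf (h1 hφ) hc]
    simp_rw [transport_comp_real hdβ hdf]
    have e1 : ∀ z, velDeriv (fun z => deriv β (f z) * φ z) z (H z) =
        deriv β (f z) * velDeriv φ z (H z) +
          ∑ i, velDeriv f z (EuclideanSpace.single i 1) *
            (deriv (deriv β) (f z) * H z i * φ z) := by
      intro z
      rw [velDeriv_mul (hβ'f.differentiable (by simp)) hdφ, velDeriv_comp_real hdβ' hdf,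
        velDeriv_eq_sum f, Finset.mul_sum, Finset.sum_mul]
      congr 1
      exact Finset.sum_congr rfl fun i _ => by ring
    have hHi : ∀ i, ContDiff ℝ ∞ (fun z => H z i) := fun i =>
      (EuclideanSpace.proj (𝕜 := ℝ) i).contDiff.comp hH
    have hΨi : ∀ i, ContDiff ℝ ∞ (fun z => deriv (deriv β) (f z) * H z i * φ z) := fun i =>
      ((hβ''.comp hf).mul (hHi i)).mul hφ
    have hΨiK : ∀ i, tsupport (fun z => deriv (deriv β) (f z) * H z i * φ z) ⊆ K := fun i =>
      (tsupport_mul_subset_right).trans hφK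
    -- G is known to be ∇_v f only against test functions supported in K, so the replacement is made
    -- weakly, one component at a time.
    have e2 : ∀ i, ∫ z, velDeriv f z (EuclideanSpace.single i 1) *
            (deriv (deriv β) (f z) * H z i * φ z) =
        ∫ z, inner ℝ (G z) (EuclideanSpace.single i 1) *
            (deriv (deriv β) (f z) * H z i * φ z) := by
      intro i
      have a := hgrad _ (hΨi i) (hΨiK i) (EuclideanSpace.single i 1)
      rw [integral_mul_velDeriv (h1 hf) (h1 (hΨi i)) hc.mul_left] at a
      linarith
    have e3 : ∀ z, (deriv (deriv β) (f z) * φ z) * inner ℝ (G z) (H z) =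
        ∑ i, inner ℝ (G z) (EuclideanSpace.single i 1) *
            (deriv (deriv β) (f z) * H z i * φ z) := by
      intro z
      rw [inner_eq_sum, Finset.mul_sum]
      exact Finset.sum_congr rfl fun i _ => by ring
    have i1 : Integrable fun z => deriv β (f z) * velDeriv φ z (H z) := by
      refine Continuous.integrable_of_hasCompactSupport ?_ ?_
      · exact hβ'f.continuous.mul ((continuous_velForm (h1 hφ)).clm_apply hH.continuous)
      · refine HasCompactSupport.intro hc fun z hz => ?_
        simp [velDeriv_eq_zero_of_notMem hz]
    have i2 : ∀ i ∈ Finset.univ, Integrable fun z => velDeriv f z (EuclideanSpace.single i 1) *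
            (deriv (deriv β) (f z) * H z i * φ z) := fun i _ =>
      Continuous.integrable_of_hasCompactSupport
        ((continuous_velDeriv (h1 hf) _).mul (hΨi i).continuous) hc.mul_left.mul_left
    have i3 : ∀ i ∈ Finset.univ, Integrable fun z => inner ℝ (G z) (EuclideanSpace.single i 1) *
            (deriv (deriv β) (f z) * H z i * φ z) := fun i _ =>
      Continuous.integrable_of_hasCompactSupport
        ((hG.continuous.inner continuous_const).mul (hΨi i).continuous) hc.mul_left.mul_left
    simp_rw [e1] at key
    rw [integral_add i1 (integrable_finsetSum _ i2), integral_finsetSum _ i2,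
      Finset.sum_congr rfl fun i _ => e2 i, ← integral_finsetSum _ i3] at key
    simp_rw [e3]
    have e4 : ∫ z, transport f z * (deriv β (f z) * φ z) =
      ∫ z, deriv β (f z) * transport f z * φ z := by
      congr 1; ext z; ring
    linarith

end

/-! ### Passage to the limit: renormalization of weak subsolutions -/

section

variable {d : ℕ}

section Limits

variable {α : Type*} [MeasurableSpace α] {μ : Measure α}

lemma tendsto_lintegral_enorm_sub_of_le_mul {X : Type*} [NormedAddCommGroup X]
    {x : ℕ → α → X} {x₀ : α → X} (hx : ∀ n, AEStronglyMeasurable (fun z => x n z - x₀ z) μ)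
    (hlim : Tendsto (fun n => eLpNorm (fun z => x n z - x₀ z) 2 μ) atTop (𝓝 0))
    {k : α → ℝ} (hk : MemLp k 2 μ) {y : ℕ → α → ℝ} {y₀ : α → ℝ}
    (hy : ∀ n z, ‖y n z - y₀ z‖ ≤ ‖x n z - x₀ z‖ * ‖k z‖) :
    Tendsto (fun n => ∫⁻ z, ‖y n z - y₀ z‖ₑ ∂μ) atTop (𝓝 0) := by
  have hle : ∀ n, ∫⁻ z, ‖y n z - y₀ z‖ₑ ∂μ ≤
      eLpNorm (fun z => x n z - x₀ z) 2 μ * eLpNorm k 2 μ := by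
    intro n
    calc ∫⁻ z, ‖y n z - y₀ z‖ₑ ∂μ ≤ ∫⁻ z, ‖‖x n z - x₀ z‖ * ‖k z‖‖ₑ ∂μ := by
          refine lintegral_mono fun z => ?_
          rw [enorm_le_iff_norm_le]
          exact (hy n z).trans (le_abs_self _)
      _ = eLpNorm (fun z => ‖x n z - x₀ z‖ * ‖k z‖) 1 μ := eLpNorm_one_eq_lintegral_enorm.symm
      _ ≤ 1 * eLpNorm (fun z => x n z - x₀ z) 2 μ * eLpNorm k 2 μ := by
          exact eLpNorm_le_eLpNorm_mul_eLpNorm'_of_norm (hx n) hk.1 (fun a b => ‖a‖ * ‖b‖) 1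
            (ae_of_all _ fun z => by simp)
      _ = _ := by rw [one_mul]
  refine tendsto_of_tendsto_of_tendsto_of_le_of_le tendsto_const_nhds ?_ (fun _ => zero_le) hle
  simpa using ENNReal.Tendsto.mul_const hlim (Or.inr hk.2.ne)

/-- Split aₙyₙ - a₀y₀ as aₙ(yₙ - y₀) + (aₙ - a₀)y₀: the first term is controlled by the uniform
bound on aₙ, the second by dominated convergence. -/
lemma tendsto_integral_mul_of_L1 {a : ℕ → α → ℝ} {a₀ : α → ℝ} {y : ℕ → α → ℝ} {y₀ : α → ℝ} {M : ℝ}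
    (hM : ∀ n z, |a n z| ≤ M) (hM₀ : ∀ z, |a₀ z| ≤ M)
    (ha : ∀ n, AEStronglyMeasurable (a n) μ) (ha₀ : AEStronglyMeasurable a₀ μ)
    (hlim : ∀ᵐ z ∂μ, Tendsto (fun n => a n z) atTop (𝓝 (a₀ z)))
    (hy : ∀ n, AEStronglyMeasurable (y n) μ) (hy₀ : Integrable y₀ μ)
    (hL : Tendsto (fun n => ∫⁻ z, ‖y n z - y₀ z‖ₑ ∂μ) atTop (𝓝 0)) :
    Tendsto (fun n => ∫ z, a n z * y n z ∂μ) atTop (𝓝 (∫ z, a₀ z * y₀ z ∂μ)) := by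
  have t1 : Tendsto (fun n => ∫⁻ z, ‖(a n z - a₀ z) * y₀ z‖ₑ ∂μ) atTop (𝓝 0) := by
    have := tendsto_lintegral_of_dominated_convergence' (μ := μ)
      (F := fun n z => ‖(a n z - a₀ z) * y₀ z‖ₑ) (f := fun _ => 0)
      (fun z => ENNReal.ofReal (2 * M) * ‖y₀ z‖ₑ) ?_ ?_ ?_ ?_
    · simpa using this
    · exact fun n => (((ha n).sub ha₀).mul hy₀.1).enorm
    · intro n
      refine ae_of_all _ fun z => ?_
      simp only [enorm_mul]
      gcongr
      rw [Real.enorm_eq_ofReal_abs]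
      refine ENNReal.ofReal_le_ofReal ((abs_sub _ _).trans ?_)
      linarith [hM n z, hM₀ z]
    · rw [lintegral_const_mul'' _ hy₀.1.enorm]
      exact ENNReal.mul_ne_top ENNReal.ofReal_ne_top hy₀.2.ne
    · filter_upwards [hlim] with z hz
      have : Tendsto (fun n => (a n z - a₀ z) * y₀ z) atTop (𝓝 ((a₀ z - a₀ z) * y₀ z)) :=
        (hz.sub_const _).mul_const _
      simpa using this.enorm
  have t2 : Tendsto (fun n => ENNReal.ofReal M * ∫⁻ z, ‖y n z - y₀ z‖ₑ ∂μ) atTop (𝓝 0) := by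
    simpa using ENNReal.Tendsto.const_mul hL (Or.inr ENNReal.ofReal_ne_top)
  have t3 : Tendsto (fun n => ∫⁻ z, ‖a n z * y n z - a₀ z * y₀ z‖ₑ ∂μ) atTop (𝓝 0) := by
    refine tendsto_of_tendsto_of_tendsto_of_le_of_le tendsto_const_nhds
      (by simpa only [add_zero] using t2.add t1) (fun _ => zero_le) fun n => ?_
    have hm : AEMeasurable (fun z => ‖y n z - y₀ z‖ₑ) μ := ((hy n).sub hy₀.1).enorm
    have hm2 : AEMeasurable (fun z => ‖(a n z - a₀ z) * y₀ z‖ₑ) μ :=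
      (((ha n).sub ha₀).mul hy₀.1).enorm
    rw [← lintegral_const_mul'' _ hm, ← lintegral_add_right' _ hm2]
    refine lintegral_mono fun z => ?_
    have : a n z * y n z - a₀ z * y₀ z = a n z * (y n z - y₀ z) + (a n z - a₀ z) * y₀ z := by ring
    simp only [this]
    refine (enorm_add_le _ _).trans ?_
    gcongr
    rw [enorm_mul]
    gcongr
    rw [Real.enorm_eq_ofReal_abs]
    exact ENNReal.ofReal_le_ofReal (hM n z)
  refine tendsto_integral_of_L1 _ (ha₀.mul hy₀.1) ?_ t3
  filter_upwards [hL.eventually (gt_mem_nhds one_pos)] with n hn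
  have hyn : Integrable (y n) μ := by
    have : Integrable (fun z => y n z - y₀ z) μ := ⟨(hy n).sub hy₀.1, hn.trans ENNReal.one_lt_top⟩
    exact (this.add hy₀).congr (ae_of_all _ fun z => by simp)
  exact hyn.bdd_mul (ha n) (ae_of_all _ (hM n))

/-- The inner product is bilinear, so two sequences converging in L² have products converging in L¹.
It is needed for the dissipation, which is quadratic in the unknowns. -/
lemma tendsto_lintegral_enorm_inner_sub {X : Type*} [NormedAddCommGroup X] [InnerProductSpace ℝ X]
    {g h : ℕ → α → X} {g₀ h₀ : α → X} (hg : ∀ n, AEStronglyMeasurable (fun z => g n z - g₀ z) μ)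
    (hh : ∀ n, AEStronglyMeasurable (fun z => h n z - h₀ z) μ) (hg₀ : MemLp g₀ 2 μ)
    (hh₀ : MemLp h₀ 2 μ)
    (hgl : Tendsto (fun n => eLpNorm (fun z => g n z - g₀ z) 2 μ) atTop (𝓝 0))
    (hhl : Tendsto (fun n => eLpNorm (fun z => h n z - h₀ z) 2 μ) atTop (𝓝 0)) :
    Tendsto (fun n => ∫⁻ z, ‖inner ℝ (g n z) (h n z) - inner ℝ (g₀ z) (h₀ z)‖ₑ ∂μ)
      atTop (𝓝 0) := by
  have t1 : Tendsto (fun n => ∫⁻ z, ‖inner ℝ (g n z - g₀ z) (h₀ z) - 0‖ₑ ∂μ) atTop (𝓝 0) := by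
    refine tendsto_lintegral_enorm_sub_of_le_mul hg hgl hh₀.norm fun n z => ?_
    simpa using abs_real_inner_le_norm (g n z - g₀ z) (h₀ z)
  have t2 : Tendsto (fun n => ∫⁻ z, ‖inner ℝ (h n z - h₀ z) (g₀ z) - 0‖ₑ ∂μ) atTop (𝓝 0) := by
    refine tendsto_lintegral_enorm_sub_of_le_mul hh hhl hg₀.norm fun n z => ?_
    simpa using abs_real_inner_le_norm (h n z - h₀ z) (g₀ z)
  have t3 : Tendsto (fun n => eLpNorm (fun z => inner ℝ (g n z - g₀ z) (h n z - h₀ z)) 1 μ)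
      atTop (𝓝 0) := by
    refine tendsto_of_tendsto_of_tendsto_of_le_of_le tendsto_const_nhds
      (g := fun _ => 0) (h := fun n => 1 * eLpNorm (fun z => g n z - g₀ z) 2 μ *
        eLpNorm (fun z => h n z - h₀ z) 2 μ) ?_ (fun _ => zero_le) fun n => ?_
    · simpa using ENNReal.Tendsto.mul hgl (Or.inr ENNReal.zero_ne_top) hhl
        (Or.inr ENNReal.zero_ne_top)
    · exact eLpNorm_le_eLpNorm_mul_eLpNorm'_of_norm (hg n) (hh n) (fun a b => inner ℝ a b) 1
        (ae_of_all _ fun z => by simpa using abs_real_inner_le_norm _ _)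
  simp only [eLpNorm_one_eq_lintegral_enorm, sub_zero] at t1 t2 t3
  refine tendsto_of_tendsto_of_tendsto_of_le_of_le tendsto_const_nhds
      (by simpa using (t1.add t2).add t3) (fun _ => zero_le) fun n => ?_
  have m1 : AEMeasurable (fun z => ‖(inner ℝ (g n z - g₀ z) (h₀ z) : ℝ)‖ₑ) μ :=
    ((hg n).inner hh₀.1).enorm
  have m2 : AEMeasurable (fun z => ‖(inner ℝ (g n z - g₀ z) (h n z - h₀ z) : ℝ)‖ₑ) μ :=
    ((hg n).inner (hh n)).enorm
  rw [← lintegral_add_left' m1, ← lintegral_add_right' _ m2]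
  refine lintegral_mono fun z => ?_
  have : inner ℝ (g n z) (h n z) - inner ℝ (g₀ z) (h₀ z) = inner ℝ (g n z - g₀ z) (h₀ z) +
      inner ℝ (h n z - h₀ z) (g₀ z) + inner ℝ (g n z - g₀ z) (h n z - h₀ z) := by
    simp only [inner_sub_left, inner_sub_right, real_inner_comm]
    ring
  rw [this]
  exact (enorm_add_le _ _).trans (add_le_add_left (enorm_add_le _ _) _)

end Limits

/-- Renormalization: if `f` is a weak subsolution then so is `β(f)` for `β` nondecreasing, up to
the dissipation term, and the chain rule holds for its weak velocity gradient. -/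
theorem IsDivSubsolution.renormalize {U : Set (Z d)} {f : Z d → ℝ} {G H : Z d → E d}
    (h : IsDivSubsolution U f G H) {β : ℝ → ℝ} (hβ : ContDiff ℝ ∞ β) {M : ℝ}
    (hβ0 : ∀ s, 0 ≤ deriv β s) (hβM : ∀ s, |deriv β s| ≤ M) (hβM2 : ∀ s, |deriv (deriv β) s| ≤ M)
    {φ : Z d → ℝ} (hφ : IsTestFun U φ) :
    (∀ e, ∫ z, β (f z) * velDeriv φ z e = - ∫ z, deriv β (f z) * (inner ℝ (G z) e * φ z)) ∧
    ((∀ z, 0 ≤ φ z) → - ∫ z, β (f z) * transport φ z ≤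
      - (∫ z, deriv β (f z) * velDeriv φ z (H z)) -
        ∫ z, (deriv (deriv β) (f z) * φ z) * inner ℝ (G z) (H z)) := by
  have hβ' : ContDiff ℝ ∞ (deriv β) := (contDiff_infty_iff_deriv.1 hβ).2
  have hβ'' : ContDiff ℝ ∞ (deriv (deriv β)) := (contDiff_infty_iff_deriv.1 hβ').2
  have hφ1 : ContDiff ℝ 1 φ := hφ.smooth.of_le (by simp)
  have hc := hφ.compact_supp
  have hK : IsCompact (tsupport φ) := hc
  obtain ⟨δ, hδ, hmoll⟩ := h.exists_moll hK hφ.supp_subset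
  let b₀ : ℕ → ContDiffBump (0 : Z d) := fun n =>
    ⟨1 / (n + 1) / 2, 1 / (n + 1), by positivity, half_lt_self (by positivity)⟩
  have hb₀ : Tendsto (fun n => (b₀ n).rOut) atTop (𝓝 0) := tendsto_one_div_add_atTop_nhds_zero_nat
  -- Convergence almost everywhere along a subsequence is what allows the limit inside β' and β'',
  -- which are merely bounded and continuous factors of quantities converging in L¹.
  obtain ⟨ns, hns, hae⟩ := (tendstoInMeasure_of_tendsto_eLpNorm_of_ne_top (by norm_num)
    (by norm_num) (fun n => (contDiff_moll (b₀ n) h.memLp_f).continuous.aestronglyMeasurable)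
    h.memLp_f.1 (tendsto_eLpNorm_moll_sub h.memLp_f h.sm_f hb₀)).exists_seq_tendsto_ae
  let b : ℕ → ContDiffBump (0 : Z d) := fun n => b₀ (ns n)
  have hb : Tendsto (fun n => (b n).rOut) atTop (𝓝 0) := hb₀.comp hns.tendsto_atTop
  have hf := tendsto_eLpNorm_moll_sub h.memLp_f h.sm_f hb
  have hG := tendsto_eLpNorm_moll_sub h.memLp_G h.sm_G hb
  have hH := tendsto_eLpNorm_moll_sub h.memLp_H h.sm_H hb
  have cf : ∀ n, Continuous (moll (b n) f) := fun n => (contDiff_moll _ h.memLp_f).continuous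
  have cG : ∀ n, Continuous (moll (b n) G) := fun n => (contDiff_moll _ h.memLp_G).continuous
  have cH : ∀ n, Continuous (moll (b n) H) := fun n => (contDiff_moll _ h.memLp_H).continuous
  have mf : ∀ n, AEStronglyMeasurable (fun z => moll (b n) f z - f z) := fun n =>
    (cf n).aestronglyMeasurable.sub h.memLp_f.1
  have mG : ∀ n, AEStronglyMeasurable (fun z => moll (b n) G z - G z) := fun n =>
    (cG n).aestronglyMeasurable.sub h.memLp_G.1
  have mH : ∀ n, AEStronglyMeasurable (fun z => moll (b n) H z - H z) := fun n =>
    (cH n).aestronglyMeasurable.sub h.memLp_H.1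
  have hev : ∀ᶠ n in atTop, (b n).rOut < δ := hb.eventually (gt_mem_nhds hδ)
  have hren : ∀ᶠ n in atTop,
      (∀ e, ∫ z, β (moll (b n) f z) * velDeriv φ z e =
        - ∫ z, deriv β (moll (b n) f z) * (inner ℝ (moll (b n) G z) e * φ z)) ∧
      ((∀ z, 0 ≤ φ z) → - ∫ z, β (moll (b n) f z) * transport φ z ≤
        - (∫ z, deriv β (moll (b n) f z) * velDeriv φ z (moll (b n) H z)) -
          ∫ z, (deriv (deriv β) (moll (b n) f z) * φ z) *
            inner ℝ (moll (b n) G z) (moll (b n) H z)) := by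
    filter_upwards [hev] with n hn
    exact renormalize_of_smooth hK (contDiff_moll _ h.memLp_f) (contDiff_moll _ h.memLp_G)
      (contDiff_moll _ h.memLp_H) (fun ψ h1 h2 => (hmoll _ hn ψ h1 h2).1)
      (fun ψ h1 h2 => (hmoll _ hn ψ h1 h2).2) hβ hβ0 hφ.smooth Subset.rfl
  have hlip : ∀ s t, |β s - β t| ≤ M * |s - t| := fun s t => by
    have := Convex.norm_image_sub_le_of_norm_deriv_le (f := β) (s := univ) (C := M)
      (fun x _ => hβ.differentiable (by simp) x) (fun x _ => hβM x) convex_univ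
      (mem_univ t) (mem_univ s)
    simpa using this
  have hM0 : 0 ≤ M := (abs_nonneg _).trans (hβM 0)
  have limβ : ∀ c : Z d → ℝ, Continuous c → HasCompactSupport c →
      Tendsto (fun n => ∫ z, β (moll (b n) f z) * c z) atTop (𝓝 (∫ z, β (f z) * c z)) := by
    intro c hcc hcs
    have hc2 : MemLp (fun z => M * c z) 2 :=
      (hcc.memLp_of_hasCompactSupport (p := 2) hcs).const_mul M
    have hβf : Integrable fun z => β (f z) * c z := by
      -- β(0) need not vanish, so only β(f) - β(0) is square integrable; the constant is integrated
      -- against the compactly supported c.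
      have i1 : Integrable fun z => (β (f z) - β 0) * c z := by
        have : MemLp (fun z => β (f z) - β 0) 2 := by
          refine h.memLp_f.of_le_mul (c := M) ?_ (ae_of_all _ fun z => ?_)
          · exact (hβ.continuous.comp_aestronglyMeasurable h.memLp_f.1).sub
              aestronglyMeasurable_const
          · simpa using hlip (f z) 0
        exact this.integrable_mul (hcc.memLp_of_hasCompactSupport (p := 2) hcs)
      have i2 : Integrable fun z => β 0 * c z :=
        (hcc.integrable_of_hasCompactSupport hcs).const_mul _
      refine (i1.add i2).congr (ae_of_all _ fun z => ?_)
      simp; ring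
    have hl := tendsto_lintegral_enorm_sub_of_le_mul mf hf hc2
      (y := fun n z => β (moll (b n) f z) * c z) (y₀ := fun z => β (f z) * c z) fun n z => by
        rw [← sub_mul, norm_mul, norm_mul, ← mul_assoc]
        refine mul_le_mul_of_nonneg_right ?_ (norm_nonneg _)
        rw [Real.norm_of_nonneg hM0, mul_comm]
        exact hlip _ _
    refine tendsto_integral_of_L1 _ hβf.1 (Eventually.of_forall fun n => ?_) hl
    exact ((hβ.continuous.comp (cf n)).mul hcc).integrable_of_hasCompactSupport hcs.mul_left
  obtain ⟨Cφ, hCφ⟩ := hc.exists_bound_of_continuous hφ.smooth.continuous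
  constructor
  · intro e
    refine tendsto_nhds_unique_of_eventuallyEq
      (limβ _ (continuous_velDeriv hφ1 e) (hasCompactSupport_velDeriv hc e)) ?_
      (hren.mono fun n hn => hn.1 e)
    refine Tendsto.neg ?_
    have hk : MemLp (fun z => ‖e‖ * φ z) 2 :=
      (hφ.smooth.continuous.memLp_of_hasCompactSupport (p := 2) hc).const_mul _
    refine tendsto_integral_mul_of_L1 (M := M) (fun n z => hβM _) (fun z => hβM _)
      (fun n => (hβ'.continuous.comp (cf n)).aestronglyMeasurable)
      (hβ'.continuous.comp_aestronglyMeasurable h.memLp_f.1)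
      (hae.mono fun z hz => (hβ'.continuous.tendsto _).comp hz)
      (fun n => (((cG n).inner continuous_const).mul hφ.smooth.continuous).aestronglyMeasurable)
      ?_ (tendsto_lintegral_enorm_sub_of_le_mul mG hG hk fun n z => ?_)
    · have h1 : MemLp (fun z => inner ℝ (G z) e) 2 := h.memLp_G.inner_const e
      exact h1.integrable_mul (hφ.smooth.continuous.memLp_of_hasCompactSupport (p := 2) hc)
    · rw [← sub_mul, ← inner_sub_left, norm_mul, norm_mul, norm_norm, ← mul_assoc]
      exact mul_le_mul_of_nonneg_right (norm_inner_le_norm _ _) (norm_nonneg _)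
  · intro hpos
    refine le_of_tendsto_of_tendsto
      (limβ _ (continuous_transport hφ1) (hasCompactSupport_transport hc)).neg ?_
      (hren.mono fun n hn => hn.2 hpos)
    refine Tendsto.sub (Tendsto.neg ?_) ?_
    · have hk0 : MemLp (velForm φ) 2 :=
        (continuous_velForm hφ1).memLp_of_hasCompactSupport (hasCompactSupport_velForm hc)
      refine tendsto_integral_mul_of_L1 (M := M) (fun n z => hβM _) (fun z => hβM _)
        (fun n => (hβ'.continuous.comp (cf n)).aestronglyMeasurable)
        (hβ'.continuous.comp_aestronglyMeasurable h.memLp_f.1)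
        (hae.mono fun z hz => (hβ'.continuous.tendsto _).comp hz)
        (fun n => ((continuous_velForm hφ1).clm_apply (cH n)).aestronglyMeasurable)
        ?_ (tendsto_lintegral_enorm_sub_of_le_mul mH hH hk0.norm fun n z => ?_)
      · have h1 : Integrable (fun z => ‖velForm φ z‖ * ‖H z‖) :=
          hk0.norm.integrable_mul h.memLp_H.norm
        refine h1.mono' ?_ (ae_of_all _ fun z => (velForm φ z).le_opNorm _)
        exact isBoundedBilinearMap_apply.continuous.comp_aestronglyMeasurable
          ((continuous_velForm hφ1).aestronglyMeasurable.prodMk h.memLp_H.1)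
      · rw [← velForm_apply, ← velForm_apply, ← map_sub, norm_norm, mul_comm]
        exact (velForm φ z).le_opNorm _
    · refine tendsto_integral_mul_of_L1 (M := M * Cφ) (fun n z => ?_) (fun z => ?_)
        (fun n => ((hβ''.continuous.comp (cf n)).mul hφ.smooth.continuous).aestronglyMeasurable)
        ((hβ''.continuous.comp_aestronglyMeasurable h.memLp_f.1).mul
          hφ.smooth.continuous.aestronglyMeasurable)
        (hae.mono fun z hz => ((hβ''.continuous.tendsto _).comp hz).mul_const _)
        (fun n => ((cG n).inner (cH n)).aestronglyMeasurable)
        ?_ (tendsto_lintegral_enorm_inner_sub mG mH h.memLp_G h.memLp_H hG hH)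
      · rw [abs_mul]
        exact mul_le_mul (hβM2 _) (hCφ z) (abs_nonneg _) hM0
      · rw [abs_mul]
        exact mul_le_mul (hβM2 _) (hCφ z) (abs_nonneg _) hM0
      · have h1 : Integrable (fun z => ‖G z‖ * ‖H z‖) := h.memLp_G.norm.integrable_mul h.memLp_H.norm
        exact h1.mono' (h.memLp_G.1.inner h.memLp_H.1) (ae_of_all _ fun z => norm_inner_le_norm _ _)

end

/-! ### The convex profile -/

section

variable {d : ℕ}

/-- The primitive of `σ` that vanishes at `0`. -/
noncomputable def prim (σ : ℝ → ℝ) (s : ℝ) : ℝ := ∫ t in (0 : ℝ)..s, σ t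

lemma deriv_prim {σ : ℝ → ℝ} (hσ : Continuous σ) : deriv (prim σ) = σ := by
  ext s
  exact hσ.deriv_integral σ 0 s

lemma differentiable_prim {σ : ℝ → ℝ} (hσ : Continuous σ) : Differentiable ℝ (prim σ) := fun s =>
  (hσ.integral_hasStrictDerivAt 0 s).hasDerivAt.differentiableAt

lemma contDiff_prim {σ : ℝ → ℝ} (hσ : ContDiff ℝ ∞ σ) : ContDiff ℝ ∞ (prim σ) :=
  contDiff_infty_iff_deriv.2 ⟨differentiable_prim hσ.continuous, by
    rwa [deriv_prim hσ.continuous]⟩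

/-- The second derivative of the convex profile: a smooth function equal to `0` on `(-∞, 0]` and
to `1` on `[1, 2]`, nondecreasing on `(-∞, 2]`, and equal to `0` on `[3, ∞)`. -/
noncomputable def hump (s : ℝ) : ℝ := Real.smoothTransition s * Real.smoothTransition (3 - s)

lemma contDiff_hump : ContDiff ℝ ∞ hump :=
  (Real.smoothTransition.contDiff (n := ⊤)).mul
    ((Real.smoothTransition.contDiff (n := ⊤)).comp (contDiff_const.sub contDiff_id))

lemma hump_nonneg (s : ℝ) : 0 ≤ hump s :=
  mul_nonneg (Real.smoothTransition.nonneg _) (Real.smoothTransition.nonneg _)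

lemma hump_le_one (s : ℝ) : hump s ≤ 1 :=
  mul_le_one₀ (Real.smoothTransition.le_one _) (Real.smoothTransition.nonneg _)
    (Real.smoothTransition.le_one _)

lemma hump_of_nonpos {s : ℝ} (hs : s ≤ 0) : hump s = 0 := by
  simp [hump, Real.smoothTransition.zero_of_nonpos hs]

lemma hump_of_ge {s : ℝ} (hs : 3 ≤ s) : hump s = 0 := by
  simp [hump, Real.smoothTransition.zero_of_nonpos (show 3 - s ≤ 0 by linarith)]

lemma hump_of_le_two {s : ℝ} (hs : s ≤ 2) : hump s = Real.smoothTransition s := by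
  simp [hump, Real.smoothTransition.one_of_one_le (show 1 ≤ 3 - s by linarith)]

lemma hump_eq_one {s : ℝ} (h1 : 1 ≤ s) (h2 : s ≤ 2) : hump s = 1 := by
  rw [hump_of_le_two h2, Real.smoothTransition.one_of_one_le h1]

/-- A smooth convex (on `(-∞, 2]`) and nondecreasing substitute for the positive part. -/
noncomputable def profile : ℝ → ℝ := prim (prim hump)

lemma contDiff_profile : ContDiff ℝ ∞ profile := contDiff_prim (contDiff_prim contDiff_hump)

lemma deriv_profile : deriv profile = prim hump :=
  deriv_prim (contDiff_prim contDiff_hump).continuous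

lemma deriv_deriv_profile : deriv (deriv profile) = hump := by
  rw [deriv_profile, deriv_prim contDiff_hump.continuous]

lemma prim_of_nonpos {σ : ℝ → ℝ} (hσ : ∀ s ≤ 0, σ s = 0) {s : ℝ} (hs : s ≤ 0) : prim σ s = 0 := by
  rw [prim, intervalIntegral.integral_symm, neg_eq_zero]
  refine intervalIntegral.integral_zero_ae (ae_of_all _ fun t ht => ?_)
  rw [uIoc_of_le hs] at ht
  exact hσ t ht.2

lemma prim_nonneg {σ : ℝ → ℝ} (hσ : ∀ s ≤ 0, σ s = 0) (h0 : ∀ s, 0 ≤ σ s) (s : ℝ) :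
    0 ≤ prim σ s := by
  rcases le_total s 0 with hs | hs
  · rw [prim_of_nonpos hσ hs]
  · exact intervalIntegral.integral_nonneg hs fun t _ => h0 t

lemma prim_le_mul {σ : ℝ → ℝ} (hc : Continuous σ) {s C : ℝ} (hs : 0 ≤ s)
    (hσ : ∀ t ∈ Icc 0 s, σ t ≤ C) : prim σ s ≤ s * C := by
  have := intervalIntegral.integral_mono_on (μ := volume) hs (hc.intervalIntegrable 0 s)
    (intervalIntegrable_const (c := C)) hσ
  simpa [prim] using this

lemma deriv_profile_nonneg (s : ℝ) : 0 ≤ deriv profile s := by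
  rw [deriv_profile]; exact prim_nonneg (fun _ => hump_of_nonpos) hump_nonneg s

lemma monotone_profile : Monotone profile :=
  monotone_of_deriv_nonneg (contDiff_profile.differentiable (by simp)) deriv_profile_nonneg

lemma deriv_profile_of_nonpos {s : ℝ} (hs : s ≤ 0) : deriv profile s = 0 := by
  rw [deriv_profile]; exact prim_of_nonpos (fun _ => hump_of_nonpos) hs

lemma profile_of_nonpos {s : ℝ} (hs : s ≤ 0) : profile s = 0 :=
  prim_of_nonpos (fun _ h => prim_of_nonpos (fun _ => hump_of_nonpos) h) hs

lemma profile_nonneg (s : ℝ) : 0 ≤ profile s :=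
  prim_nonneg (fun _ h => prim_of_nonpos (fun _ => hump_of_nonpos) h)
    (prim_nonneg (fun _ => hump_of_nonpos) hump_nonneg) s

lemma deriv_profile_le (s : ℝ) : deriv profile s ≤ 3 := by
  have h3 : ∀ s, 0 ≤ s → s ≤ 3 → prim hump s ≤ 3 := fun s h0 h3 => by
    have := prim_le_mul contDiff_hump.continuous h0 (fun t _ => hump_le_one t)
    linarith
  rw [deriv_profile]
  rcases le_total s 0 with hs | hs
  · rw [prim_of_nonpos (fun _ => hump_of_nonpos) hs]; norm_num
  rcases le_total s 3 with hs3 | hs3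
  · exact h3 s hs hs3
  · have e : prim hump s = prim hump 3 + ∫ t in (3 : ℝ)..s, hump t :=
      (intervalIntegral.integral_add_adjacent_intervals
        (contDiff_hump.continuous.intervalIntegrable _ _)
        (contDiff_hump.continuous.intervalIntegrable _ _)).symm
    have e2 : ∫ t in (3 : ℝ)..s, hump t = 0 := by
      refine intervalIntegral.integral_zero_ae (ae_of_all _ fun t ht => ?_)
      rw [uIoc_of_le hs3] at ht
      exact hump_of_ge ht.1.le
    rw [e, e2, add_zero]
    exact h3 3 (by norm_num) le_rfl

/-- `hump` is nondecreasing up to 2, so its primitive is at most s · hump(s) ≤ 2 hump(s); squaring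
and hump ≤ 1 finish. Such a bound of β'² by β'' is what lets the dissipation absorb the cross term
in the energy estimate. -/
lemma deriv_profile_sq_le {s : ℝ} (hs : s ≤ 2) : deriv profile s ^ 2 ≤ 4 * hump s := by
  rcases le_total s 0 with h0 | h0
  · rw [deriv_profile_of_nonpos h0]; nlinarith [hump_nonneg s]
  · have h1 : deriv profile s ≤ s * hump s := by
      rw [deriv_profile]
      refine prim_le_mul contDiff_hump.continuous h0 fun t ht => ?_
      rw [hump_of_le_two hs, hump_of_le_two (ht.2.trans hs)]
      exact Real.smoothTransition.monotone ht.2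
    have h2 := deriv_profile_nonneg s
    have h3 := hump_nonneg s
    have h4 := hump_le_one s
    have h5 : deriv profile s ≤ 2 * hump s := h1.trans (mul_le_mul_of_nonneg_right hs h3)
    calc deriv profile s ^ 2 ≤ (2 * hump s) ^ 2 := by gcongr
      _ ≤ 4 * hump s := by nlinarith

lemma profile_le_four {s : ℝ} (hs : s ≤ 2) : profile s ≤ 4 := by
  refine (monotone_profile hs).trans ?_
  have : prim (prim hump) 2 ≤ 2 * 2 := by
    refine prim_le_mul (contDiff_prim contDiff_hump).continuous (by norm_num) fun t ht => ?_
    have := prim_le_mul contDiff_hump.continuous ht.1 (fun t _ => hump_le_one t)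
    linarith [ht.2]
  exact this.trans (by norm_num)

lemma profile_one_pos : 0 < profile 1 := by
  have hpos : ∀ t, 0 < t → t ≤ 2 → 0 < hump t := fun t h0 h2 => by
    rw [hump_of_le_two h2]; exact Real.smoothTransition.pos_of_pos h0
  refine intervalIntegral.intervalIntegral_pos_of_pos_on
    ((contDiff_prim contDiff_hump).continuous.intervalIntegrable _ _) (fun t ht => ?_) one_pos
  refine intervalIntegral.intervalIntegral_pos_of_pos_on
    (contDiff_hump.continuous.intervalIntegrable _ _) (fun s hs => ?_) ht.1
  exact hpos s hs.1 (by linarith [hs.2, ht.2])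

lemma abs_profile_sub_le (s t : ℝ) : |profile s - profile t| ≤ 3 * |s - t| := by
  have := Convex.norm_image_sub_le_of_norm_deriv_le (f := profile) (s := univ) (C := 3)
    (fun x _ => contDiff_profile.differentiable (by simp) x)
    (fun x _ => by
      rw [Real.norm_of_nonneg (deriv_profile_nonneg x)]; exact deriv_profile_le x)
    convex_univ (mem_univ t) (mem_univ s)
  simpa using this

/-! ### Cutoffs and the energy estimate up to the final time -/

/-- A fixed smooth cutoff that is equal to `1` near the unit cylinder. -/
noncomputable def cutoff (z : Z d) : ℝ :=
  (⟨1, 3 / 2, one_pos, by norm_num⟩ : ContDiffBump (0 : ℝ)) z.1 *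
    ((⟨1, 3 / 2, one_pos, by norm_num⟩ : ContDiffBump (0 : E d)) z.2.1 *
      (⟨1, 3 / 2, one_pos, by norm_num⟩ : ContDiffBump (0 : E d)) z.2.2)

lemma contDiff_cutoff : ContDiff ℝ ∞ (cutoff : Z d → ℝ) := by
  unfold cutoff
  refine ContDiff.mul ?_ (ContDiff.mul ?_ ?_)
  · exact (ContDiffBump.contDiff (n := ⊤) _).comp contDiff_fst
  · exact (ContDiffBump.contDiff (n := ⊤) _).comp (contDiff_fst.comp contDiff_snd)
  · exact (ContDiffBump.contDiff (n := ⊤) _).comp (contDiff_snd.comp contDiff_snd)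

lemma cutoff_nonneg (z : Z d) : 0 ≤ cutoff z :=
  mul_nonneg (ContDiffBump.nonneg _) (mul_nonneg (ContDiffBump.nonneg _) (ContDiffBump.nonneg _))

lemma tsupport_cutoff_subset : tsupport (cutoff : Z d → ℝ) ⊆
    Metric.closedBall 0 (3 / 2) ×ˢ Metric.closedBall 0 (3 / 2) ×ˢ Metric.closedBall 0 (3 / 2) := by
  refine closure_minimal (fun z hz => ?_) (Metric.isClosed_closedBall.prod
    (Metric.isClosed_closedBall.prod Metric.isClosed_closedBall))
  have h1 := left_ne_zero_of_mul hz
  have h2 := left_ne_zero_of_mul (right_ne_zero_of_mul hz)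
  have h3 := right_ne_zero_of_mul (right_ne_zero_of_mul hz)
  rw [← mem_support, ContDiffBump.support_eq] at h1 h2 h3
  exact ⟨Metric.ball_subset_closedBall h1, Metric.ball_subset_closedBall h2,
    Metric.ball_subset_closedBall h3⟩

lemma hasCompactSupport_cutoff : HasCompactSupport (cutoff : Z d → ℝ) :=
  ((isCompact_closedBall _ _).prod ((isCompact_closedBall _ _).prod
    (isCompact_closedBall _ _))).of_isClosed_subset (isClosed_tsupport _) tsupport_cutoff_subset

lemma cutoff_eq_one {z : Z d} (hz : z ∈ cyl d 1) : cutoff z = 1 := by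
  obtain ⟨h1, h2, h3⟩ := hz
  rw [cutoff, ContDiffBump.one_of_mem_closedBall, ContDiffBump.one_of_mem_closedBall,
    ContDiffBump.one_of_mem_closedBall]
  · norm_num
  · exact Metric.ball_subset_closedBall h3
  · simpa using Metric.ball_subset_closedBall h2
  · simp only [one_pow, mem_Ioc, Metric.mem_closedBall, dist_zero_right, Real.norm_eq_abs] at h1 ⊢
    rw [abs_le]; constructor <;> linarith

lemma Ioo_prod_subset_interior_cyl (r : ℝ) :
    Ioo (-r ^ 2) 0 ×ˢ Metric.ball (0 : E d) (r ^ 3) ×ˢ Metric.ball (0 : E d) r ⊆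
      interior (cyl d r) :=
  interior_maximal (prod_mono_left Ioo_subset_Ioc_self)
    (isOpen_Ioo.prod (Metric.isOpen_ball.prod Metric.isOpen_ball))

lemma transport_comp_fst {χ : ℝ → ℝ} (hχ : Differentiable ℝ χ) (z : Z d) :
    transport (fun z => χ z.1) z = deriv χ z.1 := by
  have h := (hχ z.1).hasDerivAt.comp_hasFDerivAt z
    (ContinuousLinearMap.fst ℝ ℝ (E d × E d)).hasFDerivAt
  have h2 : fderiv ℝ (fun z : Z d => χ z.1) z = _ := h.fderiv
  rw [transport, h2]
  simp

lemma velDeriv_comp_fst {χ : ℝ → ℝ} (hχ : Differentiable ℝ χ) (z : Z d) (e : E d) :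
    velDeriv (fun z => χ z.1) z e = 0 := by
  have h := (hχ z.1).hasDerivAt.comp_hasFDerivAt z
    (ContinuousLinearMap.fst ℝ ℝ (E d × E d)).hasFDerivAt
  have h2 : fderiv ℝ (fun z : Z d => χ z.1) z = _ := h.fderiv
  rw [velDeriv, h2]
  simp

/-- A smooth nonincreasing cutoff in time, equal to `1` for `t ≤ -ε` and to `0` for `t ≥ -ε/2`. -/
noncomputable def timeCutoff (ε t : ℝ) : ℝ := Real.smoothTransition (-(2 / ε) * t - 1)

lemma contDiff_timeCutoff (ε : ℝ) : ContDiff ℝ ∞ (timeCutoff ε) :=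
  (Real.smoothTransition.contDiff (n := ⊤)).comp ((contDiff_const.mul contDiff_id).sub
    contDiff_const)

lemma antitone_timeCutoff {ε : ℝ} (hε : 0 < ε) : Antitone (timeCutoff ε) := fun s t hst => by
  refine Real.smoothTransition.monotone ?_
  have : 0 < 2 / ε := by positivity
  nlinarith

lemma timeCutoff_eq_one {ε t : ℝ} (hε : 0 < ε) (ht : t ≤ -ε) : timeCutoff ε t = 1 := by
  refine Real.smoothTransition.one_of_one_le ?_
  have h1 : 0 < 2 / ε := by positivity
  have h2 : 2 / ε * ε = 2 := by field_simp
  nlinarith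

lemma timeCutoff_eq_zero {ε t : ℝ} (hε : 0 < ε) (ht : -ε / 2 ≤ t) : timeCutoff ε t = 0 := by
  refine Real.smoothTransition.zero_of_nonpos ?_
  have h1 : 0 < 2 / ε := by positivity
  have h2 : 2 / ε * ε = 2 := by field_simp
  nlinarith

/-- The bounds of an elliptic subsolution: `|H|² ≤ Λ G·H` and `|G|² ≤ Λ G·H`. -/
structure IsEllipticPair (Λ : ℝ) (G H : Z d → E d) : Prop where
  flux : ∀ᵐ z, ‖H z‖ ^ 2 ≤ Λ * inner ℝ (G z) (H z)
  grad : ∀ᵐ z, ‖G z‖ ^ 2 ≤ Λ * inner ℝ (G z) (H z)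

/-- Test functions must vanish near t = 0, because the interior of the cylinder excludes the final
time; hence the extra factor in time. -/
lemma isTestFun_timeCutoff_mul_cutoff {ε : ℝ} (hε : 0 < ε) :
    IsTestFun (cyl d 2) (fun z => timeCutoff ε z.1 * (cutoff z * cutoff z)) where
  smooth := ((contDiff_timeCutoff ε).comp contDiff_fst).mul (contDiff_cutoff.mul contDiff_cutoff)
  compact_supp := hasCompactSupport_cutoff.mul_left.mul_left
  supp_subset := by
    have h : tsupport (fun z : Z d => timeCutoff ε z.1 * (cutoff z * cutoff z)) ⊆
        {z | z.1 ≤ -ε / 2} ∩ (Metric.closedBall 0 (3 / 2) ×ˢ Metric.closedBall 0 (3 / 2) ×ˢ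
          Metric.closedBall 0 (3 / 2)) := by
      refine subset_inter ?_ ?_
      · refine closure_minimal (fun z hz => ?_) (isClosed_le continuous_fst continuous_const)
        have h1 := left_ne_zero_of_mul hz
        by_contra hlt
        simp only [mem_ofPred_eq, not_le] at hlt
        exact h1 (timeCutoff_eq_zero hε hlt.le)
      · exact ((tsupport_mul_subset_right).trans tsupport_mul_subset_right).trans
          tsupport_cutoff_subset
    refine (h.trans ?_).trans (Ioo_prod_subset_interior_cyl 2)
    rintro z ⟨h0, h1, h2, h3⟩
    simp only [mem_ofPred_eq, Metric.mem_closedBall, dist_zero_right, Real.norm_eq_abs] at h0 h1 h2 h3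
    refine ⟨⟨?_, ?_⟩, ?_, ?_⟩
    · have := (abs_le.1 h1).1; norm_num; linarith
    · linarith
    · simp only [Metric.mem_ball, dist_zero_right]; norm_num; linarith
    · simp only [Metric.mem_ball, dist_zero_right]; linarith

lemma integrable_velDeriv_apply {φ : Z d → ℝ} (hφ : ContDiff ℝ 1 φ) (hc : HasCompactSupport φ)
    {H : Z d → E d} (hH : MemLp H 2) : Integrable fun z => velDeriv φ z (H z) := by
  have hk0 : MemLp (velForm φ) 2 :=
    (continuous_velForm hφ).memLp_of_hasCompactSupport (hasCompactSupport_velForm hc)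
  have h1 : Integrable (fun z => ‖velForm φ z‖ * ‖H z‖) := hk0.norm.integrable_mul hH.norm
  refine h1.mono' ?_ (ae_of_all _ fun z => (velForm φ z).le_opNorm _)
  exact isBoundedBilinearMap_apply.continuous.comp_aestronglyMeasurable
    ((continuous_velForm hφ).aestronglyMeasurable.prodMk hH.1)

/-- The local energy estimate, uniformly up to the final time. -/
theorem exists_energy_bound (d : ℕ) {Λ : ℝ} (hΛ : 0 < Λ) : ∃ C : ℝ, 0 < C ∧
    ∀ (f : Z d → ℝ) (G H : Z d → E d), IsDivSubsolution (cyl d 2) f G H → IsEllipticPair Λ G H →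
      (∀ z, f z ≤ 1) → ∀ (β : ℝ → ℝ) (B M : ℝ), ContDiff ℝ ∞ β → (∀ s, 0 ≤ deriv β s) →
      (∀ s, |deriv β s| ≤ M) → (∀ s, |deriv (deriv β) s| ≤ M) →
      (∀ s ≤ 1, 0 ≤ β s ∧ β s ≤ B) → (∀ s ≤ 1, deriv β s ^ 2 ≤ B * deriv (deriv β) s) → 0 < B →
      ∀ ε > 0, ∫ z in cyl d 1 ∩ {z | z.1 < -ε}, deriv (deriv β) (f z) * inner ℝ (G z) (H z) ≤
        C * B := by
  have hsq1 : ContDiff ℝ 1 (fun z : Z d => cutoff z * cutoff z) :=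
    (contDiff_cutoff.mul contDiff_cutoff).of_le (by simp)
  have hcut1 : ContDiff ℝ 1 (cutoff : Z d → ℝ) := contDiff_cutoff.of_le (by simp)
  obtain ⟨C₁, hC₁⟩ := (hasCompactSupport_transport (d := d)
    (f := fun z => cutoff z * cutoff z) hasCompactSupport_cutoff.mul_left).exists_bound_of_continuous
    (continuous_transport hsq1)
  obtain ⟨C₂, hC₂⟩ := (hasCompactSupport_velForm (d := d)
    hasCompactSupport_cutoff).exists_bound_of_continuous (continuous_velForm hcut1)
  have hC₁0 : 0 ≤ C₁ := (norm_nonneg _).trans (hC₁ 0)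
  let S : Set (Z d) := tsupport cutoff
  have hSm : MeasurableSet S := (isClosed_tsupport _).measurableSet
  have hSfin : volume S ≠ ⊤ := (hasCompactSupport_cutoff (d := d)).isCompact.measure_lt_top.ne
  -- The factor 2 comes from absorbing half of the dissipation, and the summand 1 only ensures
  -- positivity.
  refine ⟨2 * (volume.real S * (C₁ + 2 * C₂ ^ 2 * Λ)) + 1, by positivity, ?_⟩
  intro f G H h hell hf1 β B M hβ hβ0 hβM hβM2 hβB hβB2 hB ε hε
  have hdiss : ∀ s ≤ 1, 0 ≤ deriv (deriv β) s := fun s hs =>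
    nonneg_of_mul_nonneg_right ((sq_nonneg _).trans (hβB2 s hs)) hB
  set φ : Z d → ℝ := fun z => timeCutoff ε z.1 * (cutoff z * cutoff z) with hφdef
  have hφt : IsTestFun (cyl d 2) φ := isTestFun_timeCutoff_mul_cutoff hε
  have hχ0 : ∀ t, 0 ≤ timeCutoff ε t := fun t => Real.smoothTransition.nonneg _
  have hχ1 : ∀ t, timeCutoff ε t ≤ 1 := fun t => Real.smoothTransition.le_one _
  have hφ0 : ∀ z, 0 ≤ φ z := fun z =>
    mul_nonneg (hχ0 _) (mul_nonneg (cutoff_nonneg z) (cutoff_nonneg z))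
  have hχd : Differentiable ℝ (timeCutoff ε) := (contDiff_timeCutoff ε).differentiable (by simp)
  have hcd : Differentiable ℝ (cutoff : Z d → ℝ) := hcut1.differentiable one_ne_zero
  have hsqd : Differentiable ℝ (fun z : Z d => cutoff z * cutoff z) := hcd.mul hcd
  have hβ' : ContDiff ℝ ∞ (deriv β) := (contDiff_infty_iff_deriv.1 hβ).2
  have hβ'' : ContDiff ℝ ∞ (deriv (deriv β)) := (contDiff_infty_iff_deriv.1 hβ').2
  have hfst : Differentiable ℝ (fun z : Z d => timeCutoff ε z.1) := hχd.comp differentiable_fst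
  have key := (h.renormalize hβ hβ0 hβM hβM2 hφt).2 hφ0
  have hφ1 : ContDiff ℝ 1 φ := hφt.smooth.of_le (by simp)
  have hGH : Integrable fun z => inner ℝ (G z) (H z) := by
    have h1 : Integrable (fun z => ‖G z‖ * ‖H z‖) := h.memLp_G.norm.integrable_mul h.memLp_H.norm
    exact h1.mono' (h.memLp_G.1.inner h.memLp_H.1) (ae_of_all _ fun z => norm_inner_le_norm _ _)
  have hmf := h.memLp_f.1
  obtain ⟨Cφ, hCφ⟩ := hφt.compact_supp.exists_bound_of_continuous hφt.smooth.continuous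
  have hM0 : 0 ≤ M := (abs_nonneg _).trans (hβM 0)
  have i1 : Integrable fun z => (deriv (deriv β) (f z) * φ z) * inner ℝ (G z) (H z) := by
    refine hGH.bdd_mul ((hβ''.continuous.comp_aestronglyMeasurable hmf).mul
      hφt.smooth.continuous.aestronglyMeasurable) (c := M * Cφ) (ae_of_all _ fun z => ?_)
    rw [norm_mul]
    exact mul_le_mul (hβM2 _) (hCφ z) (norm_nonneg _) hM0
  have hvel : ∀ z e, velDeriv φ z e = timeCutoff ε z.1 * (2 * cutoff z * velDeriv cutoff z e) := by
    intro z e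
    rw [hφdef, velDeriv_mul hfst hsqd, velDeriv_comp_fst hχd, velDeriv_mul hcd hcd]
    ring
  -- The time cutoff is nonincreasing, so its large derivative has a favourable sign and is dropped.
  -- This makes the bound independent of ε.
  have htr : ∀ z, transport φ z ≤ S.indicator (fun _ => C₁) z := by
    intro z
    by_cases hz : z ∈ S
    · rw [indicator_of_mem hz, hφdef, transport_mul hfst hsqd, transport_comp_fst hχd]
      have a1 : deriv (timeCutoff ε) z.1 ≤ 0 := (antitone_timeCutoff hε).deriv_nonpos
      have a2 : transport (fun z => cutoff z * cutoff z) z ≤ C₁ :=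
        (le_abs_self _).trans (hC₁ z)
      nlinarith [mul_self_nonneg (cutoff z), hχ0 z.1, hχ1 z.1]
    · rw [indicator_of_notMem hz]
      refine (transport_eq_zero_of_notMem fun hz' => hz ?_).le
      exact (tsupport_mul_subset_right.trans tsupport_mul_subset_right) hz'
  have i2 : Integrable fun z => deriv β (f z) * velDeriv φ z (H z) :=
    (integrable_velDeriv_apply hφ1 hφt.compact_supp h.memLp_H).bdd_mul
      (hβ'.continuous.comp_aestronglyMeasurable hmf) (ae_of_all _ fun z => hβM _)
  have i3 : Integrable fun z => β (f z) * transport φ z := by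
    refine ((continuous_transport hφ1).integrable_of_hasCompactSupport
      (hasCompactSupport_transport hφt.compact_supp)).bdd_mul
      (hβ.continuous.comp_aestronglyMeasurable hmf) (c := B) (ae_of_all _ fun z => ?_)
    rw [Real.norm_of_nonneg (hβB _ (hf1 z)).1]
    exact (hβB _ (hf1 z)).2
  have hind : ∀ c : ℝ, Integrable (S.indicator fun _ => c) := fun c =>
    (integrable_indicator_iff hSm).2 (integrableOn_const hSfin)
  have hindI : ∀ c : ℝ, ∫ z, S.indicator (fun _ => c) z = volume.real S * c := fun c => by
    rw [integral_indicator hSm, setIntegral_const, smul_eq_mul]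
  have e1 : ∫ z, β (f z) * transport φ z ≤ volume.real S * (B * C₁) := by
    rw [← hindI]
    refine integral_mono i3 (hind _) fun z => ?_
    have := htr z
    obtain ⟨b0, b1⟩ := hβB _ (hf1 z)
    by_cases hz : z ∈ S
    · simp only [indicator_of_mem hz] at this ⊢
      exact (mul_le_mul_of_nonneg_left this b0).trans (mul_le_mul_of_nonneg_right b1 hC₁0)
    · simp only [indicator_of_notMem hz] at this ⊢
      exact mul_nonpos_of_nonneg_of_nonpos b0 this
  have e2 : -∫ z, deriv β (f z) * velDeriv φ z (H z) ≤
      (1 / 2) * (∫ z, (deriv (deriv β) (f z) * φ z) * inner ℝ (G z) (H z)) +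
        volume.real S * (2 * C₂ ^ 2 * Λ * B) := by
    rw [← hindI, ← integral_const_mul, ← integral_add (i1.const_mul _) (hind _), ← integral_neg]
    refine integral_mono_ae i2.neg ((i1.const_mul _).add (hind _)) ?_
    filter_upwards [hell.flux] with z hz
    rw [hvel]
    by_cases hzS : z ∈ S
    · rw [indicator_of_mem hzS]
      have v1 : |velDeriv cutoff z (H z)| ≤ C₂ * ‖H z‖ :=
        ((velForm cutoff z).le_opNorm _).trans (mul_le_mul_of_nonneg_right (hC₂ z) (norm_nonneg _))
      have v2 : velDeriv cutoff z (H z) ^ 2 ≤ C₂ ^ 2 * ‖H z‖ ^ 2 := by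
        rw [← mul_pow, ← sq_abs]; gcongr
      have v3 := hβB2 _ (hf1 z)
      have v4 := hdiss _ (hf1 z)
      have v5 : 0 ≤ inner ℝ (G z) (H z) := nonneg_of_mul_nonneg_right ((sq_nonneg _).trans hz) hΛ
      set p := cutoff z ^ 2 * deriv (deriv β) (f z) * inner ℝ (G z) (H z) with hp
      set q := C₂ ^ 2 * B * Λ with hq
      have hp0 : 0 ≤ p := by positivity
      have hq0 : 0 ≤ q := by positivity
      -- Young's inequality in the form 2√(pq) ≤ p/2 + 2q: by β'² ≤ Bβ'' and |H|² ≤ Λ G·H, the cross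
      -- term is at most half of the dissipation plus a constant multiple of B.
      have hX : (2 * cutoff z * deriv β (f z) * velDeriv cutoff z (H z)) ^ 2 ≤ 4 * p * q := by
        calc (2 * cutoff z * deriv β (f z) * velDeriv cutoff z (H z)) ^ 2
            = 4 * cutoff z ^ 2 * (deriv β (f z) ^ 2 * velDeriv cutoff z (H z) ^ 2) := by ring
          _ ≤ 4 * cutoff z ^ 2 * ((B * deriv (deriv β) (f z)) *
              (C₂ ^ 2 * (Λ * inner ℝ (G z) (H z)))) := by
              gcongr
              exact v2.trans (mul_le_mul_of_nonneg_left hz (sq_nonneg _))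
          _ = 4 * p * q := by rw [hp, hq]; ring
      have hX2 : |2 * cutoff z * deriv β (f z) * velDeriv cutoff z (H z)| ≤ p / 2 + 2 * q := by
        refine abs_le_of_sq_le_sq (hX.trans ?_) (by positivity)
        nlinarith [sq_nonneg (p / 2 - 2 * q)]
      have hX3 := (abs_le.1 hX2).1
      have c0 := hχ0 z.1
      have c1 := hχ1 z.1
      calc -(deriv β (f z) * (timeCutoff ε z.1 * (2 * cutoff z * velDeriv cutoff z (H z))))
          = timeCutoff ε z.1 * -(2 * cutoff z * deriv β (f z) * velDeriv cutoff z (H z)) := by ring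
        _ ≤ timeCutoff ε z.1 * (p / 2 + 2 * q) :=
            mul_le_mul_of_nonneg_left (by linarith) c0
        _ ≤ timeCutoff ε z.1 * (p / 2) + 2 * q := by nlinarith
        _ = _ := by simp only [hp, hq, hφdef]; ring
    · have : velDeriv cutoff z (H z) = 0 := velDeriv_eq_zero_of_notMem hzS _
      have hφz : φ z = 0 := by
        have : cutoff z = 0 := image_eq_zero_of_notMem_tsupport hzS
        simp [hφdef, this]
      simp [hφz, this, indicator_of_notMem hzS]
  have e3 : ∫ z in cyl d 1 ∩ {z | z.1 < -ε}, deriv (deriv β) (f z) * inner ℝ (G z) (H z) ≤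
      ∫ z, (deriv (deriv β) (f z) * φ z) * inner ℝ (G z) (H z) := by
    have hmeas : MeasurableSet (cyl d 1 ∩ {z | z.1 < -ε}) :=
      (measurableSet_Ioc.prod (measurableSet_ball.prod measurableSet_ball)).inter
        (measurableSet_lt measurable_fst measurable_const)
    calc ∫ z in cyl d 1 ∩ {z | z.1 < -ε}, deriv (deriv β) (f z) * inner ℝ (G z) (H z)
        = ∫ z in cyl d 1 ∩ {z | z.1 < -ε},
            (deriv (deriv β) (f z) * φ z) * inner ℝ (G z) (H z) := by
          refine setIntegral_congr_fun hmeas fun z hz => ?_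
          have : φ z = 1 := by
            simp only [hφdef, cutoff_eq_one hz.1, timeCutoff_eq_one hε (le_of_lt hz.2)]
            norm_num
          simp [this]
      _ ≤ _ := by
          refine setIntegral_le_integral i1 ?_
          filter_upwards [hell.flux] with z hz
          have v5 : 0 ≤ inner ℝ (G z) (H z) := nonneg_of_mul_nonneg_right ((sq_nonneg _).trans hz) hΛ
          exact mul_nonneg (mul_nonneg (hdiss _ (hf1 z)) (hφ0 z)) v5
  nlinarith [measureReal_nonneg (μ := volume) (s := S)]

end

/-! ### Smallness of the velocity gradient in L¹ -/

section

variable {d : ℕ}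

lemma integral_le_sqrt_mul_sqrt {α : Type*} [MeasurableSpace α] {μ : Measure α} [IsFiniteMeasure μ]
    {g : α → ℝ} (hg0 : 0 ≤ᵐ[μ] g) (hg : MemLp g 2 μ) :
    ∫ z, g z ∂μ ≤ √(μ.real univ) * √(∫ z, g z ^ 2 ∂μ) := by
  have h := integral_mul_le_Lp_mul_Lq_of_nonneg (μ := μ) Real.HolderConjugate.two_two
    (f := fun _ => 1) (g := g) (ae_of_all _ fun _ => zero_le_one) hg0
    (by simpa using memLp_const (1 : ℝ)) (by simpa using hg)
  simpa [Real.sqrt_eq_rpow] using h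

lemma measurableSet_cyl (r : ℝ) : MeasurableSet (cyl d r) :=
  measurableSet_Ioc.prod (measurableSet_ball.prod measurableSet_ball)

lemma volume_cyl_ne_top (r : ℝ) : volume (cyl d r) ≠ ⊤ := by
  have : Bornology.IsBounded (cyl d r) :=
    (Metric.isBounded_Ioc _ _).prod (Metric.isBounded_ball.prod Metric.isBounded_ball)
  exact this.measure_lt_top.ne

/-- The part of the unit cylinder before time `-ε`. -/
def cylBefore (d : ℕ) (ε : ℝ) : Set (Z d) := cyl d 1 ∩ {z | z.1 < -ε}

lemma measurableSet_cylBefore (ε : ℝ) : MeasurableSet (cylBefore d ε) :=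
  (measurableSet_cyl 1).inter (measurableSet_lt measurable_fst measurable_const)

lemma setIntegral_norm_le_of_sq {S : Set (Z d)} (hS : volume S ≠ ⊤) {G : Z d → E d} {c : Z d → ℝ}
    {M : ℝ} (hG : MemLp G 2) (hc : StronglyMeasurable c) (hc0 : ∀ z, 0 ≤ c z) (hcM : ∀ z, c z ≤ M)
    {m D : ℝ} (hm : volume.real S ≤ m) (hD : ∫ z in S, (c z * ‖G z‖) ^ 2 ≤ D) :
    ∫ z in S, c z * ‖G z‖ ≤ √m * √D := by
  have : IsFiniteMeasure (volume.restrict S) := ⟨by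
    rw [Measure.restrict_apply_univ]; exact hS.lt_top⟩
  have hmem : MemLp (fun z => c z * ‖G z‖) 2 (volume.restrict S) := by
    refine (hG.restrict S).norm.of_le_mul (c := M)
      (hc.aestronglyMeasurable.mul (hG.restrict S).1.norm) (ae_of_all _ fun z => ?_)
    rw [norm_mul, Real.norm_of_nonneg (hc0 z)]
    exact mul_le_mul_of_nonneg_right (hcM z) (norm_nonneg _)
  refine (integral_le_sqrt_mul_sqrt
    (ae_of_all _ fun z => mul_nonneg (hc0 z) (norm_nonneg _)) hmem).trans ?_
  rw [measureReal_restrict_apply_univ]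
  gcongr

/-- The velocity gradient is small in `L¹` when the intermediate set and `θ` are. -/
theorem exists_gradient_bound (d : ℕ) {Λ : ℝ} (hΛ : 0 < Λ) : ∃ C : ℝ, 0 < C ∧
    ∀ (f : Z d → ℝ) (G H : Z d → E d), IsDivSubsolution (cyl d 2) f G H → IsEllipticPair Λ G H →
      (∀ z, f z ≤ 1) → ∀ θ ∈ Ioo (0 : ℝ) 1, ∀ ε > 0,
        ∫ z in cylBefore d ε, deriv profile (f z) * ‖G z‖ ≤
          C * (√(volume.real ({z | 0 < f z ∧ f z < 1 - θ} ∩ cyl d 1)) + θ) := by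
  obtain ⟨C, hC, hen⟩ := exists_energy_bound d hΛ
  -- 16ΛC is 4 · Λ · 4C, from profile'² ≤ 4 hump and the energy bound with B = 4; 36ΛC is 9 · Λ ·
  -- 4C, from profile' ≤ 3.
  refine ⟨√(16 * Λ * C) + √(volume.real (cyl d 1)) * √(36 * Λ * C), by positivity, ?_⟩
  intro f G H h hell hf1 θ hθ ε hε
  have hθ0 := hθ.1
  have hfm : Measurable f := h.sm_f.measurable
  have hQ := measurableSet_cylBefore (d := d) ε
  have hQfin : volume (cylBefore d ε) ≠ ⊤ :=
    measure_ne_top_of_subset inter_subset_left (volume_cyl_ne_top 1)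
  have hGH : Integrable fun z => inner ℝ (G z) (H z) := by
    have h1 : Integrable (fun z => ‖G z‖ * ‖H z‖) := h.memLp_G.norm.integrable_mul h.memLp_H.norm
    exact h1.mono' (h.memLp_G.1.inner h.memLp_H.1) (ae_of_all _ fun z => norm_inner_le_norm _ _)
  have hG2 : Integrable fun z => ‖G z‖ ^ 2 := h.memLp_G.integrable_norm_pow two_ne_zero
  have hcdp : Continuous (deriv profile) := (contDiff_infty_iff_deriv.1 contDiff_profile).2.continuous
  set c : Z d → ℝ := fun z => deriv profile (f z) with hcdef
  have hcm : StronglyMeasurable c := hcdp.comp_stronglyMeasurable h.sm_f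
  have hc0 : ∀ z, 0 ≤ c z := fun z => deriv_profile_nonneg _
  have hc3 : ∀ z, c z ≤ 3 := fun z => deriv_profile_le _
  have hGHpos : ∀ᵐ z, 0 ≤ inner ℝ (G z) (H z) := by
    filter_upwards [hell.flux] with z hz
    exact nonneg_of_mul_nonneg_right ((sq_nonneg _).trans hz) hΛ
  have ihump : ∀ κ : ℝ → ℝ, Continuous κ →
      Integrable fun z => hump (κ (f z)) * inner ℝ (G z) (H z) := fun κ hκ =>
    hGH.bdd_mul ((contDiff_hump.continuous.comp hκ).comp_aestronglyMeasurable h.memLp_f.1) (c := 1)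
      (ae_of_all _ fun z => by
        rw [Real.norm_of_nonneg (hump_nonneg _)]; exact hump_le_one _)
  have icG : Integrable fun z => (c z * ‖G z‖) ^ 2 := by
    simp_rw [mul_pow]
    refine hG2.bdd_mul (hcm.pow 2).aestronglyMeasurable (c := 9) (ae_of_all _ fun z => ?_)
    rw [Real.norm_of_nonneg (sq_nonneg _)]
    nlinarith [hc0 z, hc3 z]
  -- energy of the whole positive part
  have en1 : ∫ z in cylBefore d ε, hump (f z) * inner ℝ (G z) (H z) ≤ C * 4 := by
    have := hen f G H h hell hf1 profile 4 3 contDiff_profile deriv_profile_nonneg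
      (fun s => by rw [abs_of_nonneg (deriv_profile_nonneg s)]; exact deriv_profile_le s)
      (fun s => by
        rw [deriv_deriv_profile, abs_of_nonneg (hump_nonneg s)]
        exact (hump_le_one s).trans (by norm_num))
      (fun s hs => ⟨profile_nonneg s, profile_le_four (by linarith)⟩)
      (fun s hs => by rw [deriv_deriv_profile]; exact deriv_profile_sq_le (by linarith))
      (by norm_num) ε hε
    rwa [deriv_deriv_profile] at this
  have b1 : ∫ z in cylBefore d ε, (c z * ‖G z‖) ^ 2 ≤ 16 * Λ * C := by
    have : ∫ z in cylBefore d ε, (c z * ‖G z‖) ^ 2 ≤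
        ∫ z in cylBefore d ε, (4 * Λ) * (hump (f z) * inner ℝ (G z) (H z)) := by
      refine integral_mono_ae icG.integrableOn ((ihump id continuous_id).const_mul _).integrableOn
        (ae_restrict_of_ae ?_)
      filter_upwards [hell.grad] with z hz
      have h1 : c z ^ 2 ≤ 4 * hump (f z) := deriv_profile_sq_le ((hf1 z).trans (by norm_num))
      calc (c z * ‖G z‖) ^ 2 = c z ^ 2 * ‖G z‖ ^ 2 := by ring
        _ ≤ (4 * hump (f z)) * (Λ * inner ℝ (G z) (H z)) :=
            mul_le_mul h1 hz (sq_nonneg _) (mul_nonneg (by norm_num) (hump_nonneg _))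
        _ = _ := by ring
    rw [integral_const_mul] at this
    nlinarith
  -- energy above the level `1 - 2θ`
  let κ : ℝ → ℝ := fun s => (s - (1 - 2 * θ)) / θ
  have hκ : ∀ s, HasDerivAt κ θ⁻¹ s := fun s => by
    simpa [κ, div_eq_mul_inv] using ((hasDerivAt_id s).sub_const (1 - 2 * θ)).mul_const θ⁻¹
  have hκc : ContDiff ℝ ∞ κ := (contDiff_id.sub contDiff_const).div_const _
  have hdκ : deriv (fun s => profile (κ s)) = fun s => deriv profile (κ s) * θ⁻¹ := by
    ext s
    exact ((contDiff_profile.differentiable (by simp) _).hasDerivAt.comp s (hκ s)).deriv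
  have hddκ : deriv (deriv (fun s => profile (κ s))) = fun s => hump (κ s) * (θ⁻¹ * θ⁻¹) := by
    rw [hdκ]
    ext s
    have h1 : HasDerivAt (deriv profile) (hump (κ s)) (κ s) := by
      rw [← deriv_deriv_profile]
      exact ((contDiff_infty_iff_deriv.1 contDiff_profile).2.differentiable (by simp) _).hasDerivAt
    have h2 : HasDerivAt (fun s => deriv profile (κ s)) (hump (κ s) * θ⁻¹) s := h1.comp s (hκ s)
    rw [(h2.mul_const θ⁻¹).deriv, mul_assoc]
  -- The levels 1 - 2θ, 1 - θ and 1 become 0, 1 and 2. So f ≤ 1 keeps the rescaled value in the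
  -- range where `profile` is convex, and `hump` equals 1 on {f ≥ 1 - θ}.
  have hκ2 : ∀ s ≤ 1, κ s ≤ 2 := fun s hs => by
    simp only [κ]
    rw [div_le_iff₀ hθ0]; linarith
  have hθi : 1 ≤ θ⁻¹ := (one_le_inv₀ hθ0).2 hθ.2.le
  -- The second derivative of the rescaled profile carries θ⁻², while B stays equal to 4;
  -- multiplying through by θ² is the gain.
  have en2 : ∫ z in cylBefore d ε, hump (κ (f z)) * inner ℝ (G z) (H z) ≤ C * 4 * θ ^ 2 := by
    have := hen f G H h hell hf1 (fun s => profile (κ s)) 4 (3 * (θ⁻¹ * θ⁻¹))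
      (contDiff_profile.comp hκc)
      (fun s => by
        rw [hdκ]; exact mul_nonneg (deriv_profile_nonneg _) (by positivity))
      (fun s => by
        rw [hdκ, abs_of_nonneg (mul_nonneg (deriv_profile_nonneg _) (by positivity))]
        have := deriv_profile_le (κ s)
        exact mul_le_mul this (by nlinarith) (by positivity) (by norm_num))
      (fun s => by
        rw [hddκ, abs_of_nonneg (mul_nonneg (hump_nonneg _) (by positivity))]
        exact mul_le_mul_of_nonneg_right ((hump_le_one _).trans (by norm_num)) (by positivity))
      (fun s hs => ⟨profile_nonneg _, profile_le_four (hκ2 s hs)⟩)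
      (fun s hs => by
        rw [hddκ, hdκ, mul_pow, sq θ⁻¹, ← mul_assoc 4]
        exact mul_le_mul_of_nonneg_right (deriv_profile_sq_le (hκ2 s hs)) (by positivity))
      (by norm_num) ε hε
    rw [hddκ] at this
    have e : ∫ z in cylBefore d ε, hump (κ (f z)) * inner ℝ (G z) (H z) =
        θ ^ 2 * ∫ z in cylBefore d ε, hump (κ (f z)) * (θ⁻¹ * θ⁻¹) * inner ℝ (G z) (H z) := by
      rw [← integral_const_mul]
      congr 1; ext z
      field_simp
    rw [e]
    have h4 : 0 ≤ θ ^ 2 := sq_nonneg _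
    calc _ ≤ θ ^ 2 * (C * 4) := mul_le_mul_of_nonneg_left this h4
      _ = _ := by ring
  set T : Set (Z d) := {z | 1 - θ ≤ f z} ∩ cylBefore d ε with hT
  set W : Set (Z d) := {z | 0 < f z ∧ f z < 1 - θ} ∩ cylBefore d ε with hW
  have hTm : MeasurableSet T := (measurableSet_le measurable_const hfm).inter hQ
  have hWm : MeasurableSet W :=
    ((measurableSet_lt measurable_const hfm).inter (measurableSet_lt hfm measurable_const)).inter hQ
  have b2 : ∫ z in T, (c z * ‖G z‖) ^ 2 ≤ 36 * Λ * C * θ ^ 2 := by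
    have h1 : ∫ z in T, (c z * ‖G z‖) ^ 2 ≤
        ∫ z in T, (9 * Λ) * (hump (κ (f z)) * inner ℝ (G z) (H z)) := by
      refine integral_mono_ae icG.integrableOn ((ihump κ hκc.continuous).const_mul _).integrableOn ?_
      filter_upwards [ae_restrict_of_ae hell.grad, ae_restrict_mem hTm] with z hz hzT
      have h1 : c z ^ 2 ≤ 9 := by nlinarith [hc0 z, hc3 z]
      have h2 : hump (κ (f z)) = 1 := by
        refine hump_eq_one ?_ (hκ2 _ (hf1 z))
        simp only [κ]
        rw [le_div_iff₀ hθ0]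
        have : 1 - θ ≤ f z := hzT.1
        linarith
      rw [h2]
      calc (c z * ‖G z‖) ^ 2 = c z ^ 2 * ‖G z‖ ^ 2 := by ring
        _ ≤ 9 * (Λ * inner ℝ (G z) (H z)) := mul_le_mul h1 hz (sq_nonneg _) (by norm_num)
        _ = _ := by ring
    have h2 : ∫ z in T, hump (κ (f z)) * inner ℝ (G z) (H z) ≤
        ∫ z in cylBefore d ε, hump (κ (f z)) * inner ℝ (G z) (H z) :=
      setIntegral_mono_set (ihump κ hκc.continuous).integrableOn
        (ae_restrict_of_ae (hGHpos.mono fun z hz => mul_nonneg (hump_nonneg _) hz))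
        (LE.le.eventuallyLE inter_subset_right)
    rw [integral_const_mul] at h1
    nlinarith
  have b3 : ∫ z in W, (c z * ‖G z‖) ^ 2 ≤ 16 * Λ * C :=
    (setIntegral_mono_set icG.integrableOn (ae_of_all _ fun z => sq_nonneg _)
      (LE.le.eventuallyLE inter_subset_right)).trans b1
  have icG1 : IntegrableOn (fun z => c z * ‖G z‖) (cylBefore d ε) := by
    have : IsFiniteMeasure (volume.restrict (cylBefore d ε)) := ⟨by
      rw [Measure.restrict_apply_univ]; exact hQfin.lt_top⟩
    have h1 : Integrable (fun z => ‖G z‖) (volume.restrict (cylBefore d ε)) :=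
      ((h.memLp_G.restrict _).integrable (by norm_num)).norm
    exact h1.bdd_mul hcm.aestronglyMeasurable (c := 3) (ae_of_all _ fun z => by
      rw [Real.norm_of_nonneg (hc0 z)]; exact hc3 z)
  -- The complement of W and T inside the cylinder is {f ≤ 0}, where profile'(f) vanishes.
  have hsplit : ∫ z in cylBefore d ε, c z * ‖G z‖ =
      (∫ z in W, c z * ‖G z‖) + ∫ z in T, c z * ‖G z‖ := by
    rw [← setIntegral_union _ hTm (icG1.mono_set inter_subset_right)
      (icG1.mono_set inter_subset_right)]
    · refine setIntegral_eq_of_subset_of_forall_sdiff_eq_zero hQ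
        (union_subset inter_subset_right inter_subset_right) fun z hz => ?_
      have : f z ≤ 0 := by
        by_contra hlt
        push Not at hlt
        rcases lt_or_ge (f z) (1 - θ) with hl | hl
        · exact hz.2 (Or.inl ⟨⟨hlt, hl⟩, hz.1⟩)
        · exact hz.2 (Or.inr ⟨hl, hz.1⟩)
      simp [hcdef, deriv_profile_of_nonpos this]
    · rw [Set.disjoint_left]
      rintro z ⟨⟨_, h1⟩, _⟩ ⟨h2, _⟩
      exact absurd (show 1 - θ ≤ f z from h2) (not_le.2 h1)
  have f1 := setIntegral_norm_le_of_sq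
    (measure_ne_top_of_subset inter_subset_right hQfin : volume W ≠ ⊤) h.memLp_G hcm hc0 hc3
    (m := volume.real ({z | 0 < f z ∧ f z < 1 - θ} ∩ cyl d 1))
    (measureReal_mono (inter_subset_inter_right _ inter_subset_left)
      (measure_ne_top_of_subset inter_subset_right (volume_cyl_ne_top 1))) b3
  have f2 := setIntegral_norm_le_of_sq
    (measure_ne_top_of_subset inter_subset_right hQfin : volume T ≠ ⊤) h.memLp_G hcm hc0 hc3
    (m := volume.real (cyl d 1))
    (measureReal_mono (inter_subset_right.trans inter_subset_left) (volume_cyl_ne_top 1)) b2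
  rw [Real.sqrt_mul (by positivity), Real.sqrt_sq hθ0.le] at f2
  rw [hsplit]
  have g1 := Real.sqrt_nonneg (volume.real ({z | 0 < f z ∧ f z < 1 - θ} ∩ cyl d 1))
  have g2 := Real.sqrt_nonneg (16 * Λ * C)
  have g3 : 0 ≤ √(volume.real (cyl d 1)) * √(36 * Λ * C) := by positivity
  nlinarith [mul_nonneg g1 g3, mul_nonneg hθ0.le g2]

end

/-! ### The self-similar density, its transport equation and the kernel bound -/

section

variable {d : ℕ}

/-- The self-similar quadratic form `(9/2)|x|²/τ³ + 3 x·v/τ² + |v|²/τ`, with `τ = -t`. -/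
noncomputable def quad (w : Z d) : ℝ :=
  9 / 2 * ‖w.2.1‖ ^ 2 / (-w.1) ^ 3 + 3 * inner ℝ w.2.1 w.2.2 / (-w.1) ^ 2 + ‖w.2.2‖ ^ 2 / (-w.1)

/-- The self-similar density that is transported by `drift`. -/
noncomputable def kolm (w : Z d) : ℝ :=
  ((-w.1) ^ (2 * d))⁻¹ * Real.smoothTransition (57 - quad w)

/-- The force field along which the sublevel sets of `quad` are transported. -/
noncomputable def drift (w : Z d) : E d :=
  (9 / 2 / (-w.1) ^ 2) • w.2.1 + (2 / (-w.1)) • w.2.2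

lemma contDiffAt_quad {w : Z d} (hw : w.1 < 0) : ContDiffAt ℝ ∞ quad w := by
  have h1 : (-w.1) ≠ 0 := by linarith
  unfold quad
  refine ContDiffAt.add (ContDiffAt.add (ContDiffAt.div ?_ ?_ (pow_ne_zero 3 h1))
    (ContDiffAt.div ?_ ?_ (pow_ne_zero 2 h1))) (ContDiffAt.div ?_ ?_ h1)
  · exact contDiffAt_const.mul ((contDiff_fst.comp contDiff_snd).contDiffAt.norm_sq ℝ)
  · exact contDiff_fst.contDiffAt.neg.pow 3
  · exact contDiffAt_const.mul ((contDiff_fst.comp contDiff_snd).contDiffAt.inner ℝ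
      (contDiff_snd.comp contDiff_snd).contDiffAt)
  · exact contDiff_fst.contDiffAt.neg.pow 2
  · exact (contDiff_snd.comp contDiff_snd).contDiffAt.norm_sq ℝ
  · exact contDiff_fst.contDiffAt.neg

lemma contDiffAt_kolm {w : Z d} (hw : w.1 < 0) : ContDiffAt ℝ ∞ kolm w := by
  have h1 : (-w.1) ≠ 0 := by linarith
  unfold kolm
  refine ((contDiff_fst.contDiffAt.neg.pow (2 * d)).inv (pow_ne_zero _ h1)).mul ?_
  exact (Real.smoothTransition.contDiff (n := ⊤)).contDiffAt.comp w
    (contDiffAt_const.sub (contDiffAt_quad hw))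

lemma contDiffAt_drift {w : Z d} (hw : w.1 < 0) : ContDiffAt ℝ ∞ drift w := by
  have h1 : (-w.1) ≠ 0 := by linarith
  unfold drift
  refine ContDiffAt.add (ContDiffAt.fun_smul ?_ ?_) (ContDiffAt.fun_smul ?_ ?_)
  · exact contDiffAt_const.div (contDiff_fst.contDiffAt.neg.pow 2) (pow_ne_zero _ h1)
  · exact (contDiff_fst.comp contDiff_snd).contDiffAt
  · exact contDiffAt_const.div contDiff_fst.contDiffAt.neg h1
  · exact (contDiff_snd.comp contDiff_snd).contDiffAt

/-- A smooth function of negative times, cut off before the time `0`. -/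
noncomputable def cutAt (a : ℝ → ℝ) (g : Z d → ℝ) (w : Z d) : ℝ := a (-w.1) * g w

lemma cutAt_eq_zero {a : ℝ → ℝ} {ε : ℝ} (ha : ∀ τ ≤ ε, a τ = 0) {g : Z d → ℝ} {w : Z d}
    (hw : -ε ≤ w.1) : cutAt a g w = 0 := by
  rw [cutAt, ha _ (by linarith), zero_mul]

lemma cutAt_eventuallyEq_zero {a : ℝ → ℝ} {ε : ℝ} (ha : ∀ τ ≤ ε, a τ = 0) (g : Z d → ℝ) {w : Z d}
    (hw : -ε < w.1) : cutAt a g =ᶠ[𝓝 w] fun _ => 0 := by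
  filter_upwards [continuous_fst.continuousAt.eventually (lt_mem_nhds hw)] with z hz
  exact cutAt_eq_zero ha (le_of_lt hz)

lemma contDiff_cutAt {a : ℝ → ℝ} (hac : ContDiff ℝ ∞ a) {ε : ℝ} (hε : 0 < ε)
    (ha : ∀ τ ≤ ε, a τ = 0) {g : Z d → ℝ} (hg : ∀ w : Z d, w.1 < 0 → ContDiffAt ℝ ∞ g w) :
    ContDiff ℝ ∞ (cutAt a g) := by
  rw [contDiff_iff_contDiffAt]
  intro w
  rcases lt_or_ge w.1 0 with hw | hw
  · exact (hac.comp contDiff_fst.neg).contDiffAt.mul (hg w hw)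
  · exact contDiffAt_const.congr_of_eventuallyEq (cutAt_eventuallyEq_zero ha g (by linarith))

lemma fderiv_eq_of_hasDerivAt {φ : Z d → ℝ} {w e : Z d} {D : ℝ} (hφ : DifferentiableAt ℝ φ w)
    (hD : HasDerivAt (fun s : ℝ => φ (w + s • e)) D 0) : fderiv ℝ φ w e = D := by
  rw [← hφ.lineDeriv_eq_fderiv]
  exact HasLineDerivAt.lineDeriv hD

lemma transport_quad {w : Z d} (hw : w.1 < 0) :
    transport quad w = 27 / 2 * ‖w.2.1‖ ^ 2 / (-w.1) ^ 4 +
      15 * inner ℝ w.2.1 w.2.2 / (-w.1) ^ 3 + 4 * ‖w.2.2‖ ^ 2 / (-w.1) ^ 2 := by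
  refine fderiv_eq_of_hasDerivAt ((contDiffAt_quad hw).differentiableAt (by simp)) ?_
  obtain ⟨t, x, v⟩ := w
  simp only at hw ⊢
  obtain ⟨τ, rfl⟩ : ∃ τ, t = -τ := ⟨-t, by simp⟩
  have hτ : τ ≠ 0 := by rintro rfl; simp at hw
  have e : (fun s : ℝ => quad ((-τ, x, v) + s • ((1 : ℝ), v, (0 : E d)))) = fun s =>
      9 / 2 * (‖x‖ ^ 2 + 2 * s * inner ℝ x v + s ^ 2 * ‖v‖ ^ 2) / (τ - s) ^ 3 +
        3 * (inner ℝ x v + s * ‖v‖ ^ 2) / (τ - s) ^ 2 + ‖v‖ ^ 2 / (τ - s) := by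
    ext s
    simp only [quad, Prod.mk_add_mk, Prod.smul_mk, smul_zero, add_zero, smul_eq_mul, mul_one]
    rw [norm_add_sq_real, inner_add_left, real_inner_smul_right, real_inner_smul_left,
      real_inner_self_eq_norm_sq, norm_smul, mul_pow, Real.norm_eq_abs, sq_abs,
      show -(-τ + s) = τ - s by ring]
    ring
  rw [e]
  have hs : HasDerivAt (fun s : ℝ => τ - s) (-1) 0 := (hasDerivAt_id (0 : ℝ)).const_sub τ
  have n1 : HasDerivAt (fun s : ℝ => 9 / 2 * (‖x‖ ^ 2 + 2 * s * inner ℝ x v + s ^ 2 * ‖v‖ ^ 2))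
      (9 * inner ℝ x v) 0 := by
    have a := ((hasDerivAt_id (0 : ℝ)).const_mul 2).mul_const (inner ℝ x v)
    have b := ((hasDerivAt_id (0 : ℝ)).pow 2).mul_const (‖v‖ ^ 2)
    have := ((a.const_add (‖x‖ ^ 2)).add b).const_mul (9 / 2)
    refine HasDerivAt.congr_deriv this ?_
    simp; ring
  have n2 : HasDerivAt (fun s : ℝ => 3 * (inner ℝ x v + s * ‖v‖ ^ 2)) (3 * ‖v‖ ^ 2) 0 := by
    have := (((hasDerivAt_id (0 : ℝ)).mul_const (‖v‖ ^ 2)).const_add (inner ℝ x v)).const_mul 3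
    simpa using this
  have h := ((n1.div (hs.pow 3) (by simpa using hτ)).add (n2.div (hs.pow 2) (by simpa using hτ))).add
    ((hasDerivAt_const (0 : ℝ) (‖v‖ ^ 2)).div hs (by simpa using hτ))
  refine HasDerivAt.congr_deriv h ?_
  simp
  field_simp
  ring

lemma velDeriv_quad {w : Z d} (hw : w.1 < 0) (e : E d) :
    velDeriv quad w e = 3 * inner ℝ w.2.1 e / (-w.1) ^ 2 + 2 * inner ℝ w.2.2 e / (-w.1) := by
  refine fderiv_eq_of_hasDerivAt ((contDiffAt_quad hw).differentiableAt (by simp)) ?_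
  obtain ⟨t, x, v⟩ := w
  simp only at hw ⊢
  have heq : (fun s : ℝ => quad ((t, x, v) + s • ((0 : ℝ), (0 : E d), e))) = fun s =>
      9 / 2 * ‖x‖ ^ 2 / (-t) ^ 3 + 3 * (inner ℝ x v + s * inner ℝ x e) / (-t) ^ 2 +
        (‖v‖ ^ 2 + 2 * s * inner ℝ v e + s ^ 2 * ‖e‖ ^ 2) / (-t) := by
    ext s
    simp only [quad, Prod.mk_add_mk, Prod.smul_mk, smul_zero, add_zero]
    rw [norm_add_sq_real, inner_add_right, real_inner_smul_right, real_inner_smul_right,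
      norm_smul, mul_pow, Real.norm_eq_abs, sq_abs]
    ring
  rw [heq]
  have a := ((((hasDerivAt_id (0 : ℝ)).mul_const (inner ℝ x e)).const_add
    (inner ℝ x v)).const_mul 3).div_const ((-t) ^ 2)
  have b := (((((hasDerivAt_id (0 : ℝ)).const_mul 2).mul_const (inner ℝ v e)).const_add
    (‖v‖ ^ 2)).add (((hasDerivAt_id (0 : ℝ)).pow 2).mul_const (‖e‖ ^ 2))).div_const (-t)
  refine HasDerivAt.congr_deriv ((a.const_add (9 / 2 * ‖x‖ ^ 2 / (-t) ^ 3)).add b) ?_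
  simp

/-- The right-hand side is the transport derivative of `quad`, the left-hand side its velocity
derivative along `drift`. Their equality is the reason for the coefficients of `quad` and `drift`:
the force compensates the transport of every level set. -/
lemma inner_drift (w : Z d) :
    3 * inner ℝ w.2.1 (drift w) / (-w.1) ^ 2 + 2 * inner ℝ w.2.2 (drift w) / (-w.1) =
      27 / 2 * ‖w.2.1‖ ^ 2 / (-w.1) ^ 4 +
      15 * inner ℝ w.2.1 w.2.2 / (-w.1) ^ 3 + 4 * ‖w.2.2‖ ^ 2 / (-w.1) ^ 2 := by
  simp only [drift, inner_add_right, real_inner_smul_right, real_inner_self_eq_norm_sq,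
    real_inner_comm w.2.1 w.2.2]
  ring

lemma fderiv_cutAt_kolm {a : ℝ → ℝ} (hac : Differentiable ℝ a) {w : Z d} (hw : w.1 < 0)
    (e : Z d) : fderiv ℝ (cutAt a kolm) w e =
      -(deriv a (-w.1) * kolm w) * e.1 + a (-w.1) * (2 * d / (-w.1) * kolm w * e.1 -
        ((-w.1) ^ (2 * d))⁻¹ * (deriv Real.smoothTransition (57 - quad w) * fderiv ℝ quad w e)) := by
  have h1 : (-w.1) ≠ 0 := by linarith
  have hfst : HasFDerivAt (fun w : Z d => -w.1) (-ContinuousLinearMap.fst ℝ ℝ (E d × E d)) w :=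
    hasFDerivAt_fst.neg
  have ha := (hac (-w.1)).hasDerivAt.comp_hasFDerivAt w hfst
  have hp := ((hasDerivAt_pow (2 * d) (-w.1)).inv (pow_ne_zero _ h1)).comp_hasFDerivAt w hfst
  have hq := (((contDiffAt_quad hw).differentiableAt (by simp)).hasFDerivAt).const_sub 57
  have hS := ((Real.smoothTransition.contDiff (n := ⊤)).differentiable (by simp)
    (57 - quad w)).hasDerivAt.comp_hasFDerivAt w hq
  have hall := ha.mul (hp.mul hS)
  have heq : fderiv ℝ (cutAt a kolm) w = _ := hall.fderiv
  rw [heq]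
  have hpow : (2 * d : ℝ) * (-w.1) ^ (2 * d - 1) / ((-w.1) ^ (2 * d)) ^ 2 =
      2 * d / (-w.1) * ((-w.1) ^ (2 * d))⁻¹ := by
    -- The exponent 2d - 1 is truncated at d = 0, where the factor 2d vanishes.
    rcases Nat.eq_zero_or_pos d with rfl | hd
    · simp
    · have : (-w.1) ^ (2 * d) = (-w.1) ^ (2 * d - 1) * (-w.1) := by
        rw [← pow_succ]; congr 1; omega
      have h2 : (-w.1) ^ (2 * d - 1) ≠ 0 := pow_ne_zero _ h1
      rw [this]
      field_simp
  simp only [add_apply, smul_apply,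
    neg_apply, comp_apply, Pi.mul_apply, Pi.inv_apply,
    ContinuousLinearMap.coe_fst', smul_eq_mul, kolm, Nat.cast_mul, Nat.cast_ofNat]
  linear_combination a (-w.1) * Real.smoothTransition (57 - quad w) * e.1 * hpow

lemma differentiableAt_cutAt_kolm {a : ℝ → ℝ} (hac : Differentiable ℝ a) {w : Z d} (hw : w.1 < 0) :
    DifferentiableAt ℝ (cutAt a kolm) w :=
  ((hac _).comp w differentiable_fst.neg.differentiableAt).mul
    ((contDiffAt_kolm hw).differentiableAt (by simp))

lemma velDeriv_cutAt_kolm {a : ℝ → ℝ} (hac : Differentiable ℝ a) {w : Z d} (hw : w.1 < 0) (e : E d) :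
    velDeriv (cutAt a kolm) w e = -(a (-w.1) * (((-w.1) ^ (2 * d))⁻¹ *
      (deriv Real.smoothTransition (57 - quad w) *
        (3 * inner ℝ w.2.1 e / (-w.1) ^ 2 + 2 * inner ℝ w.2.2 e / (-w.1))))) := by
  rw [← velDeriv_quad hw, velDeriv, fderiv_cutAt_kolm hac hw, velDeriv]
  ring

/-- Summed over i with e the i-th basis vector, this gives the velocity divergence 2d/τ of the
drift, which matches the time derivative of the factor τ^(-2d) in `kolm`. -/
lemma velDeriv_drift_apply {w : Z d} (hw : w.1 < 0) (i : Fin d) (e : E d) :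
    velDeriv (fun w : Z d => drift w i) w e = 2 / (-w.1) * e i := by
  have hd : DifferentiableAt ℝ (fun w : Z d => drift w i) w :=
    (EuclideanSpace.proj (𝕜 := ℝ) i).differentiableAt.comp w
      ((contDiffAt_drift hw).differentiableAt (by simp))
  refine fderiv_eq_of_hasDerivAt hd ?_
  obtain ⟨t, x, v⟩ := w
  have heq : (fun s : ℝ => drift ((t, x, v) + s • ((0 : ℝ), (0 : E d), e)) i) = fun s =>
      9 / 2 / (-t) ^ 2 * x i + 2 / (-t) * (v i + s * e i) := by
    ext s
    simp [drift, mul_add]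
  rw [heq]
  have := ((((hasDerivAt_id (0 : ℝ)).mul_const (e i)).const_add (v i)).const_mul
    (2 / (-t))).const_add (9 / 2 / (-t) ^ 2 * x i)
  refine HasDerivAt.congr_deriv this ?_
  simp

/-- The `i`-th component of the flux that compensates the transport of the density. -/
noncomputable def kolmFlux (i : Fin d) (w : Z d) : ℝ := kolm w * drift w i

lemma contDiffAt_kolmFlux (i : Fin d) {w : Z d} (hw : w.1 < 0) : ContDiffAt ℝ ∞ (kolmFlux i) w :=
  (contDiffAt_kolm hw).mul
    ((EuclideanSpace.proj (𝕜 := ℝ) i).contDiff.contDiffAt.comp w (contDiffAt_drift hw))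

lemma transport_eq_zero_of_eventuallyEq {φ : Z d → ℝ} {w : Z d} (h : φ =ᶠ[𝓝 w] fun _ => 0) :
    transport φ w = 0 := by
  rw [transport, h.fderiv_eq]; simp

lemma velDeriv_eq_zero_of_eventuallyEq {φ : Z d → ℝ} {w : Z d} (h : φ =ᶠ[𝓝 w] fun _ => 0)
    (e : E d) : velDeriv φ w e = 0 := by
  rw [velDeriv, h.fderiv_eq]; simp

/-- The transport equation with flux that is solved by the cut off density. -/
lemma transport_cutAt_kolm {a : ℝ → ℝ} (hac : Differentiable ℝ a) {ε : ℝ} (hε : 0 < ε)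
    (ha : ∀ τ ≤ ε, a τ = 0) (w : Z d) :
    transport (cutAt a kolm) w = -cutAt (deriv a) kolm w +
      ∑ i, velDeriv (cutAt a (kolmFlux i)) w (EuclideanSpace.single i 1) := by
  rcases lt_or_ge w.1 0 with hw | hw
  · have h1 : ∀ i, velDeriv (cutAt a (kolmFlux i)) w (EuclideanSpace.single i 1) =
        a (-w.1) * kolm w * (2 / (-w.1)) +
          drift w i * velDeriv (cutAt a kolm) w (EuclideanSpace.single i 1) := by
      intro i
      have hd : DifferentiableAt ℝ (fun w : Z d => drift w i) w :=
        (EuclideanSpace.proj (𝕜 := ℝ) i).differentiableAt.comp w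
          ((contDiffAt_drift hw).differentiableAt (by simp))
      have e1 : cutAt a (kolmFlux i) = fun w => cutAt a kolm w * drift w i := by
        ext w; simp only [cutAt, kolmFlux]; ring
      rw [velDeriv, e1, fderiv_fun_mul (differentiableAt_cutAt_kolm hac hw) hd]
      have := velDeriv_drift_apply hw i (EuclideanSpace.single i 1)
      rw [velDeriv] at this
      simp only [add_apply, smul_apply, this, smul_eq_mul]
      simp [cutAt, velDeriv]
    simp_rw [h1]
    rw [Finset.sum_add_distrib, ← velDeriv_eq_sum, velDeriv_cutAt_kolm hac hw, inner_drift,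
      ← transport_quad hw, transport, fderiv_cutAt_kolm hac hw]
    simp only [Finset.sum_const, Finset.card_univ, Fintype.card_fin, nsmul_eq_mul, cutAt, transport]
    ring
  · have hw' : -ε < w.1 := by linarith
    rw [transport_eq_zero_of_eventuallyEq (cutAt_eventuallyEq_zero ha _ hw'),
      Finset.sum_eq_zero fun i _ =>
        velDeriv_eq_zero_of_eventuallyEq (cutAt_eventuallyEq_zero ha _ hw') _]
    have : deriv a (-w.1) = 0 := by
      have : a =ᶠ[𝓝 (-w.1)] fun _ => 0 := by
        filter_upwards [gt_mem_nhds (show -w.1 < ε by linarith)] with τ hτ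
        exact ha τ (le_of_lt hτ)
      rw [this.deriv_eq]; simp
    simp [cutAt, this]

/-- Complete the square in x; what remains is |v|²/(2τ), and 114 = 2 · 57. -/
lemma norm_snd_snd_sq_le {w : Z d} (hw : w.1 < 0) (hq : quad w ≤ 57) :
    ‖w.2.2‖ ^ 2 ≤ 114 * (-w.1) := by
  set τ := -w.1 with hτ
  have hτ0 : 0 < τ := by linarith
  have h1 : quad w = 9 / 2 * ‖w.2.1 + (τ / 3) • w.2.2‖ ^ 2 / τ ^ 3 + ‖w.2.2‖ ^ 2 / (2 * τ) := by
    rw [norm_add_sq_real, real_inner_smul_right, norm_smul, mul_pow, Real.norm_eq_abs, sq_abs, quad,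
      ← hτ]
    field_simp
    ring
  have h2 : 0 ≤ 9 / 2 * ‖w.2.1 + (τ / 3) • w.2.2‖ ^ 2 / τ ^ 3 := by positivity
  have h3 : ‖w.2.2‖ ^ 2 / (2 * τ) ≤ 57 := by linarith
  rw [div_le_iff₀ (by positivity)] at h3
  linarith

/-- Complete the square in v; what remains is (9/4)|x|²/τ³, and 76/3 = 57 · 4/9. -/
lemma norm_snd_fst_sq_le {w : Z d} (hw : w.1 < 0) (hq : quad w ≤ 57) :
    ‖w.2.1‖ ^ 2 ≤ 76 / 3 * (-w.1) ^ 3 := by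
  set τ := -w.1 with hτ
  have hτ0 : 0 < τ := by linarith
  have h1 : quad w = 9 / 4 * ‖w.2.1‖ ^ 2 / τ ^ 3 + ‖(3 / 2 : ℝ) • w.2.1 + τ • w.2.2‖ ^ 2 / τ ^ 3 := by
    rw [norm_add_sq_real, real_inner_smul_right, real_inner_smul_left, norm_smul, norm_smul, mul_pow,
      mul_pow, Real.norm_eq_abs, Real.norm_eq_abs, sq_abs, sq_abs, quad, ← hτ]
    field_simp
    ring
  have h2 : 0 ≤ ‖(3 / 2 : ℝ) • w.2.1 + τ • w.2.2‖ ^ 2 / τ ^ 3 := by positivity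
  have h3 : 9 / 4 * ‖w.2.1‖ ^ 2 / τ ^ 3 ≤ 57 := by linarith
  rw [div_le_iff₀ (by positivity)] at h3
  linarith

lemma norm_snd_snd_le {w : Z d} (hw : w.1 < 0) (hq : quad w ≤ 57) :
    ‖w.2.2‖ ≤ 11 * √(-w.1) := by
  refine le_of_sq_le_sq ?_ (by positivity)
  rw [mul_pow, Real.sq_sqrt (by linarith)]
  linarith [norm_snd_snd_sq_le hw hq]

lemma norm_snd_fst_le {w : Z d} (hw : w.1 < 0) (hq : quad w ≤ 57) :
    ‖w.2.1‖ ≤ 6 * ((-w.1) * √(-w.1)) := by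
  have h0 : 0 < -w.1 := by linarith
  refine le_of_sq_le_sq ?_ (by positivity)
  rw [mul_pow, mul_pow, Real.sq_sqrt h0.le]
  have : 0 < (-w.1) ^ 3 := by positivity
  linarith [norm_snd_fst_sq_le hw hq]

lemma quad_lt_of_kolm_ne_zero {w : Z d} (h : kolm w ≠ 0) : quad w < 57 := by
  by_contra hq
  push Not at hq
  exact h (by rw [kolm, Real.smoothTransition.zero_of_nonpos (by linarith), mul_zero])

lemma deriv_smoothTransition_of_neg {s : ℝ} (hs : s < 0) : deriv Real.smoothTransition s = 0 := by
  have : Real.smoothTransition =ᶠ[𝓝 s] fun _ => 0 := by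
    filter_upwards [gt_mem_nhds hs] with t ht
    exact Real.smoothTransition.zero_of_nonpos (le_of_lt ht)
  rw [this.deriv_eq]; simp

lemma exists_deriv_smoothTransition_bound :
    ∃ C : ℝ, 0 ≤ C ∧ ∀ s, |deriv Real.smoothTransition s| ≤ C := by
  have hc : HasCompactSupport (deriv Real.smoothTransition) := by
    refine HasCompactSupport.intro (isCompact_Icc (a := (0 : ℝ)) (b := 1)) fun s hs => ?_
    rcases lt_or_ge s 0 with h | h
    · exact deriv_smoothTransition_of_neg h
    · have h1 : 1 < s := by
        by_contra hle
        exact hs ⟨h, not_lt.1 hle⟩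
      have : Real.smoothTransition =ᶠ[𝓝 s] fun _ => 1 := by
        filter_upwards [lt_mem_nhds h1] with t ht
        exact Real.smoothTransition.one_of_one_le (le_of_lt ht)
      rw [this.deriv_eq]; simp
  obtain ⟨C, hC⟩ := hc.exists_bound_of_continuous
    ((Real.smoothTransition.contDiff (n := ⊤)).continuous_deriv (by simp))
  exact ⟨C, (norm_nonneg _).trans (hC 0), hC⟩

/-- The region in which the self-similar density lives, up to time `-1`. -/
def kernelSet (d : ℕ) : Set (Z d) :=
  {w | -1 ≤ w.1 ∧ w.1 < 0 ∧ ‖w.2.1‖ ≤ 6 * ((-w.1) * √(-w.1)) ∧ ‖w.2.2‖ ≤ 11 * √(-w.1)}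

/-- The integrable kernel that bounds the gradient and the flux. -/
noncomputable def kernel (w : Z d) : ℝ :=
  (kernelSet d).indicator (fun w => ((-w.1) ^ (2 * d) * √(-w.1))⁻¹) w

lemma mem_kernelSet {w : Z d} (h1 : -1 ≤ w.1) (hw : w.1 < 0) (hq : quad w ≤ 57) :
    w ∈ kernelSet d := ⟨h1, hw, norm_snd_fst_le hw hq, norm_snd_snd_le hw hq⟩

lemma kernel_nonneg (w : Z d) : 0 ≤ kernel w := by
  refine indicator_nonneg (fun w hw => ?_) w
  have : 0 < -w.1 := by linarith [hw.2.1]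
  positivity

lemma sqrt_bounds {w : Z d} (hw : w ∈ kernelSet d) :
    ‖w.2.1‖ / (-w.1) ^ 2 ≤ 6 * (√(-w.1))⁻¹ ∧ ‖w.2.2‖ / (-w.1) ≤ 11 * (√(-w.1))⁻¹ := by
  obtain ⟨-, hw0, hx, hv⟩ := hw
  have h0 : 0 < -w.1 := by linarith
  have hs : 0 < √(-w.1) := Real.sqrt_pos.2 h0
  have hss : √(-w.1) * √(-w.1) = -w.1 := Real.mul_self_sqrt h0.le
  constructor
  · rw [div_le_iff₀ (by positivity)]
    refine hx.trans (le_of_eq ?_)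
    rw [eq_comm, mul_assoc, mul_eq_mul_left_iff]
    left
    rw [inv_mul_eq_iff_eq_mul₀ hs.ne']
    linear_combination (-(-w.1)) * hss
  · rw [div_le_iff₀ h0]
    refine hv.trans (le_of_eq ?_)
    rw [eq_comm, mul_assoc, mul_eq_mul_left_iff]
    left
    rw [inv_mul_eq_iff_eq_mul₀ hs.ne', hss]

/-- The velocity gradient and the flux of the cut off density are bounded by the kernel. -/
lemma exists_kernel_bound : ∃ C : ℝ, 0 < C ∧ ∀ (d : ℕ) (a : ℝ → ℝ) (ε : ℝ), 0 < ε →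
    Differentiable ℝ a → (∀ τ, 0 ≤ a τ ∧ a τ ≤ 1) → (∀ τ ≤ ε, a τ = 0) → (∀ τ ≥ 1, a τ = 0) →
    (∀ (w : Z d) (e : E d), |velDeriv (cutAt a kolm) w e| ≤ C * kernel w * ‖e‖) ∧
    (∀ w : Z d, |cutAt a kolm w| * ‖drift w‖ ≤ C * kernel w) := by
  obtain ⟨C, hC0, hC⟩ := exists_deriv_smoothTransition_bound
  -- On the support, |x|/τ² ≤ 6 τ^(-1/2) and |v|/τ ≤ 11 τ^(-1/2). So 40 = 3 · 6 + 2 · 11 bounds the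
  -- velocity gradient of `quad`, and 49 = (9/2) · 6 + 2 · 11 bounds the drift.
  refine ⟨40 * C + 49, by positivity, fun d a ε hε hac ha01 ha ha1 => ⟨fun w e => ?_, fun w => ?_⟩⟩
  · have hpos : 0 ≤ (40 * C + 49) * kernel w * ‖e‖ :=
      mul_nonneg (mul_nonneg (by positivity) (kernel_nonneg w)) (norm_nonneg _)
    rcases le_or_gt 0 w.1 with hw | hw
    · rw [velDeriv_eq_zero_of_eventuallyEq (cutAt_eventuallyEq_zero ha _ (by linarith)), abs_zero]
      exact hpos
    rw [velDeriv_cutAt_kolm hac hw]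
    rcases lt_or_ge w.1 (-1) with h1 | h1
    · rw [ha1 _ (by linarith)]; simpa using hpos
    rcases lt_or_ge 57 (quad w) with hq | hq
    · rw [deriv_smoothTransition_of_neg (by linarith)]; simpa using hpos
    have hmem := mem_kernelSet h1 hw hq
    obtain ⟨b1, b2⟩ := sqrt_bounds hmem
    have h0 : 0 < -w.1 := by linarith
    have hP : 0 < ((-w.1) ^ (2 * d))⁻¹ := by positivity
    have i1 : |3 * inner ℝ w.2.1 e / (-w.1) ^ 2 + 2 * inner ℝ w.2.2 e / (-w.1)| ≤
        40 * (√(-w.1))⁻¹ * ‖e‖ := by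
      have j1 : |3 * inner ℝ w.2.1 e / (-w.1) ^ 2| ≤ 3 * (‖w.2.1‖ / (-w.1) ^ 2) * ‖e‖ := by
        rw [abs_div, abs_mul, abs_of_pos (show (0 : ℝ) < 3 by norm_num),
          abs_of_pos (show 0 < (-w.1) ^ 2 by positivity)]
        have := abs_real_inner_le_norm w.2.1 e
        calc 3 * |inner ℝ w.2.1 e| / (-w.1) ^ 2 ≤ 3 * (‖w.2.1‖ * ‖e‖) / (-w.1) ^ 2 := by gcongr
          _ = _ := by ring
      have j2 : |2 * inner ℝ w.2.2 e / (-w.1)| ≤ 2 * (‖w.2.2‖ / (-w.1)) * ‖e‖ := by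
        rw [abs_div, abs_mul, abs_of_pos (show (0 : ℝ) < 2 by norm_num), abs_of_pos h0]
        have := abs_real_inner_le_norm w.2.2 e
        calc 2 * |inner ℝ w.2.2 e| / (-w.1) ≤ 2 * (‖w.2.2‖ * ‖e‖) / (-w.1) := by gcongr
          _ = _ := by ring
      refine (abs_add_le _ _).trans ((add_le_add j1 j2).trans ?_)
      rw [← add_mul]
      refine mul_le_mul_of_nonneg_right ?_ (norm_nonneg _)
      linarith
    rw [abs_neg, abs_mul, abs_mul, abs_mul, abs_of_nonneg (ha01 _).1, abs_of_pos hP, kernel,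
      indicator_of_mem hmem, mul_inv]
    calc a (-w.1) * (((-w.1) ^ (2 * d))⁻¹ * (|deriv Real.smoothTransition (57 - quad w)| *
          |3 * inner ℝ w.2.1 e / (-w.1) ^ 2 + 2 * inner ℝ w.2.2 e / (-w.1)|))
        ≤ 1 * (((-w.1) ^ (2 * d))⁻¹ * (C * (40 * (√(-w.1))⁻¹ * ‖e‖))) := by
          gcongr
          · exact (ha01 _).2
          · exact hC _
      _ = 40 * C * ((((-w.1) ^ (2 * d))⁻¹ * (√(-w.1))⁻¹) * ‖e‖) := by ring
      _ ≤ (40 * C + 49) * ((((-w.1) ^ (2 * d))⁻¹ * (√(-w.1))⁻¹) * ‖e‖) := by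
          gcongr; linarith
      _ = _ := by ring
  · have hpos : 0 ≤ (40 * C + 49) * kernel w := mul_nonneg (by positivity) (kernel_nonneg w)
    rcases le_or_gt 0 w.1 with hw | hw
    · rw [cutAt_eq_zero ha (by linarith)]; simpa using hpos
    rcases lt_or_ge w.1 (-1) with h1 | h1
    · rw [cutAt, ha1 _ (by linarith)]; simpa using hpos
    rcases lt_or_ge 57 (quad w) with hq | hq
    · rw [cutAt, kolm, Real.smoothTransition.zero_of_nonpos (by linarith)]; simpa using hpos
    have hmem := mem_kernelSet h1 hw hq
    obtain ⟨b1, b2⟩ := sqrt_bounds hmem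
    have h0 : 0 < -w.1 := by linarith
    have hP : 0 < ((-w.1) ^ (2 * d))⁻¹ := by positivity
    have i1 : ‖drift w‖ ≤ 49 * (√(-w.1))⁻¹ := by
      refine (norm_add_le _ _).trans ?_
      rw [norm_smul, norm_smul, Real.norm_of_nonneg (by positivity),
        Real.norm_of_nonneg (by positivity)]
      calc 9 / 2 / (-w.1) ^ 2 * ‖w.2.1‖ + 2 / (-w.1) * ‖w.2.2‖
          = 9 / 2 * (‖w.2.1‖ / (-w.1) ^ 2) + 2 * (‖w.2.2‖ / (-w.1)) := by ring
        _ ≤ _ := by linarith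
    rw [cutAt, kolm, abs_mul, abs_mul, abs_of_nonneg (ha01 _).1, abs_of_pos hP,
      abs_of_nonneg (Real.smoothTransition.nonneg _), kernel, indicator_of_mem hmem, mul_inv]
    calc a (-w.1) * (((-w.1) ^ (2 * d))⁻¹ * Real.smoothTransition (57 - quad w)) * ‖drift w‖
        ≤ 1 * (((-w.1) ^ (2 * d))⁻¹ * 1) * (49 * (√(-w.1))⁻¹) := by
          gcongr
          · exact mul_nonneg hP.le (Real.smoothTransition.nonneg _)
          · exact (ha01 _).2
          · exact Real.smoothTransition.le_one _
      _ = 49 * (((-w.1) ^ (2 * d))⁻¹ * (√(-w.1))⁻¹) := by ring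
      _ ≤ (40 * C + 49) * (((-w.1) ^ (2 * d))⁻¹ * (√(-w.1))⁻¹) := by
          gcongr; linarith

end

/-! ### Integrability of the kernel -/

section

variable {d : ℕ}

lemma measurableSet_kernelSet : MeasurableSet (kernelSet d) := by
  have h1 : Measurable fun w : Z d => w.1 := measurable_fst
  have h2 : Measurable fun w : Z d => √(-w.1) := h1.neg.sqrt
  have hx : Measurable fun w : Z d => ‖w.2.1‖ := by fun_prop
  have hv : Measurable fun w : Z d => ‖w.2.2‖ := by fun_prop
  exact (measurableSet_le measurable_const h1).inter ((measurableSet_lt h1 measurable_const).inter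
    ((measurableSet_le hx (measurable_const.mul (h1.neg.mul h2))).inter
      (measurableSet_le hv (measurable_const.mul h2))))

lemma measurable_kernel : Measurable (kernel : Z d → ℝ) := by
  unfold kernel
  refine Measurable.indicator ?_ measurableSet_kernelSet
  fun_prop

lemma integrableOn_inv_sqrt_neg : IntegrableOn (fun t : ℝ => (√(-t))⁻¹) (Ico (-1) 0) := by
  have h : IntervalIntegrable (fun x : ℝ => x ^ (-(1 / 2) : ℝ)) volume 0 1 :=
    intervalIntegral.intervalIntegrable_rpow' (by norm_num)
  have h2 := ((IntervalIntegrable.iff_comp_neg enorm_ne_top).1 h).symm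
  rw [neg_zero, intervalIntegrable_iff_integrableOn_Ico_of_le (by norm_num)] at h2
  refine h2.congr_fun (fun t ht => ?_) measurableSet_Ico
  have : 0 ≤ -t := by linarith [ht.2]
  simp only
  rw [Real.rpow_neg this, Real.sqrt_eq_rpow]

/-- The slice is a product of balls of radii 6τ^(3/2) and 11τ^(1/2), of volume proportional to 66^d
τ^(2d). This cancels the power in the kernel and leaves the integrable singularity τ^(-1/2). -/
lemma lintegral_kernel_section (t : ℝ) :
    ∫⁻ p : E d × E d, ENNReal.ofReal (kernel (t, p)) = (Ico (-1) 0).indicator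
      (fun t => ENNReal.ofReal (66 ^ d * (√(-t))⁻¹) * volume (Metric.ball (0 : E d) 1) ^ 2) t := by
  by_cases ht : t ∈ Ico (-1 : ℝ) 0
  · rw [indicator_of_mem ht]
    have h0 : 0 < -t := by linarith [ht.2]
    have hs : 0 < √(-t) := Real.sqrt_pos.2 h0
    have hss : √(-t) * √(-t) = -t := Real.mul_self_sqrt h0.le
    have e : (fun p : E d × E d => ENNReal.ofReal (kernel (t, p))) =
        (Metric.closedBall (0 : E d) (6 * (-t * √(-t))) ×ˢ
          Metric.closedBall (0 : E d) (11 * √(-t))).indicator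
            fun _ => ENNReal.ofReal (((-t) ^ (2 * d) * √(-t))⁻¹) := by
      ext p
      by_cases hp : ((t, p) : Z d) ∈ kernelSet d
      · rw [kernel, indicator_of_mem hp, indicator_of_mem]
        exact ⟨by simpa using hp.2.2.1, by simpa using hp.2.2.2⟩
      · rw [kernel, indicator_of_notMem hp, indicator_of_notMem, ENNReal.ofReal_zero]
        rintro ⟨h1, h2⟩
        exact hp ⟨ht.1, ht.2, by simpa using h1, by simpa using h2⟩
    rw [e, lintegral_indicator (measurableSet_closedBall.prod measurableSet_closedBall),
      setLIntegral_const, Measure.volume_eq_prod, Measure.prod_prod,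
      Measure.addHaar_closedBall _ _ (by positivity), Measure.addHaar_closedBall _ _ (by positivity),
      finrank_euclideanSpace_fin, mul_mul_mul_comm, ← ENNReal.ofReal_mul (by positivity), ← mul_assoc,
      ← ENNReal.ofReal_mul (by positivity), sq]
    congr 2
    rw [← mul_pow]
    have h3 : 6 * (-t * √(-t)) * (11 * √(-t)) = 66 * (-t) ^ 2 := by
      linear_combination 66 * (-t) * hss
    rw [h3, mul_pow, ← pow_mul]
    have : (-t) ^ (2 * d) ≠ 0 := by positivity
    field_simp
  · rw [indicator_of_notMem ht]
    have : ∀ p : E d × E d, kernel (t, p) = 0 := fun p => by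
      rw [kernel, indicator_of_notMem]
      exact fun h => ht ⟨h.1, h.2.1⟩
    simp [this]

lemma lintegral_kernel_lt_top : ∫⁻ w : Z d, ENNReal.ofReal (kernel w) < ⊤ := by
  rw [Measure.volume_eq_prod, lintegral_prod _ measurable_kernel.ennreal_ofReal.aemeasurable]
  simp_rw [lintegral_kernel_section]
  rw [lintegral_indicator measurableSet_Ico, lintegral_mul_const' _ _ (by
    exact ENNReal.pow_ne_top measure_ball_lt_top.ne)]
  exact ENNReal.mul_lt_top (integrableOn_inv_sqrt_neg.const_mul _).lintegral_lt_top
    (ENNReal.pow_lt_top measure_ball_lt_top)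

/-! ### The amplitude in time and the geometry of the supports -/

/-- The weight in time of the final density: a bump around `τ = 2r²`, where `r = 1/20`. -/
noncomputable def timeWeight : ℝ → ℝ :=
  (⟨1 / 400, 11 / 4000, by norm_num, by norm_num⟩ : ContDiffBump (1 / 200 : ℝ)).normed volume

lemma contDiff_timeWeight : ContDiff ℝ ∞ timeWeight := ContDiffBump.contDiff_normed (n := ⊤) _

lemma timeWeight_nonneg (τ : ℝ) : 0 ≤ timeWeight τ := ContDiffBump.nonneg_normed _ _

lemma timeWeight_eq_zero {τ : ℝ} (h : τ ≤ 9 / 4000 ∨ 31 / 4000 ≤ τ) : timeWeight τ = 0 := by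
  rw [← notMem_support, timeWeight, ContDiffBump.support_normed_eq, Metric.mem_ball, Real.dist_eq,
    not_lt, le_abs]
  rcases h with h | h
  · right; norm_num; linarith
  · left; norm_num; linarith

lemma exists_timeWeight_ge : ∃ κ : ℝ, 0 < κ ∧ ∀ τ ∈ Icc (1 / 400 : ℝ) (3 / 400), κ ≤ timeWeight τ := by
  let b : ContDiffBump (1 / 200 : ℝ) := ⟨1 / 400, 11 / 4000, by norm_num, by norm_num⟩
  refine ⟨1 / ∫ x, b x, one_div_pos.2 b.integral_pos, fun τ hτ => ?_⟩
  rw [show timeWeight τ = b τ / ∫ x, b x from rfl, b.one_of_mem_closedBall]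
  rw [Metric.mem_closedBall, Real.dist_eq, abs_le]
  constructor
  · show -(1 / 400 : ℝ) ≤ _
    linarith [hτ.1]
  · show _ ≤ (1 / 400 : ℝ)
    linarith [hτ.2]

lemma prim_timeWeight_nonneg (τ : ℝ) : 0 ≤ prim timeWeight τ :=
  prim_nonneg (fun s hs => timeWeight_eq_zero (Or.inl (by linarith))) timeWeight_nonneg τ

lemma prim_timeWeight_of_le {τ : ℝ} (hτ : τ ≤ 9 / 4000) : prim timeWeight τ = 0 := by
  rw [prim]
  refine intervalIntegral.integral_zero_ae (ae_of_all _ fun t ht => ?_)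
  refine timeWeight_eq_zero (Or.inl ?_)
  rw [mem_uIoc] at ht
  rcases ht with h | h <;> linarith [h.2]

lemma prim_timeWeight_of_ge {τ : ℝ} (hτ : 31 / 4000 ≤ τ) : prim timeWeight τ = 1 := by
  have h : ∫ t, timeWeight t = 1 := ContDiffBump.integral_normed _
  rw [prim, intervalIntegral.integral_eq_integral_of_support_subset, h]
  intro t ht
  constructor
  · by_contra hlt
    exact ht (timeWeight_eq_zero (Or.inl (by linarith)))
  · by_contra hlt
    exact ht (timeWeight_eq_zero (Or.inr (by linarith)))

lemma monotone_prim_timeWeight : Monotone (prim timeWeight) :=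
  monotone_of_deriv_nonneg (differentiable_prim contDiff_timeWeight.continuous) fun τ => by
    rw [deriv_prim contDiff_timeWeight.continuous]; exact timeWeight_nonneg τ

lemma prim_timeWeight_le_one (τ : ℝ) : prim timeWeight τ ≤ 1 := by
  rw [← prim_timeWeight_of_ge (le_max_right τ (31 / 4000))]
  exact monotone_prim_timeWeight (le_max_left _ _)

/-- The smooth step in time from `0` for `τ ≤ ε` to `1` for `τ ≥ 2ε`. -/
noncomputable def timeStep (ε τ : ℝ) : ℝ := Real.smoothTransition (ε⁻¹ * τ - 1)

lemma contDiff_timeStep (ε : ℝ) : ContDiff ℝ ∞ (timeStep ε) :=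
  (Real.smoothTransition.contDiff (n := ⊤)).comp ((contDiff_const.mul contDiff_id).sub
    contDiff_const)

lemma timeStep_of_le {ε τ : ℝ} (hε : 0 < ε) (hτ : τ ≤ ε) : timeStep ε τ = 0 := by
  refine Real.smoothTransition.zero_of_nonpos ?_
  have : ε⁻¹ * τ ≤ ε⁻¹ * ε := mul_le_mul_of_nonneg_left hτ (by positivity)
  rw [inv_mul_cancel₀ hε.ne'] at this
  linarith

lemma timeStep_of_ge {ε τ : ℝ} (hε : 0 < ε) (hτ : 2 * ε ≤ τ) : timeStep ε τ = 1 := by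
  refine Real.smoothTransition.one_of_one_le ?_
  have : ε⁻¹ * (2 * ε) ≤ ε⁻¹ * τ := mul_le_mul_of_nonneg_left hτ (by positivity)
  have h2 : ε⁻¹ * (2 * ε) = 2 := by field_simp
  linarith

lemma deriv_timeStep_nonneg {ε : ℝ} (hε : 0 < ε) (τ : ℝ) : 0 ≤ deriv (timeStep ε) τ := by
  refine Monotone.deriv_nonneg fun s t hst => ?_
  refine Real.smoothTransition.monotone ?_
  have : ε⁻¹ * s ≤ ε⁻¹ * t := mul_le_mul_of_nonneg_left hst (by positivity)
  linarith

lemma contDiff_deriv_timeStep (ε : ℝ) : ContDiff ℝ ∞ (deriv (timeStep ε)) :=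
  (contDiff_infty_iff_deriv.1 (contDiff_timeStep ε)).2

lemma deriv_timeStep_of_le {ε τ : ℝ} (hε : 0 < ε) (hτ : τ ≤ ε) : deriv (timeStep ε) τ = 0 := by
  have hcl : Iic ε ⊆ {τ | deriv (timeStep ε) τ = 0} := by
    rw [← closure_Iio ε]
    refine closure_minimal (fun s hs => ?_)
      (isClosed_eq (contDiff_deriv_timeStep ε).continuous continuous_const)
    have : timeStep ε =ᶠ[𝓝 s] fun _ => 0 := by
      filter_upwards [gt_mem_nhds (show s < ε from hs)] with t ht
      exact timeStep_of_le hε (le_of_lt ht)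
    show deriv (timeStep ε) s = 0
    rw [this.deriv_eq]; simp
  exact hcl hτ

lemma deriv_timeStep_of_ge {ε τ : ℝ} (hε : 0 < ε) (hτ : 2 * ε < τ) : deriv (timeStep ε) τ = 0 := by
  have : timeStep ε =ᶠ[𝓝 τ] fun _ => 1 := by
    filter_upwards [lt_mem_nhds hτ] with t ht
    exact timeStep_of_ge hε (le_of_lt ht)
  rw [this.deriv_eq]; simp

/-- The amplitude in time of the test function. -/
noncomputable def amplitude (ε τ : ℝ) : ℝ := timeStep ε τ - prim timeWeight τ

lemma contDiff_amplitude (ε : ℝ) : ContDiff ℝ ∞ (amplitude ε) :=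
  (contDiff_timeStep ε).sub (contDiff_prim contDiff_timeWeight)

lemma deriv_amplitude (ε : ℝ) : deriv (amplitude ε) = fun τ => deriv (timeStep ε) τ - timeWeight τ := by
  ext τ
  have h1 := ((contDiff_timeStep ε).differentiable (by simp) τ).hasDerivAt
  have h2 := (differentiable_prim contDiff_timeWeight.continuous τ).hasDerivAt
  have := (h1.sub h2).deriv
  rw [deriv_prim contDiff_timeWeight.continuous] at this
  exact this

lemma amplitude_of_le {ε τ : ℝ} (hε : 0 < ε) (hε2 : ε < 1 / 1000) (hτ : τ ≤ ε) :
    amplitude ε τ = 0 := by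
  rw [amplitude, timeStep_of_le hε hτ, prim_timeWeight_of_le (by linarith), sub_zero]

lemma amplitude_of_ge {ε τ : ℝ} (hε : 0 < ε) (hε2 : ε < 1 / 1000) (hτ : 31 / 4000 ≤ τ) :
    amplitude ε τ = 0 := by
  rw [amplitude, timeStep_of_ge hε (by linarith), prim_timeWeight_of_ge hτ, sub_self]

/-- The step has reached 1 by time 2ε < 9/4000, before the primitive of the weight starts to grow.
The amplitude thus rises from 0 to 1 and then returns to 0; the derivatives of the two phases are
the two densities to be compared. -/
lemma amplitude_bounds {ε : ℝ} (hε : 0 < ε) (hε2 : ε < 1 / 1000) (τ : ℝ) :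
    0 ≤ amplitude ε τ ∧ amplitude ε τ ≤ 1 := by
  have h1 := prim_timeWeight_nonneg τ
  have h2 := prim_timeWeight_le_one τ
  have h3 : 0 ≤ timeStep ε τ := Real.smoothTransition.nonneg _
  have h4 : timeStep ε τ ≤ 1 := Real.smoothTransition.le_one _
  refine ⟨?_, by rw [amplitude]; linarith⟩
  rcases le_total τ (9 / 4000) with h | h
  · rw [amplitude, prim_timeWeight_of_le h]; linarith
  · rw [amplitude, timeStep_of_ge hε (by linarith)]; linarith

/-- A compact set that contains the supports of the cut off densities. -/
def suppSet (d : ℕ) (ε : ℝ) : Set (Z d) :=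
  Icc (-(31 / 4000)) (-ε) ×ˢ Metric.closedBall 0 (7 / 2000) ×ˢ Metric.closedBall 0 (47 / 50)

lemma isCompact_suppSet (ε : ℝ) : IsCompact (suppSet d ε) :=
  isCompact_Icc.prod ((isCompact_closedBall _ _).prod (isCompact_closedBall _ _))

/-- The radii are what the bounds on |x|² and |v|² give at τ = 31/4000: 114 · 31/4000 lies just
under (47/50)². -/
lemma mem_suppSet {ε : ℝ} (hε : 0 < ε) {w : Z d} (h1 : -(31 / 4000) ≤ w.1) (h2 : w.1 ≤ -ε)
    (hq : quad w ≤ 57) : w ∈ suppSet d ε := by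
  have hw : w.1 < 0 := by linarith
  refine ⟨⟨h1, h2⟩, ?_, ?_⟩
  · rw [mem_closedBall_zero_iff]
    refine le_of_sq_le_sq ?_ (by norm_num)
    refine (norm_snd_fst_sq_le hw hq).trans ?_
    have : (-w.1) ^ 3 ≤ (31 / 4000) ^ 3 := pow_le_pow_left₀ (by linarith) (by linarith) 3
    norm_num at this ⊢
    linarith
  · rw [mem_closedBall_zero_iff]
    refine le_of_sq_le_sq ?_ (by norm_num)
    refine (norm_snd_snd_sq_le hw hq).trans ?_
    norm_num; linarith

lemma support_cutAt_subset {a : ℝ → ℝ} {ε : ℝ} (hε : 0 < ε) (ha : ∀ τ ≤ ε, a τ = 0)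
    (ha1 : ∀ τ > 31 / 4000, a τ = 0) {g : Z d → ℝ} (hg : ∀ w, kolm w = 0 → g w = 0) :
    support (cutAt a g) ⊆ suppSet d ε := by
  intro w hw
  have h1 := left_ne_zero_of_mul hw
  have h2 : kolm w ≠ 0 := fun h => right_ne_zero_of_mul hw (hg w h)
  refine mem_suppSet hε ?_ ?_ (quad_lt_of_kolm_ne_zero h2).le
  · by_contra hlt
    exact h1 (ha1 _ (by linarith))
  · by_contra hlt
    exact h1 (ha _ (by linarith))

lemma tsupport_cutAt_subset {a : ℝ → ℝ} {ε : ℝ} (hε : 0 < ε) (ha : ∀ τ ≤ ε, a τ = 0)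
    (ha1 : ∀ τ > 31 / 4000, a τ = 0) {g : Z d → ℝ} (hg : ∀ w, kolm w = 0 → g w = 0) :
    tsupport (cutAt a g) ⊆ suppSet d ε :=
  closure_minimal (support_cutAt_subset hε ha ha1 hg) (isCompact_suppSet ε).isClosed

/-- Here r = 1/20 is small enough: in velocity, 1/20 + 47/50 < 1, so the density centred at any
point of Q_r stays in the unit cylinder, where the gradient is controlled. -/
lemma gal_mem_of_mem_suppSet {ε : ℝ} (hε : 0 < ε) {z w : Z d} (hz : z ∈ cyl d (1 / 20))
    (hw : w ∈ suppSet d ε) : (gal z w).1 ≤ -ε ∧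
      gal z w ∈ Ioo (-1 : ℝ) 0 ×ˢ Metric.ball (0 : E d) 1 ×ˢ Metric.ball (0 : E d) 1 := by
  obtain ⟨⟨t1, t2⟩, hx, hv⟩ := hz
  obtain ⟨⟨s1, s2⟩, hy, hν⟩ := hw
  rw [mem_ball_zero_iff] at hx hv
  rw [mem_closedBall_zero_iff] at hy hν
  norm_num at t1 hx hv
  have h1 : (gal z w).1 ≤ -ε := by simp only [gal]; linarith
  refine ⟨h1, ⟨?_, by linarith⟩, ?_, ?_⟩
  · simp only [gal]; linarith
  · rw [mem_ball_zero_iff]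
    simp only [gal]
    have h3 : ‖w.1 • z.2.2‖ ≤ 1 * (1 / 20) := by
      rw [norm_smul, Real.norm_eq_abs]
      refine mul_le_mul ?_ hv.le (norm_nonneg _) zero_le_one
      rw [abs_le]; constructor <;> linarith
    calc ‖z.2.1 + w.2.1 + w.1 • z.2.2‖ ≤ ‖z.2.1‖ + ‖w.2.1‖ + ‖w.1 • z.2.2‖ := norm_add₃_le
      _ < 1 := by linarith
  · rw [mem_ball_zero_iff]
    simp only [gal]
    refine (norm_add_le _ _).trans_lt ?_
    linarith

lemma unit_box_subset_interior :
    Ioo (-1 : ℝ) 0 ×ˢ Metric.ball (0 : E d) 1 ×ˢ Metric.ball (0 : E d) 1 ⊆ interior (cyl d 2) := by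
  refine Subset.trans ?_ (Ioo_prod_subset_interior_cyl 2)
  refine prod_mono (Ioo_subset_Ioo_left (by norm_num)) (prod_mono ?_ ?_)
  · exact Metric.ball_subset_ball (by norm_num)
  · exact Metric.ball_subset_ball (by norm_num)

lemma unit_box_subset_cyl :
    Ioo (-1 : ℝ) 0 ×ˢ Metric.ball (0 : E d) 1 ×ˢ Metric.ball (0 : E d) 1 ⊆ cyl d 1 := by
  rw [cyl]
  norm_num
  exact prod_mono_left Ioo_subset_Ioc_self

lemma isTestFun_cutAt {a : ℝ → ℝ} (hac : ContDiff ℝ ∞ a) {ε : ℝ} (hε : 0 < ε)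
    (ha : ∀ τ ≤ ε, a τ = 0) (ha1 : ∀ τ > 31 / 4000, a τ = 0) {g : Z d → ℝ}
    (hg : ∀ w, kolm w = 0 → g w = 0) (hgs : ∀ w : Z d, w.1 < 0 → ContDiffAt ℝ ∞ g w)
    {z : Z d} (hz : z ∈ cyl d (1 / 20)) :
    IsTestFun (cyl d 2) (fun y => cutAt a g (gal (galInv z) y)) := by
  have hs := tsupport_cutAt_subset hε ha ha1 hg
  exact IsTestFun.comp_galInv (contDiff_cutAt hac hε ha hgs)
    ((isCompact_suppSet ε).of_isClosed_subset (isClosed_tsupport _) hs)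
    fun w hw => unit_box_subset_interior (gal_mem_of_mem_suppSet hε hz (hs hw)).2

lemma hasCompactSupport_cutAt {a : ℝ → ℝ} {ε : ℝ} (hε : 0 < ε)
    (ha : ∀ τ ≤ ε, a τ = 0) (ha1 : ∀ τ > 31 / 4000, a τ = 0) {g : Z d → ℝ}
    (hg : ∀ w, kolm w = 0 → g w = 0) : HasCompactSupport (cutAt a g) :=
  (isCompact_suppSet ε).of_isClosed_subset (isClosed_tsupport _) (tsupport_cutAt_subset hε ha ha1 hg)

/-- The density sits above `1` at the pairs of points of the two cylinders. -/
lemma one_le_kolm {z y : Z d} (hz : z ∈ cyl d (1 / 20)) (hy : y ∈ pastCyl d (1 / 20)) :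
    (gal (galInv z) y).1 ∈ Ioo (-(3 / 400) : ℝ) (-(1 / 400)) ∧ 1 ≤ kolm (gal (galInv z) y) := by
  obtain ⟨⟨t1, t2⟩, hx, hv⟩ := hz
  obtain ⟨⟨s1, s2⟩, hy, hν⟩ := hy
  rw [mem_ball_zero_iff] at hx hv hy hν
  norm_num at t1 s1 s2 hx hv hy hν
  obtain ⟨t₁, x₁, b⟩ := z
  obtain ⟨t₀, x₀, c⟩ := y
  simp only at t1 t2 s1 s2 hx hv hy hν
  have hw : gal (galInv (t₁, x₁, b)) (t₀, x₀, c) = (-(t₁ - t₀), (x₀ - x₁) + (t₁ - t₀) • b, c - b) := by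
    simp only [gal, galInv, Prod.mk.injEq]
    refine ⟨by ring, by module, by abel⟩
  rw [hw]
  set τ := t₁ - t₀ with hτdef
  have hτ1 : 1 / 400 < τ := by linarith
  have hτ2 : τ < 3 / 400 := by linarith
  have hτ0 : 0 < τ := by linarith
  refine ⟨⟨by simp only; linarith, by simp only; linarith⟩, ?_⟩
  set A := x₀ - x₁ with hA
  have hAn : ‖A‖ ≤ 1 / 4000 := (norm_sub_le _ _).trans (by linarith)
  have hq : quad ((-τ, A + τ • b, c - b) : Z d) ≤ 55 := by
    -- In this form |b|² appears with the favourable sign. With |A| ≤ 2r³ = 1/4000, |b| and |c|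
    -- below r = 1/20 and τ > r² = 1/400, the three terms are at most 81/2, 12 and 2, which sum to
    -- less than 55. The threshold 57 then leaves the margin 1 needed for the smooth step to equal
    -- 1.
    have e : quad ((-τ, A + τ • b, c - b) : Z d) = 9 / 2 * ‖A + τ • b‖ ^ 2 / τ ^ 3 +
        3 * (inner ℝ A c - inner ℝ A b) / τ ^ 2 +
          (inner ℝ c b + ‖c‖ ^ 2 - 2 * ‖b‖ ^ 2) / τ := by
      simp only [quad, neg_neg]
      rw [norm_sub_sq_real c b, inner_add_left, inner_sub_right, inner_sub_right,
        real_inner_smul_left, real_inner_smul_left, real_inner_self_eq_norm_sq, real_inner_comm b c]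
      field_simp
      ring
    have q1 : 9 / 2 * ‖A + τ • b‖ ^ 2 / τ ^ 3 ≤ 81 / 2 := by
      have n1 : ‖A + τ • b‖ ≤ 3 / 20 * τ := by
        refine (norm_add_le _ _).trans ?_
        rw [norm_smul, Real.norm_of_nonneg hτ0.le]
        nlinarith
      rw [div_le_iff₀ (by positivity)]
      have n2 : ‖A + τ • b‖ ^ 2 ≤ (3 / 20 * τ) ^ 2 := by gcongr
      have n3 : τ ^ 2 * (1 / 400) ≤ τ ^ 3 := by nlinarith [sq_nonneg τ]
      nlinarith
    have i1 : inner ℝ A c ≤ 1 / 4000 * (1 / 20) :=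
      (real_inner_le_norm _ _).trans (mul_le_mul hAn hν.le (norm_nonneg _) (by norm_num))
    have i2 : -inner ℝ A b ≤ 1 / 4000 * (1 / 20) := by
      have := neg_le_of_abs_le (abs_real_inner_le_norm A b)
      have h2 : ‖A‖ * ‖b‖ ≤ 1 / 4000 * (1 / 20) := mul_le_mul hAn hv.le (norm_nonneg _) (by norm_num)
      linarith
    have i3 : inner ℝ c b ≤ 1 / 20 * (1 / 20) :=
      (real_inner_le_norm _ _).trans (mul_le_mul hν.le hv.le (norm_nonneg _) (by norm_num))
    have q2 : 3 * (inner ℝ A c - inner ℝ A b) / τ ^ 2 ≤ 12 := by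
      rw [div_le_iff₀ (by positivity)]
      nlinarith
    have q3 : (inner ℝ c b + ‖c‖ ^ 2 - 2 * ‖b‖ ^ 2) / τ ≤ 2 := by
      rw [div_le_iff₀ hτ0]
      have : ‖c‖ ^ 2 ≤ (1 / 20) ^ 2 := by gcongr
      nlinarith [sq_nonneg ‖b‖]
    rw [e]; linarith
  rw [kolm, Real.smoothTransition.one_of_one_le (by linarith), mul_one, neg_neg]
  exact (one_le_inv₀ (by positivity)).2 (pow_le_one₀ hτ0.le (by linarith))

lemma kolm_nonneg {w : Z d} (hw : w.1 < 0) : 0 ≤ kolm w := by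
  have : 0 < -w.1 := by linarith
  exact mul_nonneg (by positivity) (Real.smoothTransition.nonneg _)

lemma cutAt_kolm_nonneg {a : ℝ → ℝ} {ε : ℝ} (hε : 0 < ε) (ha : ∀ τ ≤ ε, a τ = 0)
    (ha0 : ∀ τ, 0 ≤ a τ) (w : Z d) : 0 ≤ cutAt a kolm w := by
  rcases lt_or_ge w.1 0 with hw | hw
  · exact mul_nonneg (ha0 _) (kolm_nonneg hw)
  · rw [cutAt_eq_zero ha (by linarith)]

lemma kolmFlux_eq_zero (i : Fin d) (w : Z d) (h : kolm w = 0) : kolmFlux i w = 0 := by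
  rw [kolmFlux, h, zero_mul]

/-- The initial and the final densities have the same mass. -/
lemma integral_cutAt_eq {ε : ℝ} (hε : 0 < ε) (hε2 : ε < 1 / 1000) :
    ∫ w : Z d, cutAt (deriv (timeStep ε)) kolm w = ∫ w : Z d, cutAt timeWeight kolm w := by
  have ha : ∀ τ ≤ ε, amplitude ε τ = 0 := fun τ => amplitude_of_le hε hε2
  have ha1 : ∀ τ > 31 / 4000, amplitude ε τ = 0 := fun τ hτ => amplitude_of_ge hε hε2 (le_of_lt hτ)
  have hs : ContDiff ℝ 1 (cutAt (amplitude ε) (kolm : Z d → ℝ)) :=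
    (contDiff_cutAt (contDiff_amplitude ε) hε ha fun w => contDiffAt_kolm).of_le (by simp)
  have hsi : ∀ i, ContDiff ℝ 1 (cutAt (amplitude ε) (kolmFlux i : Z d → ℝ)) := fun i =>
    (contDiff_cutAt (contDiff_amplitude ε) hε ha fun w => contDiffAt_kolmFlux i).of_le (by simp)
  have hc : HasCompactSupport (cutAt (amplitude ε) (kolm : Z d → ℝ)) :=
    hasCompactSupport_cutAt hε ha ha1 fun _ h => h
  have hci : ∀ i, HasCompactSupport (cutAt (amplitude ε) (kolmFlux i : Z d → ℝ)) := fun i =>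
    hasCompactSupport_cutAt hε ha ha1 (kolmFlux_eq_zero i)
  have i1 : Integrable (cutAt (deriv (timeStep ε)) (kolm : Z d → ℝ)) :=
    (contDiff_cutAt (contDiff_deriv_timeStep ε) hε (fun τ => deriv_timeStep_of_le hε)
      fun w => contDiffAt_kolm).continuous.integrable_of_hasCompactSupport
      (hasCompactSupport_cutAt hε (fun τ => deriv_timeStep_of_le hε)
        (fun τ hτ => deriv_timeStep_of_ge hε (by linarith)) fun _ h => h)
  have i2 : Integrable (cutAt timeWeight (kolm : Z d → ℝ)) :=
    (contDiff_cutAt contDiff_timeWeight (show (0 : ℝ) < 9 / 4000 by norm_num)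
      (fun τ h => timeWeight_eq_zero (Or.inl h))
      fun w => contDiffAt_kolm).continuous.integrable_of_hasCompactSupport
      (hasCompactSupport_cutAt (show (0 : ℝ) < 9 / 4000 by norm_num)
        (fun τ h => timeWeight_eq_zero (Or.inl h))
        (fun τ hτ => timeWeight_eq_zero (Or.inr (le_of_lt hτ))) fun _ h => h)
  -- In the transport equation of the density, both the transport term and the velocity divergence
  -- integrate to zero; only the two densities in the derivative of the amplitude remain.
  have key := integral_transport_eq_zero hs hc
  simp_rw [transport_cutAt_kolm ((contDiff_amplitude ε).differentiable (by simp)) hε ha,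
    deriv_amplitude] at key
  have e : ∀ w : Z d, cutAt (fun τ => deriv (timeStep ε) τ - timeWeight τ) kolm w =
      cutAt (deriv (timeStep ε)) kolm w - cutAt timeWeight kolm w := fun w => by
    simp only [cutAt]; ring
  simp_rw [e] at key
  rw [integral_add, integral_neg, integral_sub i1 i2, integral_finsetSum] at key
  · rw [Finset.sum_eq_zero fun i _ => integral_velDeriv_eq_zero (hsi i) (hci i) _] at key
    linarith
  · exact fun i _ => (continuous_velDeriv (hsi i) _).integrable_of_hasCompactSupport
      (hasCompactSupport_velDeriv (hci i) _)
  · exact (i1.sub i2).neg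
  · exact integrable_finsetSum _ fun i _ =>
      (continuous_velDeriv (hsi i) _).integrable_of_hasCompactSupport
        (hasCompactSupport_velDeriv (hci i) _)

end

/-! ### Testing the equation with the density, and integration of the kernel -/

section

variable {d : ℕ}

lemma sum_inner_single_mul (g e : E d) :
    ∑ i, inner ℝ g (EuclideanSpace.single i 1) * e i = inner ℝ g e := by
  rw [inner_eq_sum]
  exact Finset.sum_congr rfl fun i _ => mul_comm _ _

lemma IsEllipticPair.norm_flux_le {Λ : ℝ} (hΛ : 0 < Λ) {G H : Z d → E d}
    (h : IsEllipticPair Λ G H) : ∀ᵐ z, ‖H z‖ ≤ Λ * ‖G z‖ := by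
  filter_upwards [h.flux] with z hz
  rcases eq_or_lt_of_le (norm_nonneg (H z)) with h0 | h0
  · rw [← h0]; positivity
  · have h1 := real_inner_le_norm (G z) (H z)
    have h2 : ‖H z‖ * ‖H z‖ ≤ (Λ * ‖G z‖) * ‖H z‖ := by nlinarith
    exact le_of_mul_le_mul_right h2 h0

/-- The subsolution property tested against the kernel centred at `z`. -/
theorem exists_kernel_inequality (d : ℕ) {Λ : ℝ} (hΛ : 0 < Λ) : ∃ C : ℝ, 0 < C ∧
    ∀ (f : Z d → ℝ) (G H : Z d → E d), IsDivSubsolution (cyl d 2) f G H → IsEllipticPair Λ G H →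
      (∀ z, f z ≤ 1) → ∀ ε : ℝ, 0 < ε → ε < 1 / 1000 → ∀ z ∈ cyl d (1 / 20),
      ENNReal.ofReal
        ((∫ y, profile (f y) * cutAt (deriv (timeStep ε)) kolm (gal (galInv z) y)) -
          ∫ y, profile (f y) * cutAt timeWeight kolm (gal (galInv z) y)) ≤
        ENNReal.ofReal C * ∫⁻ y, (cylBefore d (ε / 2)).indicator
          (fun y => ENNReal.ofReal (deriv profile (f y) * ‖G y‖)) y *
            ENNReal.ofReal (kernel (gal (galInv z) y)) := by
  obtain ⟨C, hC, hker⟩ := exists_kernel_bound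
  refine ⟨C * (Λ + 1), by positivity, ?_⟩
  intro f G H h hell hf1 ε hε hε2 z hz
  have ha : ∀ τ ≤ ε, amplitude ε τ = 0 := fun τ => amplitude_of_le hε hε2
  have ha1 : ∀ τ > 31 / 4000, amplitude ε τ = 0 := fun τ hτ => amplitude_of_ge hε hε2 (le_of_lt hτ)
  have had : Differentiable ℝ (amplitude ε) := (contDiff_amplitude ε).differentiable (by simp)
  obtain ⟨kb1, kb2⟩ := hker d (amplitude ε) ε hε had (amplitude_bounds hε hε2) ha
    (fun τ hτ => amplitude_of_ge hε hε2 (by linarith))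
  have hφ : IsTestFun (cyl d 2) (fun y => cutAt (amplitude ε) kolm (gal (galInv z) y)) :=
    isTestFun_cutAt (contDiff_amplitude ε) hε ha ha1 (fun _ h => h) (fun _ => contDiffAt_kolm) hz
  have hφi : ∀ i, IsTestFun (cyl d 2)
      (fun y => cutAt (amplitude ε) (kolmFlux i) (gal (galInv z) y)) := fun i =>
    isTestFun_cutAt (contDiff_amplitude ε) hε ha ha1 (kolmFlux_eq_zero i)
      (fun _ => contDiffAt_kolmFlux i) hz
  set φ : Z d → ℝ := fun y => cutAt (amplitude ε) kolm (gal (galInv z) y) with hφdef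
  set ψ : Fin d → Z d → ℝ := fun i y => cutAt (amplitude ε) (kolmFlux i) (gal (galInv z) y) with hψdef
  have hφ1 : ContDiff ℝ 1 φ := hφ.smooth.of_le (by simp)
  have hψ1 : ∀ i, ContDiff ℝ 1 (ψ i) := fun i => (hφi i).smooth.of_le (by simp)
  have hsm : Differentiable ℝ (cutAt (amplitude ε) (kolm : Z d → ℝ)) :=
    (contDiff_cutAt (contDiff_amplitude ε) hε ha fun w => contDiffAt_kolm).differentiable (by simp)
  have hsmi : ∀ i, Differentiable ℝ (cutAt (amplitude ε) (kolmFlux i : Z d → ℝ)) := fun i =>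
    (contDiff_cutAt (contDiff_amplitude ε) hε ha fun w => contDiffAt_kolmFlux i).differentiable
      (by simp)
  have hφ0 : ∀ y, 0 ≤ φ y := fun y =>
    cutAt_kolm_nonneg hε ha (fun τ => (amplitude_bounds hε hε2 τ).1) _
  have hM1 : ∀ s, |deriv profile s| ≤ 3 := fun s => by
    rw [abs_of_nonneg (deriv_profile_nonneg s)]; exact deriv_profile_le s
  have hM2 : ∀ s, |deriv (deriv profile) s| ≤ 3 := fun s => by
    rw [deriv_deriv_profile, abs_of_nonneg (hump_nonneg s)]
    exact (hump_le_one s).trans (by norm_num)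
  have key := (h.renormalize contDiff_profile deriv_profile_nonneg hM1 hM2 hφ).2 hφ0
  -- The chain rule for ∇_v u is tested with each component of the flux: this moves the velocity
  -- divergence from the flux onto u.
  have keyi := fun i => (h.renormalize contDiff_profile deriv_profile_nonneg hM1 hM2 (hφi i)).1
    (EuclideanSpace.single i 1)
  have hcdp : Continuous (deriv profile) := (contDiff_infty_iff_deriv.1 contDiff_profile).2.continuous
  have hu : AEStronglyMeasurable (fun y => profile (f y)) :=
    contDiff_profile.continuous.comp_aestronglyMeasurable h.memLp_f.1
  have hub : ∀ y, ‖profile (f y)‖ ≤ 4 := fun y => by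
    rw [Real.norm_of_nonneg (profile_nonneg _)]; exact profile_le_four ((hf1 y).trans (by norm_num))
  have hc : AEStronglyMeasurable (fun y => deriv profile (f y)) :=
    hcdp.comp_aestronglyMeasurable h.memLp_f.1
  -- the transport derivative of the test function
  have hT : ∀ y, transport φ y = -(cutAt (deriv (timeStep ε)) kolm (gal (galInv z) y) -
      cutAt timeWeight kolm (gal (galInv z) y)) +
        ∑ i, velDeriv (ψ i) y (EuclideanSpace.single i 1) := by
    intro y
    rw [hφdef, transport_comp_gal_left hsm, transport_cutAt_kolm had hε ha, deriv_amplitude]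
    congr 1
    · simp only [cutAt]; ring
    · exact Finset.sum_congr rfl fun i _ => (velDeriv_comp_gal_left (hsmi i) _ _ _).symm
  have i1 : Integrable fun y => cutAt (deriv (timeStep ε)) kolm (gal (galInv z) y) :=
    (isTestFun_cutAt (contDiff_deriv_timeStep ε) hε (fun τ => deriv_timeStep_of_le hε)
      (fun τ hτ => deriv_timeStep_of_ge hε (by linarith)) (fun _ h => h)
      (fun _ => contDiffAt_kolm) hz).smooth.continuous.integrable_of_hasCompactSupport
    (isTestFun_cutAt (contDiff_deriv_timeStep ε) hε (fun τ => deriv_timeStep_of_le hε)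
      (fun τ hτ => deriv_timeStep_of_ge hε (by linarith)) (fun _ h => h)
      (fun _ => contDiffAt_kolm) hz).compact_supp
  have hwt : IsTestFun (cyl d 2) fun y => cutAt timeWeight kolm (gal (galInv z) y) :=
    isTestFun_cutAt contDiff_timeWeight (show (0 : ℝ) < 9 / 4000 by norm_num)
      (fun τ h => timeWeight_eq_zero (Or.inl h))
      (fun τ hτ => timeWeight_eq_zero (Or.inr (le_of_lt hτ))) (fun _ h => h)
      (fun _ => contDiffAt_kolm) hz
  have i2 : Integrable fun y => cutAt timeWeight kolm (gal (galInv z) y) :=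
    hwt.smooth.continuous.integrable_of_hasCompactSupport hwt.compact_supp
  have i1u := i1.bdd_mul hu (ae_of_all _ hub)
  have i2u := i2.bdd_mul hu (ae_of_all _ hub)
  have i3u : ∀ i ∈ Finset.univ, Integrable fun y =>
      profile (f y) * velDeriv (ψ i) y (EuclideanSpace.single i 1) := fun i _ =>
    ((continuous_velDeriv (hψ1 i) _).integrable_of_hasCompactSupport
      (hasCompactSupport_velDeriv (hφi i).compact_supp _)).bdd_mul hu (ae_of_all _ hub)
  have i4 : Integrable fun y => deriv profile (f y) * velDeriv φ y (H y) :=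
    (integrable_velDeriv_apply hφ1 hφ.compact_supp h.memLp_H).bdd_mul hc
      (ae_of_all _ fun y => hM1 _)
  have i5 : ∀ i ∈ Finset.univ, Integrable fun y => deriv profile (f y) *
      (inner ℝ (G y) (EuclideanSpace.single i 1) * ψ i y) := fun i _ => by
    have h1 : MemLp (fun y => inner ℝ (G y) (EuclideanSpace.single i (1 : ℝ) : E d)) 2 :=
      h.memLp_G.inner_const _
    exact (h1.integrable_mul ((hφi i).smooth.continuous.memLp_of_hasCompactSupport (p := 2)
      (hφi i).compact_supp)).bdd_mul hc (ae_of_all _ fun y => hM1 _)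
  -- The dissipation is discarded; `profile` is convex where it is evaluated.
  have hpos : 0 ≤ ∫ y, (deriv (deriv profile) (f y) * φ y) * inner ℝ (G y) (H y) := by
    refine integral_nonneg_of_ae ?_
    filter_upwards [hell.flux] with y hy
    have v5 : 0 ≤ inner ℝ (G y) (H y) := nonneg_of_mul_nonneg_right ((sq_nonneg _).trans hy) hΛ
    rw [deriv_deriv_profile]
    exact mul_nonneg (mul_nonneg (hump_nonneg _) (hφ0 y)) v5
  have e1 : ∫ y, profile (f y) * transport φ y =
      -((∫ y, profile (f y) * cutAt (deriv (timeStep ε)) kolm (gal (galInv z) y)) -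
          ∫ y, profile (f y) * cutAt timeWeight kolm (gal (galInv z) y)) -
        ∫ y, deriv profile (f y) * inner ℝ (G y) (φ y • drift (gal (galInv z) y)) := by
    have a1 : ∀ y, profile (f y) * transport φ y =
        -(profile (f y) * cutAt (deriv (timeStep ε)) kolm (gal (galInv z) y) -
          profile (f y) * cutAt timeWeight kolm (gal (galInv z) y)) +
        ∑ i, profile (f y) * velDeriv (ψ i) y (EuclideanSpace.single i 1) := fun y => by
      rw [hT, ← Finset.mul_sum]; ring
    have a2 : ∀ y, deriv profile (f y) * inner ℝ (G y) (φ y • drift (gal (galInv z) y)) =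
        ∑ i, deriv profile (f y) * (inner ℝ (G y) (EuclideanSpace.single i 1) * ψ i y) := by
      intro y
      rw [← sum_inner_single_mul, Finset.mul_sum]
      refine Finset.sum_congr rfl fun i _ => ?_
      simp only [hφdef, hψdef, cutAt, kolmFlux, PiLp.smul_apply, smul_eq_mul]
      ring
    simp_rw [a1, a2]
    have i12 : Integrable fun y =>
        -(profile (f y) * cutAt (deriv (timeStep ε)) kolm (gal (galInv z) y) -
          profile (f y) * cutAt timeWeight kolm (gal (galInv z) y)) := (i1u.sub i2u).neg
    rw [integral_add i12 (integrable_finsetSum _ i3u), integral_neg,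
      integral_sub i1u i2u, integral_finsetSum _ i3u, integral_finsetSum _ i5,
      Finset.sum_congr rfl fun i _ => keyi i, Finset.sum_neg_distrib, ← sub_eq_add_neg]
  have i6 : Integrable fun y => deriv profile (f y) *
      inner ℝ (G y) (φ y • drift (gal (galInv z) y)) := by
    refine (integrable_finsetSum _ i5).congr (ae_of_all _ fun y => ?_)
    beta_reduce
    rw [← sum_inner_single_mul, Finset.mul_sum]
    refine Finset.sum_congr rfl fun i _ => ?_
    simp only [hφdef, hψdef, cutAt, kolmFlux, PiLp.smul_apply, smul_eq_mul]
    ring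
  set D := (∫ y, profile (f y) * cutAt (deriv (timeStep ε)) kolm (gal (galInv z) y)) -
          ∫ y, profile (f y) * cutAt timeWeight kolm (gal (galInv z) y) with hD
  have e2 : D ≤ -∫ y, (deriv profile (f y) * velDeriv φ y (H y) +
      deriv profile (f y) * inner ℝ (G y) (φ y • drift (gal (galInv z) y))) := by
    rw [integral_add i4 i6]
    linarith
  refine (ENNReal.ofReal_le_ofReal (e2.trans (neg_le_abs _))).trans ?_
  rw [← Real.enorm_eq_ofReal_abs]
  refine (enorm_integral_le_lintegral_enorm _).trans ?_
  rw [← lintegral_const_mul' _ _ ENNReal.ofReal_ne_top]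
  refine lintegral_mono_ae ?_
  filter_upwards [hell.norm_flux_le hΛ] with y hy
  -- Off the support the integrand vanishes. On it, y lies in the unit cylinder before time -ε,
  -- hence strictly before -ε/2, where the L¹ gradient bound applies.
  by_cases hmem : gal (galInv z) y ∈ suppSet d ε
  · have hyc := gal_mem_of_mem_suppSet hε hz hmem
    rw [gal_galInv_cancel] at hyc
    have hyb : y ∈ cylBefore d (ε / 2) := ⟨unit_box_subset_cyl hyc.2, by
      show y.1 < -(ε / 2)
      linarith [hyc.1]⟩
    rw [indicator_of_mem hyb, Real.enorm_eq_ofReal_abs,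
      ← ENNReal.ofReal_mul (mul_nonneg (deriv_profile_nonneg _) (norm_nonneg _)),
      ← ENNReal.ofReal_mul (by positivity)]
    refine ENNReal.ofReal_le_ofReal ?_
    have hk := kernel_nonneg (gal (galInv z) y)
    have hd0 := deriv_profile_nonneg (f y)
    have j1 : |velDeriv φ y (H y)| ≤ C * kernel (gal (galInv z) y) * (Λ * ‖G y‖) := by
      rw [hφdef, velDeriv_comp_gal_left hsm]
      exact (kb1 _ _).trans (mul_le_mul_of_nonneg_left hy (by positivity))
    have j2 : |(inner ℝ (G y) (φ y • drift (gal (galInv z) y)) : ℝ)| ≤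
        ‖G y‖ * (C * kernel (gal (galInv z) y)) := by
      refine (abs_real_inner_le_norm _ _).trans (mul_le_mul_of_nonneg_left ?_ (norm_nonneg _))
      rw [norm_smul]
      exact kb2 _
    rw [← mul_add, abs_mul, abs_of_nonneg hd0]
    calc deriv profile (f y) * |velDeriv φ y (H y) +
          inner ℝ (G y) (φ y • drift (gal (galInv z) y))|
        ≤ deriv profile (f y) * (C * kernel (gal (galInv z) y) * (Λ * ‖G y‖) +
            ‖G y‖ * (C * kernel (gal (galInv z) y))) :=
          mul_le_mul_of_nonneg_left ((abs_add_le _ _).trans (add_le_add j1 j2)) hd0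
      _ = _ := by ring
  · have hnt : gal (galInv z) y ∉ tsupport (cutAt (amplitude ε) (kolm : Z d → ℝ)) := fun h =>
      hmem (tsupport_cutAt_subset hε ha ha1 (fun _ h => h) h)
    have z1 : velDeriv φ y (H y) = 0 := by
      rw [hφdef, velDeriv_comp_gal_left hsm, velDeriv_eq_zero_of_notMem hnt]
    have z2 : φ y = 0 := show cutAt (amplitude ε) kolm (gal (galInv z) y) = 0 from
      image_eq_zero_of_notMem_tsupport hnt
    simp [z1, z2]

/-- Young's inequality on the group: by Tonelli the kernel is integrated in its centre z, and z ↦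
z⁻¹ ∘ y preserves the measure. -/
lemma lintegral_lintegral_kernel_le {g : Z d → ℝ≥0∞} (hg : Measurable g) (S : Set (Z d)) :
    ∫⁻ z in S, ∫⁻ y, g y * ENNReal.ofReal (kernel (gal (galInv z) y)) ≤
      (∫⁻ y, g y) * ∫⁻ w : Z d, ENNReal.ofReal (kernel w) := by
  have hm : Measurable fun w : Z d => ENNReal.ofReal (kernel w) := measurable_kernel.ennreal_ofReal
  calc ∫⁻ z in S, ∫⁻ y, g y * ENNReal.ofReal (kernel (gal (galInv z) y))
      ≤ ∫⁻ z, ∫⁻ y, g y * ENNReal.ofReal (kernel (gal (galInv z) y)) := setLIntegral_le_lintegral _ _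
    _ = ∫⁻ y, ∫⁻ z, g y * ENNReal.ofReal (kernel (gal (galInv z) y)) := by
        refine lintegral_lintegral_swap (Measurable.aemeasurable ?_)
        refine (hg.comp measurable_snd).mul (hm.comp ?_)
        exact (continuous_gal.comp
          ((continuous_galInv.comp continuous_fst).prodMk continuous_snd)).measurable
    _ = ∫⁻ y, g y * ∫⁻ w : Z d, ENNReal.ofReal (kernel w) := by
        refine lintegral_congr fun y => ?_
        have hm2 : Measurable fun z : Z d => ENNReal.ofReal (kernel (gal (galInv z) y)) :=
          hm.comp (measurePreserving_galInv_gal y).measurable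
        rw [lintegral_const_mul _ hm2, (measurePreserving_galInv_gal y).lintegral_comp hm]
    _ = _ := lintegral_mul_const _ hg

/-- The initial density concentrates at the origin. -/
lemma exists_support_initial_subset {δ : ℝ} (hδ : 0 < δ) : ∃ ε : ℝ, 0 < ε ∧ ε < 1 / 1000 ∧
    ∀ w : Z d, cutAt (deriv (timeStep ε)) kolm w ≠ 0 → w ∈ Metric.ball (0 : Z d) δ := by
  -- On the support τ ≤ 2ε ≤ δ²/200, so √τ < δ/13, which beats the factors 6 and 11 in the bounds on
  -- |x| and |v|; the bound 1/2000 keeps τ ≤ 1.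
  refine ⟨min (1 / 2000) (δ ^ 2 / 400), by positivity,
    (min_le_left _ _).trans_lt (by norm_num), ?_⟩
  set ε := min (1 / 2000) (δ ^ 2 / 400) with hεdef
  have hε : 0 < ε := by positivity
  have hε1 : ε ≤ 1 / 2000 := min_le_left _ _
  have hε2 : ε ≤ δ ^ 2 / 400 := min_le_right _ _
  intro w hw
  have h1 := left_ne_zero_of_mul hw
  have h2 : kolm w ≠ 0 := right_ne_zero_of_mul hw
  have b1 : ε < -w.1 := by
    by_contra hle
    exact h1 (deriv_timeStep_of_le hε (not_lt.1 hle))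
  have b2 : -w.1 ≤ 2 * ε := by
    by_contra hle
    exact h1 (deriv_timeStep_of_ge hε (not_le.1 hle))
  have hw0 : w.1 < 0 := by linarith
  have hq := (quad_lt_of_kolm_ne_zero h2).le
  have hs : √(-w.1) < δ / 13 := by
    rw [Real.sqrt_lt' (by positivity)]
    nlinarith [sq_pos_of_pos hδ]
  have hs0 := Real.sqrt_nonneg (-w.1)
  have hss := Real.mul_self_sqrt (show 0 ≤ -w.1 by linarith)
  have hs1 : √(-w.1) ≤ 1 := by
    exact (Real.sqrt_le_sqrt (by linarith)).trans_eq Real.sqrt_one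
  have hle : -w.1 ≤ √(-w.1) := by nlinarith
  have n1 := norm_snd_fst_le hw0 hq
  have n2 := norm_snd_snd_le hw0 hq
  rw [mem_ball_zero_iff, Prod.norm_def, Prod.norm_def, max_lt_iff, max_lt_iff]
  refine ⟨?_, ?_, ?_⟩
  · rw [Real.norm_eq_abs, abs_of_neg hw0]; linarith
  · nlinarith
  · linarith

/-- The mass of the final density. -/
noncomputable def mass (d : ℕ) : ℝ := ∫ w : Z d, cutAt timeWeight kolm w

lemma lintegral_initial_eq {ε : ℝ} (hε : 0 < ε) (hε2 : ε < 1 / 1000) :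
    ∫⁻ w : Z d, ENNReal.ofReal (cutAt (deriv (timeStep ε)) kolm w) = ENNReal.ofReal (mass d) := by
  have h0 : ∀ w : Z d, 0 ≤ cutAt (deriv (timeStep ε)) kolm w :=
    cutAt_kolm_nonneg hε (fun τ => deriv_timeStep_of_le hε) (deriv_timeStep_nonneg hε)
  have i1 : Integrable (cutAt (deriv (timeStep ε)) (kolm : Z d → ℝ)) :=
    (contDiff_cutAt (contDiff_deriv_timeStep ε) hε (fun τ => deriv_timeStep_of_le hε)
      fun w => contDiffAt_kolm).continuous.integrable_of_hasCompactSupport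
      (hasCompactSupport_cutAt hε (fun τ => deriv_timeStep_of_le hε)
        (fun τ hτ => deriv_timeStep_of_ge hε (by linarith)) fun _ h => h)
  rw [mass, ← integral_cutAt_eq hε hε2, ofReal_integral_eq_lintegral_ofReal i1 (ae_of_all _ h0)]

end

/-! ### The quantitative intermediate value estimate -/

section

variable {d : ℕ}

lemma integral_comp_gal_left (z : Z d) (g : Z d → ℝ) : ∫ w, g (gal z w) = ∫ y, g y :=
  (measurePreserving_gal_left z).integral_comp (galHomeo z).measurableEmbedding g

/-- The mean of a function against the density `e` centred at `z` differs from its value at `z` by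
its mean oscillation. -/
lemma mass_mul_sub_le {u e : Z d → ℝ} {M N : ℝ} (hu : Measurable u) (hub : ∀ y, ‖u y‖ ≤ M)
    (he : Integrable e) (he0 : ∀ w, 0 ≤ e w) (hN : ∫ w, e w = N) (z : Z d) {c : ℝ} :
    ENNReal.ofReal (N * u z - c) ≤ ENNReal.ofReal ((∫ y, u y * e (gal (galInv z) y)) - c) +
      ∫⁻ w, ‖u (gal z w) - u z‖ₑ * ENNReal.ofReal (e w) := by
  have hug : AEStronglyMeasurable (fun w => u (gal z w)) :=
    (hu.comp (measurePreserving_gal_left z).measurable).aestronglyMeasurable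
  have i1 : Integrable fun w => u (gal z w) * e w :=
    he.bdd_mul hug (ae_of_all _ fun w => hub _)
  have h1 : ∫ y, u y * e (gal (galInv z) y) = ∫ w, u (gal z w) * e w := by
    rw [← integral_comp_gal_left z]
    simp only [galInv_gal_cancel]
  have h2 : ∫ w, (u z - u (gal z w)) * e w = N * u z - ∫ w, u (gal z w) * e w := by
    simp_rw [sub_mul]
    rw [integral_sub (he.const_mul _) i1, integral_const_mul, hN, mul_comm]
  have h3 : ENNReal.ofReal (∫ w, (u z - u (gal z w)) * e w) ≤
      ∫⁻ w, ‖u (gal z w) - u z‖ₑ * ENNReal.ofReal (e w) := by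
    refine (ENNReal.ofReal_le_ofReal (le_abs_self _)).trans ?_
    rw [← Real.enorm_eq_ofReal_abs]
    refine (enorm_integral_le_lintegral_enorm _).trans (le_of_eq (lintegral_congr fun w => ?_))
    rw [enorm_mul, ← enorm_neg, neg_sub, Real.enorm_of_nonneg (he0 w)]
  rw [h1]
  refine (ENNReal.ofReal_le_ofReal (le_of_eq ?_)).trans
    (ENNReal.ofReal_add_le.trans (add_le_add_right h3 _))
  rw [h2]; ring

/-- The mean against the final density detects the set where the function vanishes. -/
lemma exists_final_mean_le (d : ℕ) : ∃ κ : ℝ, 0 < κ ∧ ∀ (u : Z d → ℝ) (M : ℝ), Measurable u →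
    (∀ y, 0 ≤ u y) → (∀ y, u y ≤ M) → ∀ z ∈ cyl d (1 / 20),
      ∫ y, u y * cutAt timeWeight kolm (gal (galInv z) y) ≤
        M * mass d - M * κ * volume.real ({y | u y = 0} ∩ pastCyl d (1 / 20)) := by
  obtain ⟨κ, hκ, hw⟩ := exists_timeWeight_ge
  refine ⟨κ, hκ, fun u M hu hu0 huM z hz => ?_⟩
  have hM : 0 ≤ M := (hu0 0).trans (huM 0)
  have hk0 : ∀ w : Z d, 0 ≤ cutAt timeWeight kolm w :=
    cutAt_kolm_nonneg (show (0 : ℝ) < 9 / 4000 by norm_num)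
      (fun τ h => timeWeight_eq_zero (Or.inl h)) timeWeight_nonneg
  have hwt : IsTestFun (cyl d 2) fun y => cutAt timeWeight kolm (gal (galInv z) y) :=
    isTestFun_cutAt contDiff_timeWeight (show (0 : ℝ) < 9 / 4000 by norm_num)
      (fun τ h => timeWeight_eq_zero (Or.inl h))
      (fun τ hτ => timeWeight_eq_zero (Or.inr (le_of_lt hτ))) (fun _ h => h)
      (fun _ => contDiffAt_kolm) hz
  have i2 : Integrable fun y => cutAt timeWeight kolm (gal (galInv z) y) :=
    hwt.smooth.continuous.integrable_of_hasCompactSupport hwt.compact_supp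
  have i3 : Integrable fun y => u y * cutAt timeWeight kolm (gal (galInv z) y) :=
    i2.bdd_mul hu.aestronglyMeasurable (ae_of_all _ fun y => by
      rw [Real.norm_of_nonneg (hu0 y)]; exact huM y)
  have hN : ∫ y, cutAt timeWeight kolm (gal (galInv z) y) = mass d := by
    rw [← integral_comp_gal_left z]
    simp only [galInv_gal_cancel]
    rfl
  set P := {y | u y = 0} ∩ pastCyl d (1 / 20) with hP
  have hPm : MeasurableSet P := (hu (measurableSet_singleton 0)).inter
    (measurableSet_Ioo.prod (measurableSet_ball.prod measurableSet_ball))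
  have hPf : volume P ≠ ⊤ := by
    refine measure_ne_top_of_subset inter_subset_right ?_
    have : Bornology.IsBounded (pastCyl d (1 / 20)) :=
      (Metric.isBounded_Ioo _ _).prod (Metric.isBounded_ball.prod Metric.isBounded_ball)
    exact this.measure_lt_top.ne
  -- (M - u) times the density is nonnegative everywhere, and at least Mκ on the part of the past
  -- cylinder where u vanishes.
  have h1 : ∫ y, P.indicator (fun _ => M * κ) y ≤
      ∫ y, (M * cutAt timeWeight kolm (gal (galInv z) y) -
        u y * cutAt timeWeight kolm (gal (galInv z) y)) := by
    refine integral_mono ((integrable_indicator_iff hPm).2 (integrableOn_const hPf))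
      ((i2.const_mul M).sub i3) fun y => ?_
    by_cases hy : y ∈ P
    · obtain ⟨hm, h1⟩ := one_le_kolm hz hy.2
      have h2 := hw (-(gal (galInv z) y).1) ⟨by linarith [hm.2], by linarith [hm.1]⟩
      have h0 : u y = 0 := hy.1
      rw [indicator_of_mem hy]
      simp only [h0, zero_mul, sub_zero]
      refine mul_le_mul_of_nonneg_left (h2.trans ?_) hM
      exact le_mul_of_one_le_right (timeWeight_nonneg _) h1
    · rw [indicator_of_notMem hy, ← sub_mul]
      exact mul_nonneg (sub_nonneg.2 (huM y)) (hk0 _)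
  rw [integral_sub (i2.const_mul M) i3, integral_const_mul, hN, integral_indicator hPm,
    setIntegral_const, smul_eq_mul] at h1
  linarith

/-- The mean oscillation against a density concentrating at the origin is small. -/
lemma exists_lintegral_oscillation_le {u : Z d → ℝ} (hu : Measurable u) (hu1 : MemLp u 1)
    {η : ℝ≥0∞} (hη : 0 < η) : ∃ ε : ℝ, 0 < ε ∧ ε < 1 / 1000 ∧
      ∫⁻ z, ∫⁻ w, ‖u (gal z w) - u z‖ₑ * ENNReal.ofReal (cutAt (deriv (timeStep ε)) kolm w) ≤
        η * ENNReal.ofReal (mass d) := by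
  -- A density centred at z evaluates u at z ∘ w with w small, so what enters is the L¹ continuity
  -- of right translations.
  have ht := tendsto_eLpNorm_comp_sub (τ := fun w z : Z d => gal z w)
    (continuous_gal.comp continuous_swap) measurePreserving_gal_right gal_zero_right
    ENNReal.one_ne_top hu1
  obtain ⟨δ, hδ, hball⟩ := Metric.eventually_nhds_iff_ball.1 (ht.eventually (gt_mem_nhds hη))
  obtain ⟨ε, hε, hε2, hsupp⟩ := exists_support_initial_subset (d := d) hδ
  refine ⟨ε, hε, hε2, ?_⟩
  have hc : Continuous (cutAt (deriv (timeStep ε)) (kolm : Z d → ℝ)) :=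
    (contDiff_cutAt (contDiff_deriv_timeStep ε) hε (fun τ => deriv_timeStep_of_le hε)
      fun w => contDiffAt_kolm).continuous
  have hm : Measurable fun w : Z d => ENNReal.ofReal (cutAt (deriv (timeStep ε)) kolm w) :=
    hc.measurable.ennreal_ofReal
  rw [lintegral_lintegral_swap, ← lintegral_initial_eq hε hε2, ← lintegral_const_mul _ hm]
  · refine lintegral_mono fun w => ?_
    have hmw : Measurable fun z => ‖u (gal z w) - u z‖ₑ :=
      ((hu.comp (measurePreserving_gal_right w).measurable).sub hu).enorm
    rw [lintegral_mul_const _ hmw]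
    by_cases h0 : cutAt (deriv (timeStep ε)) kolm w = 0
    · simp [h0]
    · refine mul_le_mul_left ?_ _
      have := hball w (hsupp w h0)
      rw [eLpNorm_one_eq_lintegral_enorm] at this
      exact this.le
  · exact Measurable.aemeasurable
      (((hu.comp continuous_gal.measurable).sub (hu.comp measurable_fst)).enorm.mul
        (hm.comp measurable_snd))

/-- A quantitative intermediate value estimate. -/
theorem exists_intermediate_value_bound (d : ℕ) {Λ : ℝ} (hΛ : 0 < Λ) : ∃ κ C : ℝ, 0 < κ ∧ 0 < C ∧
    ∀ (f : Z d → ℝ) (G H : Z d → E d), IsDivSubsolution (cyl d 2) f G H → IsEllipticPair Λ G H →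
      (∀ z, f z ≤ 1) → (∀ z ∉ cyl d 2, f z = 0) → ∀ θ ∈ Ioo (0 : ℝ) 1,
      (κ * volume.real ({z | f z ≤ 0} ∩ pastCyl d (1 / 20)) - C * θ) *
          volume.real ({z | 1 - θ ≤ f z} ∩ cyl d (1 / 20)) ≤
        C * (√(volume.real ({z | 0 < f z ∧ f z < 1 - θ} ∩ cyl d 1)) + θ) := by
  obtain ⟨κ, hκ, hfinal⟩ := exists_final_mean_le d
  obtain ⟨C₁, hC₁, hkernel⟩ := exists_kernel_inequality d hΛ
  obtain ⟨C₂, hC₂, hgrad⟩ := exists_gradient_bound d hΛ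
  set K : ℝ := (∫⁻ w : Z d, ENNReal.ofReal (kernel w)).toReal with hK
  have hK0 : 0 ≤ K := ENNReal.toReal_nonneg
  have hKe : ENNReal.ofReal K = ∫⁻ w : Z d, ENNReal.ofReal (kernel w) :=
    ENNReal.ofReal_toReal lintegral_kernel_lt_top.ne
  have hN0 : 0 ≤ mass d := integral_nonneg
    (cutAt_kolm_nonneg (show (0 : ℝ) < 9 / 4000 by norm_num)
      (fun τ h => timeWeight_eq_zero (Or.inl h)) timeWeight_nonneg)
  have hm := profile_one_pos
  -- C₁C₂K comes from the kernel inequality, the gradient bound and the mass of the kernel; 3 · mass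
  -- from the Lipschitz constant 3 of `profile`; the summand 1 from positivity.
  refine ⟨profile 1 * κ, C₁ * C₂ * K + 3 * mass d + 1, by positivity, by positivity, ?_⟩
  intro f G H h hell hf1 hf0 θ hθ
  set N := mass d with hNdef
  have hfm : Measurable f := h.sm_f.measurable
  have hum : Measurable fun y => profile (f y) := contDiff_profile.continuous.measurable.comp hfm
  have huM : ∀ y, profile (f y) ≤ profile 1 := fun y => monotone_profile (hf1 y)
  have hub : ∀ y, ‖profile (f y)‖ ≤ profile 1 := fun y => by
    rw [Real.norm_of_nonneg (profile_nonneg _)]; exact huM y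
  -- Vanishing of f outside the cylinder makes u integrable over the whole space, as the continuity
  -- of translations requires.
  have hu1 : MemLp (fun y => profile (f y)) 1 := by
    have h1 : MemLp (fun y => profile (f y)) 1 (volume.restrict (cyl d 2)) := by
      have : IsFiniteMeasure (volume.restrict (cyl d 2)) :=
        isFiniteMeasure_restrict.2 (volume_cyl_ne_top 2)
      exact MemLp.of_bound hum.aestronglyMeasurable _ (ae_of_all _ hub)
    rw [← memLp_indicator_iff_restrict (measurableSet_cyl 2)] at h1
    refine h1.ae_eq (ae_of_all _ fun y => ?_)
    by_cases hy : y ∈ cyl d 2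
    · rw [indicator_of_mem hy]
    · rw [indicator_of_notMem hy]
      exact (profile_of_nonpos (hf0 y hy).le).symm
  set P := {z | f z ≤ 0} ∩ pastCyl d (1 / 20) with hP
  set S := {z | 1 - θ ≤ f z} ∩ cyl d (1 / 20) with hS
  have hSm : MeasurableSet S := (measurableSet_le measurable_const hfm).inter (measurableSet_cyl _)
  set X := C₂ * (√(volume.real ({z | 0 < f z ∧ f z < 1 - θ} ∩ cyl d 1)) + θ) with hX
  have hX0 : 0 ≤ X := mul_nonneg hC₂.le (add_nonneg (Real.sqrt_nonneg _) hθ.1.le)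
  set A₀ := profile 1 * κ * volume.real P - 3 * N * θ with hA₀
  have hPle : volume.real P ≤ volume.real ({y | profile (f y) = 0} ∩ pastCyl d (1 / 20)) := by
    refine measureReal_mono (inter_subset_inter_left _ fun y hy => profile_of_nonpos hy) ?_
    refine measure_ne_top_of_subset inter_subset_right ?_
    have : Bornology.IsBounded (pastCyl d (1 / 20)) :=
      (Metric.isBounded_Ioo _ _).prod (Metric.isBounded_ball.prod Metric.isBounded_ball)
    exact this.measure_lt_top.ne
  -- A₀ bounds from below, on S, the gap between mass · u(z) and the past mean. Extended nonnegative
  -- values make a negative A₀ harmless and avoid checking, for each z, that the kernel integral is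
  -- finite. The error η comes from replacing the mean near z by the value at z.
  have main : ∀ η : ℝ≥0∞, 0 < η → ENNReal.ofReal A₀ * volume S ≤
      ENNReal.ofReal (C₁ * X * K) + η * ENNReal.ofReal N := by
    intro η hη
    obtain ⟨ε, hε, hε2, hosc⟩ := exists_lintegral_oscillation_le hum hu1 hη
    have he0 : ∀ w : Z d, 0 ≤ cutAt (deriv (timeStep ε)) kolm w :=
      cutAt_kolm_nonneg hε (fun τ => deriv_timeStep_of_le hε) (deriv_timeStep_nonneg hε)
    have hec : Continuous (cutAt (deriv (timeStep ε)) (kolm : Z d → ℝ)) :=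
      (contDiff_cutAt (contDiff_deriv_timeStep ε) hε (fun τ => deriv_timeStep_of_le hε)
        fun w => contDiffAt_kolm).continuous
    have hei : Integrable (cutAt (deriv (timeStep ε)) (kolm : Z d → ℝ)) :=
      hec.integrable_of_hasCompactSupport
        (hasCompactSupport_cutAt hε (fun τ => deriv_timeStep_of_le hε)
          (fun τ hτ => deriv_timeStep_of_ge hε (by linarith)) fun _ h => h)
    have heN : ∫ w : Z d, cutAt (deriv (timeStep ε)) kolm w = N := integral_cutAt_eq hε hε2
    set g : Z d → ℝ≥0∞ := (cylBefore d (ε / 2)).indicator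
      (fun y => ENNReal.ofReal (deriv profile (f y) * ‖G y‖)) with hg
    have hcdp : Continuous (deriv profile) :=
      (contDiff_infty_iff_deriv.1 contDiff_profile).2.continuous
    have hgm : Measurable g :=
      (((hcdp.measurable.comp hfm).mul h.sm_G.norm.measurable).ennreal_ofReal).indicator
        (measurableSet_cylBefore _)
    have hgi : ∫⁻ y, g y ≤ ENNReal.ofReal X := by
      rw [hg, lintegral_indicator (measurableSet_cylBefore _), ← ofReal_integral_eq_lintegral_ofReal]
      · exact ENNReal.ofReal_le_ofReal (hgrad f G H h hell hf1 θ hθ (ε / 2) (by positivity))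
      · have : IsFiniteMeasure (volume.restrict (cylBefore d (ε / 2))) :=
          isFiniteMeasure_restrict.2 (measure_ne_top_of_subset inter_subset_left
            (volume_cyl_ne_top 1))
        refine Integrable.bdd_mul (c := 3)
          ((h.memLp_G.restrict _).norm.integrable (by norm_num))
          (hcdp.measurable.comp hfm).aestronglyMeasurable (ae_of_all _ fun y => ?_)
        rw [Real.norm_of_nonneg (deriv_profile_nonneg _)]
        exact deriv_profile_le _
      · exact ae_of_all _ fun y => mul_nonneg (deriv_profile_nonneg _) (norm_nonneg _)
    have hpt : ∀ z ∈ S, ENNReal.ofReal A₀ ≤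
        ENNReal.ofReal C₁ * (∫⁻ y, g y * ENNReal.ofReal (kernel (gal (galInv z) y))) +
          ∫⁻ w, ‖profile (f (gal z w)) - profile (f z)‖ₑ *
            ENNReal.ofReal (cutAt (deriv (timeStep ε)) kolm w) := by
      intro z hz
      have h1 := hfinal _ _ hum (fun y => profile_nonneg _) huM z hz.2
      have h2 := mass_mul_sub_le hum hub hei he0 heN z
        (c := ∫ y, profile (f y) * cutAt timeWeight kolm (gal (galInv z) y))
      refine (ENNReal.ofReal_le_ofReal ?_).trans
        (h2.trans (add_le_add_left (hkernel f G H h hell hf1 ε hε hε2 z hz.2) _))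
      have hz1 : 1 - θ ≤ f z := hz.1
      have h3 : profile 1 - profile (f z) ≤ 3 * θ := by
        refine (le_abs_self _).trans ((abs_profile_sub_le _ _).trans ?_)
        rw [abs_of_nonneg (by linarith [hf1 z])]
        linarith
      have h4 : profile 1 * κ * volume.real P ≤
          profile 1 * κ * volume.real ({y | profile (f y) = 0} ∩ pastCyl d (1 / 20)) :=
        mul_le_mul_of_nonneg_left hPle (by positivity)
      have h5 := mul_le_mul_of_nonneg_left h3 hN0
      rw [hA₀]
      linarith
    calc ENNReal.ofReal A₀ * volume S = ∫⁻ z in S, ENNReal.ofReal A₀ := by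
          rw [setLIntegral_const]
      _ ≤ ∫⁻ z in S, (ENNReal.ofReal C₁ *
            (∫⁻ y, g y * ENNReal.ofReal (kernel (gal (galInv z) y))) +
          ∫⁻ w, ‖profile (f (gal z w)) - profile (f z)‖ₑ *
            ENNReal.ofReal (cutAt (deriv (timeStep ε)) kolm w)) :=
          setLIntegral_mono' hSm hpt
      _ = (∫⁻ z in S, ENNReal.ofReal C₁ *
            (∫⁻ y, g y * ENNReal.ofReal (kernel (gal (galInv z) y)))) +
          ∫⁻ z in S, ∫⁻ w, ‖profile (f (gal z w)) - profile (f z)‖ₑ *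
            ENNReal.ofReal (cutAt (deriv (timeStep ε)) kolm w) := by
          refine lintegral_add_right _ (Measurable.lintegral_prod_right' (f := fun p : Z d × Z d =>
            ‖profile (f (gal p.1 p.2)) - profile (f p.1)‖ₑ *
              ENNReal.ofReal (cutAt (deriv (timeStep ε)) kolm p.2)) ?_)
          exact ((hum.comp continuous_gal.measurable).sub (hum.comp measurable_fst)).enorm.mul
            (hec.measurable.ennreal_ofReal.comp measurable_snd)
      _ ≤ ENNReal.ofReal (C₁ * X * K) + η * ENNReal.ofReal N := by
          refine add_le_add ?_ ((setLIntegral_le_lintegral _ _).trans hosc)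
          rw [lintegral_const_mul' _ _ ENNReal.ofReal_ne_top, mul_assoc,
            ENNReal.ofReal_mul hC₁.le, ENNReal.ofReal_mul hX0, hKe]
          refine mul_le_mul_right ((lintegral_lintegral_kernel_le hgm S).trans ?_) _
          exact mul_le_mul_left hgi _
  have hlim : ENNReal.ofReal A₀ * volume S ≤ ENNReal.ofReal (C₁ * X * K) := by
    refine ENNReal.le_of_forall_pos_le_add fun ρ hρ _ => ?_
    have hN1 : ENNReal.ofReal (N + 1) ≠ 0 := (ENNReal.ofReal_pos.2 (by positivity)).ne'
    refine (main (ρ / ENNReal.ofReal (N + 1))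
      (ENNReal.div_pos (by exact_mod_cast hρ.ne') ENNReal.ofReal_ne_top)).trans
      (add_le_add_right ?_ _)
    refine (mul_le_mul_right (ENNReal.ofReal_le_ofReal (by linarith : N ≤ N + 1)) _).trans ?_
    rw [ENNReal.div_mul_cancel hN1 ENNReal.ofReal_ne_top]
  have hreal : A₀ * volume.real S ≤ C₁ * X * K := by
    have h1 := ENNReal.toReal_mono ENNReal.ofReal_ne_top hlim
    rw [ENNReal.toReal_mul, ENNReal.toReal_ofReal (show 0 ≤ C₁ * X * K from
      mul_nonneg (mul_nonneg hC₁.le hX0) hK0)] at h1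
    refine (mul_le_mul_of_nonneg_right ?_ measureReal_nonneg).trans h1
    rw [ENNReal.toReal_ofReal']
    exact le_max_left _ _
  have hθ0 := hθ.1
  have hY : 0 ≤ √(volume.real ({z | 0 < f z ∧ f z < 1 - θ} ∩ cyl d 1)) + θ :=
    add_nonneg (Real.sqrt_nonneg _) hθ0.le
  have hA : profile 1 * κ * volume.real P - (C₁ * C₂ * K + 3 * N + 1) * θ ≤ A₀ := by
    have : 0 ≤ (C₁ * C₂ * K + 1) * θ := by positivity
    rw [hA₀]; linarith
  refine (mul_le_mul_of_nonneg_right hA measureReal_nonneg).trans (hreal.trans ?_)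
  have h2 : 0 ≤ (3 * N + 1) * (√(volume.real ({z | 0 < f z ∧ f z < 1 - θ} ∩ cyl d 1)) + θ) :=
    mul_nonneg (by positivity) hY
  rw [hX]
  linarith

end

/-! ### From the original problem to functions on the whole space; volumes -/

section

variable {d : ℕ}

/-- With η = Mξ, the form of M is nonnegative at ξ - Λ⁻¹η. Expanding by symmetry and bounding the
form at η by Λ|η|² gives Λ⁻¹|η|² ≤ ξ·η. The two conclusions are all that is used of the ellipticity
afterwards. -/
lemma norm_sq_le_of_bounds {Λ : ℝ} (hΛ : 0 < Λ) {M : Matrix (Fin d) (Fin d) ℝ} (hM : M.IsSymm)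
    (hb : ∀ ξ : E d, Λ⁻¹ * ‖ξ‖ ^ 2 ≤ inner ℝ (Matrix.toEuclideanLin M ξ) ξ ∧
      inner ℝ (Matrix.toEuclideanLin M ξ) ξ ≤ Λ * ‖ξ‖ ^ 2) (ξ : E d) :
    ‖Matrix.toEuclideanLin M ξ‖ ^ 2 ≤ Λ * inner ℝ ξ (Matrix.toEuclideanLin M ξ) ∧
      ‖ξ‖ ^ 2 ≤ Λ * inner ℝ ξ (Matrix.toEuclideanLin M ξ) := by
  have hH : M.IsHermitian := by
    rw [Matrix.IsHermitian, Matrix.conjTranspose_eq_transpose_of_trivial]; exact hM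
  have hs := Matrix.isSymmetric_toEuclideanLin_iff.2 hH
  set T := Matrix.toEuclideanLin M with hT
  constructor
  · set η := T ξ with hη
    have h1 : inner ℝ (T (ξ - Λ⁻¹ • η)) (ξ - Λ⁻¹ • η) =
        inner ℝ ξ η - 2 * Λ⁻¹ * ‖η‖ ^ 2 + Λ⁻¹ * Λ⁻¹ * inner ℝ (T η) η := by
      have e1 : inner ℝ (T η) ξ = ‖η‖ ^ 2 := by
        rw [hs η ξ, ← hη, real_inner_self_eq_norm_sq]
      simp only [map_sub, map_smul, inner_sub_left, inner_sub_right, inner_smul_left,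
        inner_smul_right, e1, ← hη, real_inner_self_eq_norm_sq, real_inner_comm ξ η,
        RCLike.conj_to_real]
      ring
    have h2 := (hb (ξ - Λ⁻¹ • η)).1
    rw [h1] at h2
    have h3 := mul_le_mul_of_nonneg_left (hb η).2 (show 0 ≤ Λ⁻¹ * Λ⁻¹ by positivity)
    have h4 : Λ⁻¹ * Λ⁻¹ * (Λ * ‖η‖ ^ 2) = Λ⁻¹ * ‖η‖ ^ 2 := by field_simp
    have h5 : 0 ≤ Λ⁻¹ * ‖ξ - Λ⁻¹ • η‖ ^ 2 := by positivity
    have h6 : Λ⁻¹ * ‖η‖ ^ 2 ≤ inner ℝ ξ η := by linarith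
    rwa [inv_mul_le_iff₀ hΛ] at h6
  · have := (hb ξ).1
    rwa [inv_mul_le_iff₀ hΛ, real_inner_comm] at this

lemma aemeasurable_toEuclideanLin {μ : Measure (Z d)} {A : Z d → Matrix (Fin d) (Fin d) ℝ}
    (hA : ∀ i j, AEMeasurable (fun z => A z i j) μ) {G : Z d → E d} (hG : AEMeasurable G μ) :
    AEMeasurable (fun z => Matrix.toEuclideanLin (A z) (G z)) μ := by
  have hGi : ∀ j, AEMeasurable (fun z => G z j) μ := fun j =>
    (EuclideanSpace.proj (𝕜 := ℝ) j).continuous.measurable.comp_aemeasurable hG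
  refine (MeasurableEquiv.toLp 2 (Fin d → ℝ)).measurable.comp_aemeasurable
    (aemeasurable_pi_iff.2 fun i => ?_)
  refine (Finset.aemeasurable_fun_sum Finset.univ fun j _ => (hA i j).mul (hGi j)).congr
    (ae_of_all _ fun z => ?_)
  simp only [Pi.mul_apply]
  rfl

lemma setIntegral_eq_integral_of_ae_eq {Q : Set (Z d)} {f g : Z d → ℝ} (hg : ∀ z ∉ Q, g z = 0)
    (h : f =ᵐ[volume.restrict Q] g) : ∫ z in Q, f z = ∫ z, g z := by
  rw [integral_congr_ae h]
  exact setIntegral_eq_integral_of_forall_compl_eq_zero hg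

/-- A bounded weak subsolution extends by zero to the whole space. -/
lemma IsWeakSubsolution.exists_extension {Λ : ℝ} (hΛ : 0 < Λ)
    {A : Z d → Matrix (Fin d) (Fin d) ℝ} {f : Z d → ℝ} {Q : Set (Z d)} (hQ : MeasurableSet Q)
    (hA : IsElliptic Λ Q A) (hf : IsWeakSubsolution Q A f)
    (hf1 : ∀ᵐ z ∂(volume.restrict Q), f z ≤ 1) :
    ∃ (g : Z d → ℝ) (G H : Z d → E d), IsDivSubsolution Q g G H ∧ IsEllipticPair Λ G H ∧
      (∀ z, g z ≤ 1) ∧ (∀ z ∉ Q, g z = 0) ∧ f =ᵐ[volume.restrict Q] g := by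
  obtain ⟨hf2, G, hG2, hgrad, hle⟩ := hf
  have hT : ∀ᵐ z ∂(volume.restrict Q),
      ‖Matrix.toEuclideanLin (A z) (G z)‖ ^ 2 ≤
          Λ * inner ℝ (G z) (Matrix.toEuclideanLin (A z) (G z)) ∧
        ‖G z‖ ^ 2 ≤ Λ * inner ℝ (G z) (Matrix.toEuclideanLin (A z) (G z)) := by
    filter_upwards [hA.symm, hA.bounds] with z h1 h2
    exact norm_sq_le_of_bounds hΛ h1 h2 _
  have hHm : AEStronglyMeasurable (fun z => Matrix.toEuclideanLin (A z) (G z))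
      (volume.restrict Q) :=
    (aemeasurable_toEuclideanLin hA.measurable hG2.1.aemeasurable).aestronglyMeasurable
  have hH2 : MemLp (fun z => Matrix.toEuclideanLin (A z) (G z)) 2 (volume.restrict Q) := by
    refine hG2.of_le_mul (c := Λ) hHm ?_
    filter_upwards [hT] with z hz
    rcases eq_or_lt_of_le (norm_nonneg (Matrix.toEuclideanLin (A z) (G z))) with h0 | h0
    · rw [← h0]; positivity
    · have h1 := real_inner_le_norm (G z) (Matrix.toEuclideanLin (A z) (G z))
      have h2 : ‖Matrix.toEuclideanLin (A z) (G z)‖ * ‖Matrix.toEuclideanLin (A z) (G z)‖ ≤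
          (Λ * ‖G z‖) * ‖Matrix.toEuclideanLin (A z) (G z)‖ := by nlinarith [hz.1]
      exact le_of_mul_le_mul_right h2 h0
  -- Strongly measurable representatives, extended by zero; the minimum with 1 turns the bound
  -- almost everywhere into one everywhere.
  set g : Z d → ℝ := Q.indicator fun z => min (hf2.1.mk f z) 1 with hg
  set G' : Z d → E d := Q.indicator (hG2.1.mk G) with hG'
  set H' : Z d → E d := Q.indicator (hHm.mk _) with hH'
  have eg : f =ᵐ[volume.restrict Q] g := by
    filter_upwards [hf2.1.ae_eq_mk, hf1, ae_restrict_mem hQ] with z h1 h2 h3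
    rw [hg, indicator_of_mem h3, ← h1, min_eq_left h2]
  have eG : G =ᵐ[volume.restrict Q] G' := by
    filter_upwards [hG2.1.ae_eq_mk, ae_restrict_mem hQ] with z h1 h3
    rw [hG', indicator_of_mem h3, ← h1]
  have eH : (fun z => Matrix.toEuclideanLin (A z) (G z)) =ᵐ[volume.restrict Q] H' := by
    filter_upwards [hHm.ae_eq_mk, ae_restrict_mem hQ] with z h1 h3
    rw [hH', indicator_of_mem h3, ← h1]
  have g0 : ∀ z ∉ Q, g z = 0 := fun z hz => indicator_of_notMem hz _
  have G0 : ∀ z ∉ Q, G' z = 0 := fun z hz => indicator_of_notMem hz _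
  have H0 : ∀ z ∉ Q, H' z = 0 := fun z hz => indicator_of_notMem hz _
  have hT' : ∀ᵐ z, ‖H' z‖ ^ 2 ≤ Λ * inner ℝ (G' z) (H' z) ∧
      ‖G' z‖ ^ 2 ≤ Λ * inner ℝ (G' z) (H' z) := by
    have h1 : ∀ᵐ z ∂(volume.restrict Q), ‖H' z‖ ^ 2 ≤ Λ * inner ℝ (G' z) (H' z) ∧
        ‖G' z‖ ^ 2 ≤ Λ * inner ℝ (G' z) (H' z) := by
      filter_upwards [hT, eG, eH] with z h1 h2 h3
      rwa [← h2, ← h3]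
    filter_upwards [(ae_restrict_iff' hQ).1 h1] with z hz
    by_cases hzQ : z ∈ Q
    · exact hz hzQ
    · simp [G0 z hzQ, H0 z hzQ]
  refine ⟨g, G', H', ?_, ⟨hT'.mono fun z h => h.1, hT'.mono fun z h => h.2⟩, fun z => ?_, g0, eg⟩
  · refine ⟨?_, hG2.1.stronglyMeasurable_mk.indicator hQ, hHm.stronglyMeasurable_mk.indicator hQ,
      ?_, ?_, ?_, ?_, ?_⟩
    · exact ((hf2.1.stronglyMeasurable_mk.measurable.min
        measurable_const).stronglyMeasurable).indicator hQ
    · have h := hf2.ae_eq eg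
      rw [← memLp_indicator_iff_restrict hQ] at h
      rwa [hg, indicator_indicator, inter_self] at h
    · have h := hG2.ae_eq eG
      rw [← memLp_indicator_iff_restrict hQ] at h
      rwa [hG', indicator_indicator, inter_self] at h
    · have h := hH2.ae_eq eH
      rw [← memLp_indicator_iff_restrict hQ] at h
      rwa [hH', indicator_indicator, inter_self] at h
    · intro φ hφ e
      rw [← setIntegral_eq_integral_of_ae_eq (Q := Q) (f := fun z => f z * velDeriv φ z e)
          (fun z hz => by rw [g0 z hz, zero_mul]) (eg.mono fun z hz => by simp only [hz]),
        ← setIntegral_eq_integral_of_ae_eq (Q := Q) (f := fun z => inner ℝ (G z) e * φ z)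
          (fun z hz => by rw [G0 z hz, inner_zero_left, zero_mul])
          (eG.mono fun z hz => by simp only [hz])]
      exact hgrad φ hφ e
    · intro φ hφ hφ0
      rw [← setIntegral_eq_integral_of_ae_eq (Q := Q) (f := fun z => f z * transport φ z)
          (fun z hz => by rw [g0 z hz, zero_mul]) (eg.mono fun z hz => by simp only [hz]),
        ← setIntegral_eq_integral_of_ae_eq (Q := Q)
          (f := fun z => velDeriv φ z (Matrix.toEuclideanLin (A z) (G z)))
          (fun z hz => by rw [H0 z hz, velDeriv]; exact map_zero _)
          (eH.mono fun z hz => by simp only [hz])]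
      exact hle φ hφ hφ0
  · by_cases hz : z ∈ Q
    · rw [hg, indicator_of_mem hz]; exact min_le_right _ _
    · rw [g0 z hz]; exact zero_le_one

lemma volume_real_inter_congr {Q P : Set (Z d)} (hQ : MeasurableSet Q) (hP : P ⊆ Q)
    {f g : Z d → ℝ} (h : f =ᵐ[volume.restrict Q] g) (p : ℝ → Prop) :
    volume.real ({z | p (f z)} ∩ P) = volume.real ({z | p (g z)} ∩ P) := by
  refine measureReal_congr ?_
  filter_upwards [(ae_restrict_iff' hQ).1 h] with z hz
  refine propext ⟨fun h1 => ⟨?_, h1.2⟩, fun h1 => ⟨?_, h1.2⟩⟩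
  · show p (g z)
    rw [← hz (hP h1.2)]; exact h1.1
  · show p (f z)
    rw [hz (hP h1.2)]; exact h1.1

lemma cyl_subset_cyl {r s : ℝ} (hr : 0 ≤ r) (h : r ≤ s) : cyl d r ⊆ cyl d s := by
  have h2 : r ^ 2 ≤ s ^ 2 := pow_le_pow_left₀ hr h 2
  exact prod_mono (Ioc_subset_Ioc_left (neg_le_neg h2))
    (prod_mono (Metric.ball_subset_ball (pow_le_pow_left₀ hr h 3)) (Metric.ball_subset_ball h))

lemma pastCyl_subset_cyl : pastCyl d (1 / 20) ⊆ cyl d 2 := by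
  refine prod_mono (fun t ht => ⟨?_, ?_⟩)
    (prod_mono (Metric.ball_subset_ball (by norm_num)) (Metric.ball_subset_ball (by norm_num)))
  · have := ht.1; norm_num at this ⊢; linarith
  · have := ht.2; norm_num at this; linarith

lemma volume_real_cyl_pos {r : ℝ} (hr : 0 < r) : 0 < volume.real (cyl d r) := by
  refine ENNReal.toReal_pos ?_ (volume_cyl_ne_top r)
  have ho : IsOpen (Ioo (-r ^ 2) 0 ×ˢ Metric.ball (0 : E d) (r ^ 3) ×ˢ Metric.ball (0 : E d) r) :=
    isOpen_Ioo.prod (Metric.isOpen_ball.prod Metric.isOpen_ball)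
  refine ((ho.measure_pos volume ?_).trans_le
    (measure_mono (prod_mono Ioo_subset_Ioc_self Subset.rfl))).ne'
  exact (nonempty_Ioo.2 (by nlinarith)).prod
    ((Metric.nonempty_ball.2 (by positivity)).prod (Metric.nonempty_ball.2 hr))

lemma volume_real_pastCyl_pos : 0 < volume.real (pastCyl d (1 / 20)) := by
  refine ENNReal.toReal_pos ?_
    (measure_ne_top_of_subset pastCyl_subset_cyl (volume_cyl_ne_top 2))
  have ho : IsOpen (pastCyl d (1 / 20)) :=
    isOpen_Ioo.prod (Metric.isOpen_ball.prod Metric.isOpen_ball)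
  refine (ho.measure_pos volume ?_).ne'
  exact (nonempty_Ioo.2 (by norm_num)).prod
    ((Metric.nonempty_ball.2 (by norm_num)).prod (Metric.nonempty_ball.2 (by norm_num)))

end

end KineticDeGiorgi

/-! ### Choice of the constants and conclusion -/

theorem lemma4p5 (d : ℕ) (hd : 1 ≤ d) (Λ : ℝ) (hΛ : 0 < Λ) :
    ∃ c : ℝ, 0 < c ∧ c < 1 ∧
      ∀ δ₁ δ₂ : ℝ, 0 < δ₁ → δ₁ < 1 → 0 < δ₂ → δ₂ < 1 →
        ∃ θ ν : ℝ, θ ∈ Set.Ioo (0 : ℝ) 1 ∧ ν ∈ Set.Ioo (0 : ℝ) 1 ∧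
          θ = c * (δ₁ * δ₂) ∧ ν = c * (δ₁ * δ₂) ^ 2 ∧
          ∀ (A : KineticDeGiorgi.Z d → Matrix (Fin d) (Fin d) ℝ)
            (f : KineticDeGiorgi.Z d → ℝ) (r : ℝ), r = 1 / 20 →
            KineticDeGiorgi.IsElliptic Λ (KineticDeGiorgi.cyl d 2) A →
            KineticDeGiorgi.IsWeakSubsolution (KineticDeGiorgi.cyl d 2) A f →
            (∀ᵐ z ∂(MeasureTheory.volume.restrict (KineticDeGiorgi.cyl d 2)), f z ≤ 1) →
            δ₁ * MeasureTheory.volume.real (KineticDeGiorgi.pastCyl d r) ≤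
              MeasureTheory.volume.real ({z | f z ≤ 0} ∩ KineticDeGiorgi.pastCyl d r) →
            δ₂ * MeasureTheory.volume.real (KineticDeGiorgi.cyl d r) ≤
              MeasureTheory.volume.real ({z | 1 - θ ≤ f z} ∩ KineticDeGiorgi.cyl d r) →
            ν * MeasureTheory.volume.real (KineticDeGiorgi.cyl d 1) ≤
              MeasureTheory.volume.real
                ({z | 0 < f z ∧ f z < 1 - θ} ∩ KineticDeGiorgi.cyl d 1) := by
  obtain ⟨κ, C, hκ, hC, hmain⟩ := KineticDeGiorgi.exists_intermediate_value_bound d hΛ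
  have hp := KineticDeGiorgi.volume_real_pastCyl_pos (d := d)
  have hq := KineticDeGiorgi.volume_real_cyl_pos (d := d) (show (0 : ℝ) < 1 / 20 by norm_num)
  have hs := KineticDeGiorgi.volume_real_cyl_pos (d := d) (show (0 : ℝ) < 1 by norm_num)
  set p := MeasureTheory.volume.real (KineticDeGiorgi.pastCyl d (1 / 20)) with hp_def
  set q := MeasureTheory.volume.real (KineticDeGiorgi.cyl d (1 / 20)) with hq_def
  set s := MeasureTheory.volume.real (KineticDeGiorgi.cyl d 1) with hs_def
  -- After absorption the inequality reads √V ≥ b δ₁δ₂: one factor 1/2 is lost to the term Cθ on the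
  -- left, another to the one on the right.
  set b := κ * p * q / (4 * C) with hb_def
  have hb : 0 < b := by positivity
  -- In order: θ and ν are below 1; Cθ is at most half of κpδ₁; θ ≤ b δ₁δ₂, for the term on the
  -- right; and ν|Q_1| ≤ (b δ₁δ₂)².
  set c := min (1 / 2) (min (κ * p / (2 * C)) (min b (b ^ 2 / s))) with hc_def
  have hc : 0 < c := by positivity
  have hc1 : c ≤ 1 / 2 := min_le_left _ _
  have hc2 : C * c ≤ κ * p / 2 := by
    have h : c ≤ κ * p / (2 * C) := (min_le_right _ _).trans (min_le_left _ _)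
    rw [le_div_iff₀ (by positivity)] at h
    linarith
  have hCb : C * b = κ * p * q / 4 := by rw [hb_def]; field_simp
  have hc3 : c ≤ b := (min_le_right _ _).trans ((min_le_right _ _).trans (min_le_left _ _))
  have hc4 : c * s ≤ b ^ 2 := by
    have h : c ≤ b ^ 2 / s := (min_le_right _ _).trans ((min_le_right _ _).trans (min_le_right _ _))
    rwa [le_div_iff₀ hs] at h
  refine ⟨c, hc, by linarith, fun δ₁ δ₂ h₁ h₁' h₂ h₂' => ?_⟩
  have hδ : 0 < δ₁ * δ₂ := mul_pos h₁ h₂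
  have hδ₁ : δ₁ * δ₂ ≤ δ₁ := mul_le_of_le_one_right h₁.le h₂'.le
  have hδ1 : δ₁ * δ₂ < 1 := hδ₁.trans_lt h₁'
  have hθ : c * (δ₁ * δ₂) ∈ Set.Ioo (0 : ℝ) 1 := ⟨by positivity, by nlinarith⟩
  refine ⟨c * (δ₁ * δ₂), c * (δ₁ * δ₂) ^ 2, hθ, ⟨by positivity, ?_⟩, rfl, rfl, ?_⟩
  · have : (δ₁ * δ₂) ^ 2 ≤ 1 := pow_le_one₀ hδ.le hδ1.le
    nlinarith
  rintro A f r rfl hA hf hf1 hP hS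
  have hQ := KineticDeGiorgi.measurableSet_cyl (d := d) 2
  obtain ⟨g, G, H, hsub, hell, hg1, hg0, hfg⟩ := hf.exists_extension hΛ hQ hA hf1
  have key := hmain g G H hsub hell hg1 hg0 _ hθ
  rw [KineticDeGiorgi.volume_real_inter_congr hQ KineticDeGiorgi.pastCyl_subset_cyl hfg
    fun x => x ≤ 0] at hP
  rw [KineticDeGiorgi.volume_real_inter_congr hQ
    (KineticDeGiorgi.cyl_subset_cyl (by norm_num) (by norm_num)) hfg
    fun x => 1 - c * (δ₁ * δ₂) ≤ x] at hS
  rw [KineticDeGiorgi.volume_real_inter_congr hQ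
    (KineticDeGiorgi.cyl_subset_cyl (by norm_num) (by norm_num)) hfg
    fun x => 0 < x ∧ x < 1 - c * (δ₁ * δ₂)]
  set V := MeasureTheory.volume.real
    ({z | 0 < g z ∧ g z < 1 - c * (δ₁ * δ₂)} ∩ KineticDeGiorgi.cyl d 1)
  have hV : 0 ≤ V := MeasureTheory.measureReal_nonneg
  have e1 : κ * p / 2 * δ₁ ≤ κ * MeasureTheory.volume.real
      ({z | g z ≤ 0} ∩ KineticDeGiorgi.pastCyl d (1 / 20)) - C * (c * (δ₁ * δ₂)) := by
    have a1 := mul_le_mul_of_nonneg_left hP hκ.le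
    have a2 : C * (c * (δ₁ * δ₂)) ≤ κ * p / 2 * δ₁ := by
      rw [← mul_assoc]
      exact mul_le_mul hc2 hδ₁ hδ.le (by positivity)
    linarith
  have e2 : κ * p / 2 * δ₁ * (δ₂ * q) ≤ C * (√V + c * (δ₁ * δ₂)) :=
    (mul_le_mul e1 hS (by positivity) ((by positivity : 0 ≤ κ * p / 2 * δ₁).trans e1)).trans key
  have e3 : C * (c * (δ₁ * δ₂)) ≤ C * b * (δ₁ * δ₂) := by
    rw [← mul_assoc]
    exact mul_le_mul_of_nonneg_right (mul_le_mul_of_nonneg_left hc3 hC.le) hδ.le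
  have e4 : C * (b * (δ₁ * δ₂)) ≤ C * √V := by
    rw [← mul_assoc]
    linear_combination e2 + e3 + 2 * (δ₁ * δ₂) * hCb
  have e5 : b * (δ₁ * δ₂) ≤ √V := le_of_mul_le_mul_left e4 hC
  calc c * (δ₁ * δ₂) ^ 2 * s = c * s * (δ₁ * δ₂) ^ 2 := by ring
    _ ≤ b ^ 2 * (δ₁ * δ₂) ^ 2 := by gcongr
    _ = (b * (δ₁ * δ₂)) ^ 2 := by ring
    _ ≤ √V ^ 2 := by gcongr
    _ = V := Real.sq_sqrt hV
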